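/- **Setting.** Signatures are multi-sorted with equality, and every sort of a structure is nonempty. A *DB schema* $\langle\Sigma,T\rangle$ consists of a finite signature $\Sigma$ whose only symbols are equality, unary functions and constants, in which some leaves (sorts that are not the source of a function) are designated as value sorts, the other sorts being id sorts, and of a set $T$ of universal $\Sigma$-sentences. A *DB instance* is a model of $T$ in which every id sort is finite. A *constraint* is a conjunction of literals. The following is assumed. * It is decidable whether a quantifier-free $\Sigma$-formula is satisfiable in a model of $T$. * Every constraint satisfiable in a model of $T$ is satisfiable in a DB instance. * $T^*$ is a *model completion* of $T$: a set of $\Sigma$-sentences with $T^*\supseteq T$ such that every constraint satisfiable in a model of $T$ is satisfiable in a model of $T^*$, and such that there is an algorithm turning each $\Sigma$-formula $\phi(\underline x)$ into a quantifier-free $\phi'(\underline x)$ with $T^*\models\phi\leftrightarrow\phi'$. Let $\Sigma_{ext}$ extend $\Sigma$ by finitely many new *artifact sorts* (the sorts of $\Sigma$ are called *basic*). A $\Sigma_{ext}$-structure is called a model of $T$, a DB instance, or a model of $T^*$ if its reduct to $\Sigma$ is one. Let $\underline x$ be finitely many individual variables of basic sorts and $\underline a$ finitely many unary function variables, each from an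 artifact sort to a basic sort. A *Relational Artifact System* $\mathcal S$ over these data is given by an initial formula $$\iota=\bigwedge_i x_i=c_i\wedge\bigwedge_j\forall y\,a_j(y)=d_j,$$ with constants $c_i,d_j$ of $\Sigma$, and a finite disjunction $\tau$ of transition formulae $$\exists\underline e\,\Big(\gamma(\underline e,\underline x,\underline a)\wedge\bigwedge_i x'_i=F_i(\underline e,\underline x,\underline a)\wedge\bigwedge_j\forall y\,a'_j(y)=G_j(y,\underline e,\underline x,\underline a)\Big),$$ where the $\underline e$ are of basic or artifact sorts, $\gamma$ is quantifier-free and $F_i,G_j$ are case-defined functions (finitely many quantifier-free cases which, in all models of $T$, are exhaustive and mutually exclusive, with a term for each case). A *state formula* is a formula $\exists\underline e\,\phi(\underline e,\underline x,\underline a)$, and an *$\exists\forall$-formula* is a formula $\exists\underline e\,\forall\underline i\,\phi(\underline e,\underline i,\underline x,\underline a)$, where $\phi$ is quantifier-free and $\underline e,\underline i$ are of artifact sorts. $\mathcal S$ is *safe* with respect to a state formula $\upsilon$ if there are no DB instance of $\Sigma_{ext}$, no $k\ge0$ and no values of $\underline x^0,\underline a^0,\dots,\underline x^k,\underline a^k$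 in it making $$\iota(\underline x^0,\underline a^0)\wedge\tau(\underline x^0,\underline a^0,\underline x^1,\underline a^1)\wedge\dots\wedge\tau(\underline x^{k-1},\underline a^{k-1},\underline x^k,\underline a^k)\wedge\upsilon(\underline x^k,\underline a^k)$$ true. A formula is *$T$-satisfiable* if it is true in a $\Sigma_{ext}$-model of $T$ for some values of $\underline x,\underline a$. Put $\mathit{Pre}(\tau,\phi)=\exists\underline x'\exists\underline a'(\tau(\underline x,\underline a,\underline x',\underline a')\wedge\phi(\underline x',\underline a'))$. A *preimage procedure* maps each state formula $\phi$ to a state formula equivalent to $\mathit{Pre}(\tau,\phi)$ in all $\Sigma_{ext}$-models of $T^*$. *Backward search* on input $\upsilon$, with a given preimage procedure, starts with $\phi:=\upsilon$, $B:=\bot$. While $\phi\wedge\neg B$ is $T$-satisfiable, it returns "unsafe" if $\iota\wedge\phi$ is $T$-satisfiable, and otherwise replaces $B$ by $\phi\vee B$ and then $\phi$ by the value of the preimage procedure at $\phi$. When the loop condition fails, it returns "(safe, $B$)". **Theorem 4.2.** Under these assumptions, for every Relational Artifact System $\mathcal S$: 1. (Effectiveness) The $T$-satisfiability of $\phi\wedge\neg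 B$, for $\phi$ a state formula and $B$ a finite disjunction of state formulae, and of $\iota\wedge\phi$, for $\phi$ a state formula, are decidable, and there is a computable preimage procedure. 2. (Partial correctness) For every preimage procedure and every state formula $\upsilon$: if backward search returns "unsafe" then $\mathcal S$ is not safe with respect to $\upsilon$, and if it returns "(safe, $B$)" then $\mathcal S$ is safe with respect to $\upsilon$. 3. An $\exists\forall$-formula is satisfiable in a $\Sigma_{ext}$-model of $T$ iff it is satisfiable in a DB instance of $\Sigma_{ext}$, iff it is satisfiable in a $\Sigma_{ext}$-model of $T^*$. It is decidable whether a given $\exists\forall$-formula is so satisfiable. -/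

import Mathlib

namespace Artifact

/-! ## Signatures, terms and formulae -/

/-- A finite multi-sorted signature whose only symbols are equality (at every sort), unary functions
and constants: `Fn s s'` is the set of function symbols with source `s` and target `s'`, and `Cst s`
the set of constants of sort `s`. The symbols are numbered by `Encodable` instances, so that formulae
can be handed to algorithms (the sets of symbols being finite, the numbering is immaterial). -/
structure Sig where
  Srt : Type
  Fn : Srt → Srt → Type
  Cst : Srt → Type
  [srtFinite : Finite Srt]
  [fnFinite : ∀ s s', Finite (Fn s s')]
  [cstFinite : ∀ s, Finite (Cst s)]
  [srtEnc : Encodable Srt]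
  [fnEnc : ∀ s s', Encodable (Fn s s')]
  [cstEnc : ∀ s, Encodable (Cst s)]

attribute [instance] Sig.srtFinite Sig.fnFinite Sig.cstFinite Sig.srtEnc Sig.fnEnc Sig.cstEnc

/-- Individual variables: countably many of every sort. -/
abbrev Sig.Var (L : Sig) : Type := L.Srt × ℕ

/-- Well-sorted terms. -/
inductive Term (L : Sig) : L.Srt → Type
  | var (s : L.Srt) (n : ℕ) : Term L s
  | cst {s : L.Srt} (c : L.Cst s) : Term L s
  | app {s s' : L.Srt} (f : L.Fn s s') (t : Term L s) : Term L s'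

/-- Well-sorted first-order formulae. -/
inductive Fml (L : Sig) : Type
  | fls : Fml L
  | eq {s : L.Srt} (t u : Term L s) : Fml L
  | neg (φ : Fml L) : Fml L
  | and (φ ψ : Fml L) : Fml L
  | ex (x : L.Var) (φ : Fml L) : Fml L

/-- Individual variables of a term. -/
def Term.vars {L : Sig} : {s : L.Srt} → Term L s → Set L.Var
  | _, .var s n => {(s, n)}
  | _, .cst _ => ∅
  | _, .app _ t => t.vars

namespace Fml

variable {L : Sig}

def or (φ ψ : Fml L) : Fml L := neg (and (neg φ) (neg ψ))

def all (x : L.Var) (φ : Fml L) : Fml L := neg (ex x (neg φ))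

/-- `∃ x₁ ⋯ ∃ xₙ φ`. -/
def exs (xs : List L.Var) (φ : Fml L) : Fml L := xs.foldr ex φ

/-- `∀ x₁ ⋯ ∀ xₙ φ`. -/
def alls (xs : List L.Var) (φ : Fml L) : Fml L := xs.foldr all φ

/-- Free individual variables. -/
def fv : Fml L → Set L.Var
  | fls => ∅
  | eq t u => t.vars ∪ u.vars
  | neg φ => φ.fv
  | and φ ψ => φ.fv ∪ ψ.fv
  | ex x φ => φ.fv \ {x}

/-- Quantifier-free formulae. -/
def IsQF : Fml L → Prop
  | fls => True
  | eq _ _ => True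
  | neg φ => φ.IsQF
  | and φ ψ => φ.IsQF ∧ ψ.IsQF
  | ex _ _ => False

/-- Constraints: conjunctions of literals (`⊤`, written `neg fls`, is the empty conjunction). -/
inductive IsConstraint : Fml L → Prop
  | top : IsConstraint (neg fls)
  | pos {s : L.Srt} (t u : Term L s) : IsConstraint (eq t u)
  | neg {s : L.Srt} (t u : Term L s) : IsConstraint (neg (eq t u))
  | and {φ ψ : Fml L} : IsConstraint φ → IsConstraint ψ → IsConstraint (and φ ψ)

/-- Universal sentences `∀ x̲ φ`, with `φ` quantifier-free. -/
def IsUniversalSentence (χ : Fml L) : Prop :=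
  ∃ (xs : List L.Var) (φ : Fml L), φ.IsQF ∧ χ = alls xs φ ∧ χ.fv = ∅

end Fml

/-! ## Structures and truth -/

/-- Many-sorted structures. As usual in first-order logic, every sort is interpreted in a nonempty
set. -/
structure Struc (L : Sig) where
  carrier : L.Srt → Type
  nonempty : ∀ s, Nonempty (carrier s)
  fn : ∀ {s s' : L.Srt}, L.Fn s s' → carrier s → carrier s'
  cst : ∀ {s : L.Srt}, L.Cst s → carrier s

/-- Assignments of elements to the individual variables. -/
abbrev Struc.Assign {L : Sig} (M : Struc L) : Type := ∀ s : L.Srt, ℕ → M.carrier s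

open Classical in
/-- The assignment `v[x ↦ d]`. -/
noncomputable def Struc.upd {L : Sig} (M : Struc L) (v : M.Assign) (x : L.Var)
    (d : M.carrier x.1) : M.Assign :=
  Function.update v x.1 (Function.update (v x.1) x.2 d)

def Term.eval {L : Sig} (M : Struc L) (v : M.Assign) : {s : L.Srt} → Term L s → M.carrier s
  | _, .var s n => v s n
  | _, .cst c => M.cst c
  | _, .app f t => M.fn f (t.eval M v)

/-- `M, v ⊨ φ`. -/
def Struc.Realize {L : Sig} (M : Struc L) : M.Assign → Fml L → Prop
  | _, .fls => False
  | v, .eq t u => t.eval M v = u.eval M v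
  | v, .neg φ => ¬ M.Realize v φ
  | v, .and φ ψ => M.Realize v φ ∧ M.Realize v ψ
  | v, .ex x φ => ∃ d : M.carrier x.1, M.Realize (M.upd v x d) φ

/-- `M ⊨ φ` (for all values of the variables that may be free in `φ`). -/
def Struc.True {L : Sig} (M : Struc L) (φ : Fml L) : Prop := ∀ v : M.Assign, M.Realize v φ

/-- `M` is a model of the theory `T`. -/
def Struc.Models {L : Sig} (M : Struc L) (T : Set (Fml L)) : Prop := ∀ φ ∈ T, M.True φ

/-! ## Algorithms on formulae -/

/-- Gödel number of a term. -/
def Term.code {L : Sig} : {s : L.Srt} → Term L s → ℕ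
  | _, .var s n => Nat.pair 0 (Nat.pair (Encodable.encode s) n)
  | _, .cst (s := s) c => Nat.pair 1 (Nat.pair (Encodable.encode s) (Encodable.encode c))
  | _, .app (s := s) (s' := s') f t =>
      Nat.pair 2 (Nat.pair (Nat.pair (Encodable.encode s) (Encodable.encode s'))
        (Nat.pair (Encodable.encode f) t.code))

/-- Gödel number of a formula. -/
def Fml.code {L : Sig} : Fml L → ℕ
  | .fls => Nat.pair 0 0
  | .eq (s := s) t u => Nat.pair 1 (Nat.pair (Encodable.encode s) (Nat.pair t.code u.code))
  | .neg φ => Nat.pair 2 φ.code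
  | .and φ ψ => Nat.pair 3 (Nat.pair φ.code ψ.code)
  | .ex x φ => Nat.pair 4 (Nat.pair (Nat.pair (Encodable.encode x.1) x.2) φ.code)

theorem Term.code_injective {L : Sig} {s : L.Srt} (t u : Term L s) (h : t.code = u.code) :
    t = u := by
  induction t with
  | var s n => cases u <;> simp_all [Term.code, Nat.pair_eq_pair]
  | cst c => cases u <;> simp_all [Term.code, Nat.pair_eq_pair]
  | app f t ih =>
    cases u with
    | var n => simp [Term.code, Nat.pair_eq_pair] at h
    | cst c => simp [Term.code, Nat.pair_eq_pair] at h
    | app g u =>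
      simp only [Term.code, Nat.pair_eq_pair, Encodable.encode_inj, true_and, and_true] at h
      obtain ⟨h1, h2, h3⟩ := h
      subst h1
      rw [Encodable.encode_inj] at h2
      rw [h2, ih u h3]

/-- Distinct formulae have distinct Gödel numbers. -/
theorem Fml.code_injective {L : Sig} (φ ψ : Fml L) (h : φ.code = ψ.code) : φ = ψ := by
  induction φ generalizing ψ with
  | fls => cases ψ <;> simp_all [Fml.code, Nat.pair_eq_pair]
  | eq t u =>
    cases ψ <;> simp only [Fml.code, Nat.pair_eq_pair, Encodable.encode_inj] at h <;>
      try omega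
    obtain ⟨-, h1, h2, h3⟩ := h
    subst h1
    rw [Term.code_injective _ _ h2, Term.code_injective _ _ h3]
  | neg φ ih =>
    cases ψ <;> simp only [Fml.code, Nat.pair_eq_pair] at h <;> try omega
    rw [ih _ h.2]
  | and φ χ ih1 ih2 =>
    cases ψ <;> simp only [Fml.code, Nat.pair_eq_pair] at h <;> try omega
    rw [ih1 _ h.2.1, ih2 _ h.2.2]
  | ex x φ ih =>
    cases ψ <;> simp only [Fml.code, Nat.pair_eq_pair, Encodable.encode_inj] at h <;> try omega
    rw [ih _ h.2.2, Prod.ext h.2.1.1 h.2.1.2]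

/-- There is an algorithm that decides, for every input formula in the class `D`, whether `Q`
holds of it. -/
def DecidableOn {L : Sig} (D Q : Fml L → Prop) : Prop :=
  ∃ g : ℕ → Bool, Computable g ∧ ∀ φ, D φ → (g φ.code = true ↔ Q φ)

/-- There is an algorithm that computes `f φ` for every input formula `φ` in the class `D`. -/
def ComputableOn {L L' : Sig} (D : Fml L → Prop) (f : Fml L → Fml L') : Prop :=
  ∃ g : ℕ → ℕ, Computable g ∧ ∀ φ, D φ → g φ.code = (f φ).code

/-! ## DB schemas -/

/-- A DB schema `⟨Σ, T⟩`: a DB signature, in which some of the leaves (sorts that are not the source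
of any function symbol) are singled out as value sorts, the other sorts being id sorts, and a DB
theory, that is, a set of universal sentences. -/
structure DBSchema where
  sig : Sig
  valueSorts : Set sig.Srt
  value_leaf : ∀ s ∈ valueSorts, ∀ s', IsEmpty (sig.Fn s s')
  T : Set (Fml sig)
  universal : ∀ φ ∈ T, φ.IsUniversalSentence

/-- A DB instance: a model of the DB theory in which every id sort is finite. -/
def DBSchema.IsInstance (𝒟 : DBSchema) (M : Struc 𝒟.sig) : Prop :=
  M.Models 𝒟.T ∧ ∀ s ∉ 𝒟.valueSorts, Finite (M.carrier s)

/-- `φ` is satisfiable (for some values of its free variables) in some structure in the class `𝒦`. -/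
def SatIn {L : Sig} (𝒦 : Struc L → Prop) (φ : Fml L) : Prop :=
  ∃ M, 𝒦 M ∧ ∃ v : M.Assign, M.Realize v φ

/-- The constraint satisfiability problem for the DB theory is decidable: given a quantifier-free
formula `φ(x̲, y̲)`, one can decide whether `∃ y̲ φ(x̲, y̲)`, or equivalently `φ`, is satisfiable in a
model of the theory. -/
def DBSchema.DecidableConstraintSat (𝒟 : DBSchema) : Prop :=
  DecidableOn Fml.IsQF (SatIn fun M => M.Models 𝒟.T)

/-- The finite model property (for constraint satisfiability). -/
def DBSchema.FiniteModelProperty (𝒟 : DBSchema) : Prop :=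
  ∀ φ : Fml 𝒟.sig, φ.IsConstraint → SatIn (fun M => M.Models 𝒟.T) φ → SatIn 𝒟.IsInstance φ

/-- (Effective) quantifier elimination: there is an algorithm that turns every formula `φ(x̲)` into a
quantifier-free formula `φ'(x̲)` which is equivalent to it in all models of `T`. -/
def HasEffectiveQE {L : Sig} (T : Set (Fml L)) : Prop :=
  ∃ qe : Fml L → Fml L, ComputableOn (fun _ => True) qe ∧
    ∀ φ, (qe φ).IsQF ∧ (qe φ).fv ⊆ φ.fv ∧
      ∀ M : Struc L, M.Models T → ∀ v : M.Assign, (M.Realize v φ ↔ M.Realize v (qe φ))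

/-- `Tstar` is a model completion of `T`: a set of sentences containing `T` that has (effective)
quantifier elimination, and such that every constraint satisfiable in a model of `T` is satisfiable
in a model of `Tstar`. -/
structure IsModelCompletion {L : Sig} (T Tstar : Set (Fml L)) : Prop where
  sentences : ∀ φ ∈ Tstar, φ.fv = ∅
  subset : T ⊆ Tstar
  conservative : ∀ φ : Fml L, φ.IsConstraint →
    SatIn (fun M => M.Models T) φ → SatIn (fun M => M.Models Tstar) φ
  qe : HasEffectiveQE Tstar

/-! ## Artifact settings -/

/-- An artifact extension of the signature `L` together with an artifact setting `(x̲, a̲)` over it: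
finitely many artifact sorts `ASrt`, finitely many artifact variables (`X s` is the set of those of
sort `s`; their sorts are basic, since their initial values are constants of `L`), and finitely many
artifact components (`A E s` is the set of those with source the artifact sort `E` and target the
basic sort `s`). -/
structure Setting (L : Sig) where
  ASrt : Type
  X : L.Srt → Type
  A : ASrt → L.Srt → Type
  [asrtFinite : Finite ASrt]
  [xFinite : ∀ s, Finite (X s)]
  [aFinite : ∀ E s, Finite (A E s)]
  [asrtEnc : Encodable ASrt]
  [xEnc : ∀ s, Encodable (X s)]
  [aEnc : ∀ E s, Encodable (A E s)]

attribute [instance] Setting.asrtFinite Setting.xFinite Setting.aFinite Setting.asrtEnc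
  Setting.xEnc Setting.aEnc

namespace Setting

variable {L : Sig} (W : Setting L)

/-- Unary function symbols of `Setting.sig`. -/
def Fn : L.Srt ⊕ W.ASrt → L.Srt ⊕ W.ASrt → Type
  | .inl s, .inl s' => L.Fn s s'
  | .inr E, .inl s' => W.A E s'
  | _, .inr _ => Empty

/-- Nullary symbols of `Setting.sig`. -/
def Cst : L.Srt ⊕ W.ASrt → Type
  | .inl s => L.Cst s ⊕ W.X s
  | .inr _ => Empty

instance fnFinite : ∀ s s', Finite (W.Fn s s')
  | .inl s, .inl s' => inferInstanceAs (Finite (L.Fn s s'))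
  | .inr E, .inl s' => inferInstanceAs (Finite (W.A E s'))
  | .inl _, .inr _ => inferInstanceAs (Finite Empty)
  | .inr _, .inr _ => inferInstanceAs (Finite Empty)

instance cstFinite : ∀ s, Finite (W.Cst s)
  | .inl s => inferInstanceAs (Finite (L.Cst s ⊕ W.X s))
  | .inr _ => inferInstanceAs (Finite Empty)

instance fnEnc : ∀ s s', Encodable (W.Fn s s')
  | .inl s, .inl s' => inferInstanceAs (Encodable (L.Fn s s'))
  | .inr E, .inl s' => inferInstanceAs (Encodable (W.A E s'))
  | .inl _, .inr _ => inferInstanceAs (Encodable Empty)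
  | .inr _, .inr _ => inferInstanceAs (Encodable Empty)

instance cstEnc : ∀ s, Encodable (W.Cst s)
  | .inl s => inferInstanceAs (Encodable (L.Cst s ⊕ W.X s))
  | .inr _ => inferInstanceAs (Encodable Empty)

/-- The signature in which the formulae `φ(e̲, x̲, a̲)` are written: the artifact extension of `L` (basic
sorts on the left, artifact sorts on the right), with the artifact variables `x̲` as additional nullary
symbols and the artifact components `a̲` as additional unary function symbols. Thus the values of
`x̲, a̲` are part of the interpretation, and the individual variables of such a formula are the `e̲`. -/
def sig : Sig where
  Srt := L.Srt ⊕ W.ASrt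
  Fn := W.Fn
  Cst := W.Cst

/-- A structure for the artifact extension of `L`: an `L`-structure `db` (its reduct to `L`), and a
nonempty set for every artifact sort. -/
structure ExtStruc where
  db : Struc L
  entries : W.ASrt → Type
  nonempty : ∀ E, Nonempty (entries E)

variable {W}

/-- An assignment to the artifact setting `(x̲, a̲)` in `M`. -/
structure Assignment (M : W.ExtStruc) where
  x : ∀ {s : L.Srt}, W.X s → M.db.carrier s
  a : ∀ {E : W.ASrt} {s : L.Srt}, W.A E s → M.entries E → M.db.carrier s

/-- The structure `(M, α)`, in which formulae `φ(e̲, x̲, a̲)` are evaluated. -/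
def ExtStruc.withAssignment (M : W.ExtStruc) (α : Assignment M) : Struc W.sig where
  carrier := Sum.elim M.db.carrier M.entries
  nonempty
    | .inl s => M.db.nonempty s
    | .inr E => M.nonempty E
  fn {s s'} f := match s, s', f with
    | .inl _, .inl _, f => M.db.fn f
    | .inr _, .inl _, a => α.a a
    | .inl _, .inr _, f => Empty.elim f
    | .inr _, .inr _, f => Empty.elim f
  cst {s} c := match s, c with
    | .inl _, .inl c => M.db.cst c
    | .inl _, .inr x => α.x x
    | .inr _, c => Empty.elim c

/-- `M, α ⊨ φ(x̲, a̲)`. -/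
def ExtStruc.Holds (M : W.ExtStruc) (α : Assignment M) (φ : Fml W.sig) : Prop :=
  (M.withAssignment α).True φ

variable (W)

/-- All the variables in the list are of artifact sorts. -/
def AreArtifactVars (es : List W.sig.Var) : Prop := ∀ e ∈ es, ∃ E : W.ASrt, e.1 = Sum.inr E

/-- State formulae `∃ e̲ φ(e̲, x̲, a̲)`: `φ` is quantifier-free and the `e̲` are of artifact sorts. -/
def IsState (χ : Fml W.sig) : Prop :=
  ∃ (es : List W.sig.Var) (φ : Fml W.sig),
    W.AreArtifactVars es ∧ φ.IsQF ∧ χ = Fml.exs es φ ∧ χ.fv = ∅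

/-- Finite disjunctions of state formulae. -/
inductive IsStateDisj : Fml W.sig → Prop
  | bot : IsStateDisj Fml.fls
  | or {φ B : Fml W.sig} : W.IsState φ → IsStateDisj B → IsStateDisj (Fml.or φ B)

/-- `∃∀`-formulae `∃ e̲ ∀ i̲ φ(e̲, i̲, x̲, a̲)`: `φ` is quantifier-free and `e̲, i̲` are of artifact sorts. -/
def IsExAll (χ : Fml W.sig) : Prop :=
  ∃ (es is : List W.sig.Var) (φ : Fml W.sig), W.AreArtifactVars es ∧ W.AreArtifactVars is ∧
    φ.IsQF ∧ χ = Fml.exs es (Fml.alls is φ) ∧ χ.fv = ∅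

/-- `φ(x̲, a̲)` is satisfiable, under some assignment to `(x̲, a̲)`, in a structure for the artifact
extension whose reduct belongs to the class `𝒦`. -/
def ExtSatIn (𝒦 : Struc L → Prop) (φ : Fml W.sig) : Prop :=
  ∃ M : W.ExtStruc, 𝒦 M.db ∧ ∃ α : Assignment M, M.Holds α φ

/-- A case-defined function with values of the basic sort `s`: quantifier-free formulae `κ₁, …, κₙ`
that form a `T`-partition, and for each of them a term, which gives the value of the function where
`κᵢ` holds. -/
structure CaseDef (T : Set (Fml L)) (s : L.Srt) where
  cases : List (Fml W.sig × Term W.sig (Sum.inl s))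
  qf : ∀ p ∈ cases, p.1.IsQF
  exhaustive : ∀ M : W.ExtStruc, M.db.Models T → ∀ (α : Assignment M)
    (v : (M.withAssignment α).Assign), ∃ p ∈ cases, (M.withAssignment α).Realize v p.1
  disjoint : cases.Pairwise fun p q => ∀ M : W.ExtStruc, M.db.Models T → ∀ (α : Assignment M)
    (v : (M.withAssignment α).Assign),
      ¬ ((M.withAssignment α).Realize v p.1 ∧ (M.withAssignment α).Realize v q.1)

/-- `b = F(⋯)`, for the case-defined function `F`, under the given values of the variables. -/
def CaseDef.IsValue {W : Setting L} {T : Set (Fml L)} {s : L.Srt} (F : W.CaseDef T s)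
    {M : W.ExtStruc} (α : Assignment M) (v : (M.withAssignment α).Assign)
    (b : M.db.carrier s) : Prop :=
  ∀ p ∈ F.cases, (M.withAssignment α).Realize v p.1 → b = p.2.eval (M.withAssignment α) v

/-- Transition formulae
`∃ e̲ (γ(e̲, x̲, a̲) ∧ ⋀ᵢ x'ᵢ = Fᵢ(e̲, x̲, a̲) ∧ ⋀ⱼ a'ⱼ = λ y. Gⱼ(y, e̲, x̲, a̲))`.
Here `γ` is quantifier-free, the `Fᵢ` and `Gⱼ` are case-defined, and the bound variable `y` of the
`j`-th abstraction is the variable number `y j` of the source sort of `aⱼ`. The individual variables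
that occur in these data, of basic or artifact sorts and finite in number, are the `e̲` (except for
the `y` bound in `Gⱼ`). -/
structure Transition (T : Set (Fml L)) where
  guard : Fml W.sig
  guard_qf : guard.IsQF
  F : ∀ {s : L.Srt}, W.X s → W.CaseDef T s
  y : ∀ {E : W.ASrt} {s : L.Srt}, W.A E s → ℕ
  G : ∀ {E : W.ASrt} {s : L.Srt}, W.A E s → W.CaseDef T s

/-- Truth in `M` of the transition formula at `(x̲, a̲) = α`, `(x̲', a̲') = α'`. The total assignment `v`
supplies the values of the `e̲`. -/
def Transition.Holds {W : Setting L} {T : Set (Fml L)} (t : W.Transition T) (M : W.ExtStruc)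
    (α α' : Assignment M) : Prop :=
  ∃ v : (M.withAssignment α).Assign,
    (M.withAssignment α).Realize v t.guard ∧
    (∀ {s : L.Srt} (x : W.X s), (t.F x).IsValue α v (α'.x x)) ∧
    (∀ {E : W.ASrt} {s : L.Srt} (a : W.A E s) (d : M.entries E),
      (t.G a).IsValue α
        ((M.withAssignment α).upd v ((Sum.inr E, t.y a) : W.sig.Var) d) (α'.a a d))

end Setting

/-! ## Relational artifact systems and their safety problem -/

/-- A relational artifact system. The initial formula is
`(⋀ᵢ xᵢ = cᵢ) ∧ (⋀ⱼ aⱼ = λ y. dⱼ)`, with constants `cᵢ`, `dⱼ` of the DB signature, and `τ` is the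
disjunction of a finite list of transition formulae. -/
structure RAS where
  schema : DBSchema
  setting : Setting schema.sig
  c : ∀ {s : schema.sig.Srt}, setting.X s → schema.sig.Cst s
  d : ∀ {E : setting.ASrt} {s : schema.sig.Srt}, setting.A E s → schema.sig.Cst s
  τ : List (setting.Transition schema.T)

namespace RAS

variable (S : RAS)

/-- The initial formula `ι` holds at `α`. -/
def Init (M : S.setting.ExtStruc) (α : Setting.Assignment M) : Prop :=
  (∀ {s} (x : S.setting.X s), α.x x = M.db.cst (S.c x)) ∧
  (∀ {E s} (a : S.setting.A E s) (e : M.entries E), α.a a e = M.db.cst (S.d a))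

/-- The formula `τ` holds at `α, α'`. -/
def Step (M : S.setting.ExtStruc) (α α' : Setting.Assignment M) : Prop :=
  ∃ t ∈ S.τ, t.Holds M α α'

/-- `S` is safe with respect to `υ`: there are no DB instance of the artifact extension, no `k`, and
no assignments such that
`ι(x̲⁰, a̲⁰) ∧ τ(x̲⁰, a̲⁰, x̲¹, a̲¹) ∧ ⋯ ∧ τ(x̲ᵏ⁻¹, a̲ᵏ⁻¹, x̲ᵏ, a̲ᵏ) ∧ υ(x̲ᵏ, a̲ᵏ)` is true. -/
def Safe (υ : Fml S.setting.sig) : Prop :=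
  ¬ ∃ M : S.setting.ExtStruc, S.schema.IsInstance M.db ∧
    ∃ (k : ℕ) (α : ℕ → Setting.Assignment M),
      S.Init M (α 0) ∧ (∀ i < k, S.Step M (α i) (α (i + 1))) ∧ M.Holds (α k) υ

/-- The formula `Pre(τ, φ) = ∃ x̲' ∃ a̲' (τ(x̲, a̲, x̲', a̲') ∧ φ(x̲', a̲'))` holds at `α`. -/
def Pre (φ : Fml S.setting.sig) (M : S.setting.ExtStruc) (α : Setting.Assignment M) : Prop :=
  ∃ α' : Setting.Assignment M, S.Step M α α' ∧ M.Holds α' φ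

/-- `T`-satisfiability of a formula `φ(x̲, a̲)`. -/
def TSat (φ : Fml S.setting.sig) : Prop :=
  S.setting.ExtSatIn (fun N => N.Models S.schema.T) φ

/-- `T`-satisfiability of `ι ∧ φ`. -/
def InitTSat (φ : Fml S.setting.sig) : Prop :=
  ∃ M : S.setting.ExtStruc, M.db.Models S.schema.T ∧
    ∃ α : Setting.Assignment M, S.Init M α ∧ M.Holds α φ

/-! ## Backward search -/

/-- `pq` is a correct subprocedure `φ ↦ QE(Tstar, Pre(τ, φ))`: it turns the preimage of a state
formula into a state formula equivalent to it in all models of `Tstar` (over the artifact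
extension). -/
def IsPreimageProcedure (Tstar : Set (Fml S.schema.sig))
    (pq : Fml S.setting.sig → Fml S.setting.sig) : Prop :=
  ∀ φ, S.setting.IsState φ → S.setting.IsState (pq φ) ∧
    ∀ M : S.setting.ExtStruc, M.db.Models Tstar → ∀ α : Setting.Assignment M,
      (M.Holds α (pq φ) ↔ S.Pre φ M α)

/-- Answers of backward search. -/
inductive Answer
  | unsafeAnswer : Answer
  | safeAnswer (B : Fml S.setting.sig) : Answer

variable {S} in
/-- `Loop pq φ B r`: when it is entered with the given values of `φ` and `B`, the loop
```
while φ ∧ ¬B is T-satisfiable do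
  if ι ∧ φ is T-satisfiable then return unsafe
  B := φ ∨ B
  φ := pq φ
return (safe, B)
```
terminates with the answer `r`. -/
inductive Loop (pq : Fml S.setting.sig → Fml S.setting.sig) :
    Fml S.setting.sig → Fml S.setting.sig → S.Answer → Prop
  | exit {φ B} : ¬ S.TSat (Fml.and φ (Fml.neg B)) → Loop pq φ B (.safeAnswer B)
  | found {φ B} : S.TSat (Fml.and φ (Fml.neg B)) → S.InitTSat φ → Loop pq φ B .unsafeAnswer
  | next {φ B r} : S.TSat (Fml.and φ (Fml.neg B)) → ¬ S.InitTSat φ →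
      Loop pq (pq φ) (Fml.or φ B) r → Loop pq φ B r

/-- Backward search `BReach(υ)`, with the subprocedure `pq` for computing preimages, terminates with
the answer `r`. -/
def BReach (pq : Fml S.setting.sig → Fml S.setting.sig) (υ : Fml S.setting.sig) (r : S.Answer) :
    Prop :=
  Loop pq υ Fml.fls r

/-- Effectiveness of backward search: all its subprocedures can be effectively executed, that is, the
two satisfiability tests are decidable and there is a computable procedure for preimages. -/
def BackwardSearchEffective (Tstar : Set (Fml S.schema.sig)) : Prop :=
  DecidableOn (fun χ => ∃ φ B, S.setting.IsState φ ∧ S.setting.IsStateDisj B ∧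
    χ = Fml.and φ (Fml.neg B)) S.TSat ∧
  DecidableOn S.setting.IsState S.InitTSat ∧
  ∃ pq, S.IsPreimageProcedure Tstar pq ∧ ComputableOn S.setting.IsState pq

/-- Partial correctness of backward search for solving safety problems: whenever it terminates, it
gives a correct answer. -/
def BackwardSearchPartiallyCorrect (Tstar : Set (Fml S.schema.sig)) : Prop :=
  ∀ pq, S.IsPreimageProcedure Tstar pq → ∀ υ, S.setting.IsState υ →
    (S.BReach pq υ .unsafeAnswer → ¬ S.Safe υ) ∧
    (∀ B, S.BReach pq υ (.safeAnswer B) → S.Safe υ)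

end RAS

end Artifact

/-! ## Primitive recursive and computable functions -/

-- Everything rests on one feature of the extended signature: no function symbol has an artifact
-- sort as its target. Hence any nonempty set of entries in each artifact sort, together with the
-- whole basic part, is a substructure (`ExtStruc.Emb.realize_iff_of_isQF`). Existential formulae
-- pass up from such a substructure, universal ones pass down to it, and a true ∃∀-sentence survives
-- in any substructure that contains its witnesses (`Small`). The number of witnesses is bounded by
-- the length of the existential prefix, hence by the Gödel number.
--
-- Over finitely many numbered entries the values of the artifact variables and components form a
-- finite tuple of elements of basic sorts. Once this tuple is named by terms over the DB signature,
-- a quantifier over entries is a finite disjunction, and equality of entries is decided by their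
-- numbers (`Names.tr`, `Names.Fresh.realize_tr`). A sentence that quantifies only over artifact
-- sorts thus becomes quantifier-free over the DB signature. Satisfiability of quantifier-free
-- formulae reduces to that of constraints (`SatIn.transfer`), so satisfiability of ∃∀-sentences is
-- the same in models of the theory, in models of its completion and in DB instances
-- (`ExtSatIn.transfer`). It is decidable, because the translation is primitive recursive and only
-- boundedly many sizes have to be tried (`decidableOn_of_forall_iff`).
--
-- The matrix of a transition formula is quantifier-free up to universal quantifiers over entries,
-- so it too passes to substructures. A whole run of fixed length, over enough entries, is therefore
-- described by one quantifier-free formula over the DB signature, and runs transfer between the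
-- three classes of structures (`RAS.Reach.transfer`). Partial correctness can then be argued
-- entirely in models of the completion, where computed preimages are exact: "unsafe" yields a run
-- by following preimages forwards, and on "safe" the formula `B` is closed under preimages and
-- contains no initial state.
--
-- For the computation of preimages, a transition over finitely many entries extends to all entries,
-- since the case-defined updates prescribe a value at each further one
-- (`Transition.HoldsAt.extend`). As state formulae pass upwards, a preimage holds iff it holds over
-- some set of entries of bounded size (`pre_iff_exists_emb`). There the second-order quantifier
-- over the primed components is a block of first-order quantifiers of basic sorts, which quantifier
-- elimination removes. Replacing the names by the artifact variables and by the components applied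
-- to distinct existentially quantified entries gives a state formula (`preState`).

attribute [fun_prop] Primrec

section Primrec

variable {α β γ σ : Type*} [Primcodable α] [Primcodable β] [Primcodable γ] [Primcodable σ]

namespace Primrec

-- Closure properties in pointwise form let `fun_prop` certify the explicit recursions on Gödel
-- numbers used later.
@[fun_prop]
theorem fun_id' : Primrec (fun x : α => x) := Primrec.id

@[fun_prop]
theorem fun_const (b : β) : Primrec (fun _ : α => b) := Primrec.const b

@[fun_prop]
theorem fun_comp {f : β → γ} {g : α → β} (hf : Primrec f) (hg : Primrec g) :
    Primrec (fun x => f (g x)) := hf.comp hg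

@[fun_prop]
theorem fun_fst {f : α → β × γ} (hf : Primrec f) : Primrec (fun x => (f x).1) :=
  Primrec.fst.comp hf

@[fun_prop]
theorem fun_snd {f : α → β × γ} (hf : Primrec f) : Primrec (fun x => (f x).2) :=
  Primrec.snd.comp hf

@[fun_prop]
theorem fun_mk {f : α → β} {g : α → γ} (hf : Primrec f) (hg : Primrec g) :
    Primrec (fun x => (f x, g x)) := hf.pair hg

@[fun_prop]
theorem fun_natPair {f g : α → ℕ} (hf : Primrec f) (hg : Primrec g) :
    Primrec (fun x => Nat.pair (f x) (g x)) := Primrec₂.natPair.comp hf hg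

@[fun_prop]
theorem fun_unpair {f : α → ℕ} (hf : Primrec f) : Primrec (fun x => Nat.unpair (f x)) :=
  Primrec.unpair.comp hf

@[fun_prop]
theorem fun_add {f g : α → ℕ} (hf : Primrec f) (hg : Primrec g) :
    Primrec (fun x => f x + g x) := Primrec.nat_add.comp hf hg

@[fun_prop]
theorem fun_mul {f g : α → ℕ} (hf : Primrec f) (hg : Primrec g) :
    Primrec (fun x => f x * g x) := Primrec.nat_mul.comp hf hg

@[fun_prop]
theorem fun_div {f g : α → ℕ} (hf : Primrec f) (hg : Primrec g) :
    Primrec (fun x => f x / g x) := Primrec.nat_div.comp hf hg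

@[fun_prop]
theorem fun_mod {f g : α → ℕ} (hf : Primrec f) (hg : Primrec g) :
    Primrec (fun x => f x % g x) := Primrec.nat_mod.comp hf hg

@[fun_prop]
theorem fun_cons {f : α → β} {g : α → List β} (hf : Primrec f) (hg : Primrec g) :
    Primrec (fun x => f x :: g x) := Primrec.list_cons.comp hf hg

@[fun_prop]
theorem fun_ite_eq {u v : α → ℕ} {f g : α → β} (hu : Primrec u) (hv : Primrec v) (hf : Primrec f)
    (hg : Primrec g) : Primrec (fun x => if u x = v x then f x else g x) :=
  Primrec.ite (Primrec.eq.comp hu hv) hf hg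

@[fun_prop]
theorem fun_map {f : α → List β} {g : α → β → γ} (hf : Primrec f)
    (hg : Primrec fun p : α × β => g p.1 p.2) : Primrec (fun x => (f x).map (g x)) :=
  Primrec.list_map hf hg

@[fun_prop]
theorem fun_flatMap {f : α → List β} {g : α → β → List γ} (hf : Primrec f)
    (hg : Primrec fun p : α × β => g p.1 p.2) : Primrec (fun x => (f x).flatMap (g x)) :=
  Primrec.list_flatMap hf hg

@[fun_prop]
theorem fun_foldr {f : α → List β} {g : α → γ} {h : α → β → γ → γ} (hf : Primrec f)
    (hg : Primrec g) (hh : Primrec fun p : α × β × γ => h p.1 p.2.1 p.2.2) :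
    Primrec (fun x => (f x).foldr (h x) (g x)) :=
  Primrec.list_foldr (h := fun x p => h x p.1 p.2) hf hg hh

@[fun_prop]
theorem fun_range {f : α → ℕ} (hf : Primrec f) : Primrec (fun x => List.range (f x)) :=
  Primrec.list_range.comp hf

@[fun_prop]
theorem fun_getD {f : α → List β} {g : α → ℕ} (d : β) (hf : Primrec f) (hg : Primrec g) :
    Primrec (fun x => (f x).getD (g x) d) :=
  (Primrec.list_getD d).comp hf hg

/-- The value at a key in an association list, by default `0`. -/
def lookupD (l : List (ℕ × ℕ)) (p : ℕ) : ℕ := (l.lookup p).getD 0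

@[fun_prop]
theorem fun_lookupD {f : α → List (ℕ × ℕ)} {g : α → ℕ} (hf : Primrec f)
    (hg : Primrec g) : Primrec (fun x => lookupD (f x) (g x)) :=
  Primrec.option_getD.comp (Primrec.listLookup.comp hg hf) (Primrec.const 0)

/-- Recursion in which the value at `b` is obtained from the values at the entries of a list
`calls b` of arguments of smaller measure. -/
theorem exists_rec {m : β → ℕ} {calls : β → List β} {combine : β → List σ → σ} (hm : Primrec m)
    (hc : Primrec calls) (hk : Primrec fun p : β × List σ => combine p.1 p.2)
    (ord : ∀ b, ∀ b' ∈ calls b, m b' < m b) :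
    ∃ f : β → σ, Primrec f ∧ ∀ b, f b = combine b ((calls b).map f) := by
  -- Attaching membership proofs to the list justifies termination; they vanish again in the
  -- equation `hF`.
  let F : β → σ := (measure m).wf.fix fun b F =>
    combine b ((calls b).attach.map fun x => F x.1 (ord b x.1 x.2))
  have hF : ∀ b, F b = combine b ((calls b).map F) := fun b => by
    rw [show F b = _ from WellFounded.fix_eq _ _ b]
    exact congrArg _ List.attach_map_val
  exact ⟨F, Primrec.nat_omega_rec' F hm hc (g := fun b l => some (combine b l))
    (Primrec.option_some.comp hk) ord fun b => by rw [← hF], hF⟩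

/-- A function on numbers can be replaced by a primitive recursive one that agrees with it on the
codes of the elements of a finite type. -/
theorem exists_table {ι : Type*} [Finite ι] (e : ι → ℕ) (he : Function.Injective e) (f : ι → ℕ) :
    ∃ g : ℕ → ℕ, Primrec g ∧ ∀ i, g (e i) = f i := by
  obtain ⟨n, ⟨u⟩⟩ := Finite.exists_equiv_fin ι
  let l : List (ℕ × ℕ) := List.ofFn fun k : Fin n => (e (u.symm k), f (u.symm k))
  refine ⟨fun x => lookupD l x, by fun_prop, fun i => ?_⟩
  have key : ∀ l' : List ι, i ∈ l' →
      (l'.map fun k => (e k, f k)).lookup (e i) = some (f i) := by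
    intro l' hi
    induction l' with
    | nil => simp at hi
    | cons k l' ih =>
      by_cases hk : i = k
      · subst hk; simp
      · have : (e i == e k) = false := by
          simpa using fun h => hk (he h)
        simp only [List.map_cons, List.lookup, this]
        exact ih (by simpa [hk] using hi)
  have : l = (List.ofFn fun k : Fin n => u.symm k).map fun k => (e k, f k) := by
    simp [l, List.map_ofFn, Function.comp_def]
  change (l.lookup (e i)).getD 0 = f i
  rw [this, key _ (List.mem_ofFn.2 ⟨u i, by simp⟩)]
  rfl

end Primrec

/-- Quantifier elimination is only assumed computable, not primitive recursive, and has to be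
applied along a list. The proof runs through the indices and appends one value at a time. -/
theorem Computable.list_map {f : α → β} (hf : Computable f) : Computable (List.map f) := by
  have h : Computable fun l : List α => (Nat.rec (motive := fun _ => List β) []
      (fun i acc => acc ++ ((l[i]?).map f).toList) l.length : List β) := by
    refine Computable.nat_rec (h := fun l p => p.2 ++ ((l[p.1]?).map f).toList)
      Computable.list_length (Computable.const []) ?_
    refine Computable.list_append.comp (Computable.snd.comp Computable.snd) ?_
    refine Primrec.optionToList.to_comp.comp (Computable.option_map ?_ ?_)
    · exact Computable.list_getElem?.comp Computable.fst (Computable.fst.comp Computable.snd)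
    · exact hf.comp Computable.snd
  refine h.of_eq fun l => ?_
  have key : ∀ n ≤ l.length, (Nat.rec (motive := fun _ => List β) []
      (fun i acc => acc ++ ((l[i]?).map f).toList) n : List β) = (l.take n).map f := by
    intro n hn
    induction n with
    | zero => simp
    | succ n ih =>
      have hn' : n < l.length := hn
      rw [List.take_add_one, List.map_append, ← ih hn'.le, List.getElem?_eq_getElem hn',
        ← Option.toList_map, ← List.getElem?_eq_getElem hn']
  simpa using key l.length le_rfl

end Primrec

namespace Artifact

/-! ## First-order logic: basic facts -/

/-- An enumeration of a finite type. -/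
noncomputable def finList (ι : Type*) [Finite ι] : List ι :=
  (@Finset.univ ι (Fintype.ofFinite ι)).toList

@[simp]
theorem mem_finList {ι : Type*} [Finite ι] (i : ι) : i ∈ finList ι := by
  simp [finList]

section Logic

variable {L : Sig} {M : Struc L}

@[simp]
theorem Struc.upd_self (v : M.Assign) (x : L.Var) (d : M.carrier x.1) :
    M.upd v x d x.1 x.2 = d := by
  simp [Struc.upd]

theorem Struc.upd_of_ne (v : M.Assign) (x : L.Var) (d : M.carrier x.1) {s : L.Srt} {m : ℕ}
    (h : ((s, m) : L.Var) ≠ x) : M.upd v x d s m = v s m := by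
  classical
  obtain ⟨t, k⟩ := x
  by_cases hs : s = t
  · subst hs
    have : m ≠ k := fun h' => h (by rw [h'])
    simp [Struc.upd, Function.update_of_ne this]
  · exact congrFun (Function.update_of_ne hs _ _) m

theorem Struc.eq_upd {v v' : M.Assign} {x : L.Var} {d : M.carrier x.1} (h : v' x.1 x.2 = d)
    (h' : ∀ s m, ((s, m) : L.Var) ≠ x → v' s m = v s m) : v' = M.upd v x d := by
  funext s m
  by_cases hx : ((s, m) : L.Var) = x
  · subst hx
    exact h.trans (M.upd_self v (s, m) d).symm
  · rw [M.upd_of_ne _ _ _ hx, h' s m hx]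

theorem Term.eval_congr {v v' : M.Assign} {s : L.Srt} (t : Term L s)
    (h : ∀ s m, ((s, m) : L.Var) ∈ t.vars → v s m = v' s m) : t.eval M v = t.eval M v' := by
  induction t with
  | var s n => exact h s n rfl
  | cst c => rfl
  | app f t ih => exact congrArg _ (ih h)

/-- The truth value of a formula depends on the values of its free variables only. -/
theorem Struc.realize_congr (φ : Fml L) {v v' : M.Assign}
    (h : ∀ s m, ((s, m) : L.Var) ∈ φ.fv → v s m = v' s m) : M.Realize v φ ↔ M.Realize v' φ := by
  induction φ generalizing v v' with
  | fls => rfl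
  | eq t u =>
    simp only [Struc.Realize]
    rw [Term.eval_congr t fun s m hm => h s m (Or.inl hm),
      Term.eval_congr u fun s m hm => h s m (Or.inr hm)]
  | neg φ ih => exact not_congr (ih h)
  | and φ ψ ih₁ ih₂ =>
    exact and_congr (ih₁ fun s m hm => h s m (Or.inl hm)) (ih₂ fun s m hm => h s m (Or.inr hm))
  | ex x φ ih =>
    refine exists_congr fun d => ih fun s m hm => ?_
    by_cases hx : ((s, m) : L.Var) = x
    · subst hx
      rw [M.upd_self v (s, m), M.upd_self v' (s, m)]
    · rw [M.upd_of_ne _ _ _ hx, M.upd_of_ne _ _ _ hx]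
      exact h s m ⟨hm, hx⟩

instance Struc.assignNonempty (M : Struc L) : Nonempty M.Assign :=
  ⟨fun s _ => (M.nonempty s).some⟩

/-- For sentences, truth under all assignments can be tested at a single one; this links `Holds`
with `Realize`. -/
theorem Struc.true_iff_realize {φ : Fml L} (h : φ.fv = ∅) (v : M.Assign) :
    M.True φ ↔ M.Realize v φ :=
  ⟨fun H => H v, fun H v' => (M.realize_congr φ (by simp [h])).1 H⟩

theorem Term.vars_finite {s : L.Srt} (t : Term L s) : t.vars.Finite := by
  induction t with
  | var s n => exact Set.finite_singleton _
  | cst c => exact Set.finite_empty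
  | app f t ih => exact ih

theorem Fml.fv_finite (φ : Fml L) : φ.fv.Finite := by
  induction φ with
  | fls => exact Set.finite_empty
  | eq t u => exact t.vars_finite.union u.vars_finite
  | neg φ ih => exact ih
  | and φ ψ ih₁ ih₂ => exact ih₁.union ih₂
  | ex x φ ih => exact ih.subset Set.sdiff_subset

/-- The free variables of a formula. -/
noncomputable def Fml.fvList (φ : Fml L) : List L.Var := φ.fv_finite.toFinset.toList

@[simp]
theorem Fml.mem_fvList {φ : Fml L} {x : L.Var} : x ∈ φ.fvList ↔ x ∈ φ.fv := by
  simp [Fml.fvList]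

/-! ### Connectives and quantifier blocks -/

theorem Struc.realize_or {v : M.Assign} {φ ψ : Fml L} :
    M.Realize v (φ.or ψ) ↔ M.Realize v φ ∨ M.Realize v ψ := by
  simp only [Fml.or, Struc.Realize]; tauto

theorem Struc.realize_all {v : M.Assign} {x : L.Var} {φ : Fml L} :
    M.Realize v (φ.all x) ↔ ∀ d, M.Realize (M.upd v x d) φ := by
  simp [Fml.all, Struc.Realize]

theorem Struc.realize_exs {v : M.Assign} {xs : List L.Var} {φ : Fml L} :
    M.Realize v (φ.exs xs) ↔
      ∃ v' : M.Assign, (∀ s m, ((s, m) : L.Var) ∉ xs → v' s m = v s m) ∧ M.Realize v' φ := by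
  induction xs generalizing v with
  | nil =>
    refine ⟨fun h => ⟨v, fun _ _ _ => rfl, h⟩, ?_⟩
    rintro ⟨v', h, h'⟩
    obtain rfl : v' = v := by ext s m; exact h s m (by simp)
    exact h'
  | cons x xs ih =>
    change (∃ d, M.Realize _ (φ.exs xs)) ↔ _
    simp only [ih]
    constructor
    · rintro ⟨d, v', h, h'⟩
      refine ⟨v', fun s m hm => ?_, h'⟩
      rw [List.mem_cons, not_or] at hm
      rw [h s m hm.2, M.upd_of_ne _ _ _ hm.1]
    · rintro ⟨v', h, h'⟩
      refine ⟨v' x.1 x.2, v', fun s m hm => ?_, h'⟩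
      by_cases hx : ((s, m) : L.Var) = x
      · subst hx
        rw [M.upd_self v (s, m)]
      · rw [M.upd_of_ne _ _ _ hx]
        exact h s m (by simp [hm, hx])

theorem Struc.realize_exs_of_subset {v : M.Assign} {xs : List L.Var} {φ : Fml L}
    (h : ∀ x ∈ φ.fv, x ∈ xs) : M.Realize v (φ.exs xs) ↔ ∃ v', M.Realize v' φ := by
  rw [M.realize_exs]
  constructor
  · rintro ⟨v', -, h'⟩; exact ⟨v', h'⟩
  · rintro ⟨v', h'⟩
    classical
    refine ⟨fun s m => if ((s, m) : L.Var) ∈ xs then v' s m else v s m,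
      fun s m hm => if_neg hm, (M.realize_congr φ fun s m hm => ?_).1 h'⟩
    rw [if_pos (h _ hm)]

namespace Fml

/-- Finite disjunctions. -/
def bigOr (l : List (Fml L)) : Fml L := l.foldr or fls

/-- Finite conjunctions. -/
def bigAnd (l : List (Fml L)) : Fml L := l.foldr and (neg fls)

/-- Implication. -/
def imp (φ ψ : Fml L) : Fml L := or (neg φ) ψ

theorem fv_or (φ ψ : Fml L) : (φ.or ψ).fv = φ.fv ∪ ψ.fv := rfl

theorem mem_fv_exs {xs : List L.Var} {φ : Fml L} {y : L.Var} :
    y ∈ (φ.exs xs).fv ↔ y ∈ φ.fv ∧ y ∉ xs := by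
  induction xs with
  | nil => simp [exs]
  | cons x xs ih =>
    change y ∈ (φ.exs xs).fv \ {x} ↔ _
    simp [ih]; tauto

theorem mem_fv_bigOr {l : List (Fml L)} {y : L.Var} :
    y ∈ (bigOr l).fv ↔ ∃ φ ∈ l, y ∈ φ.fv := by
  induction l with
  | nil => simp [bigOr, fv]
  | cons φ l ih =>
    change y ∈ φ.fv ∪ (bigOr l).fv ↔ _
    simp [ih]

theorem mem_fv_bigAnd {l : List (Fml L)} {y : L.Var} :
    y ∈ (bigAnd l).fv ↔ ∃ φ ∈ l, y ∈ φ.fv := by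
  induction l with
  | nil => simp [bigAnd, fv]
  | cons φ l ih =>
    change y ∈ φ.fv ∪ (bigAnd l).fv ↔ _
    simp [ih]

theorem isQF_or {φ ψ : Fml L} : (φ.or ψ).IsQF ↔ φ.IsQF ∧ ψ.IsQF := Iff.rfl

theorem isQF_bigOr {l : List (Fml L)} : (bigOr l).IsQF ↔ ∀ φ ∈ l, φ.IsQF := by
  induction l with
  | nil => simp [bigOr, IsQF]
  | cons φ l ih => exact (isQF_or.trans (and_congr_right fun _ => ih)).trans (by simp)

theorem isQF_bigAnd {l : List (Fml L)} : (bigAnd l).IsQF ↔ ∀ φ ∈ l, φ.IsQF := by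
  induction l with
  | nil => simp [bigAnd, IsQF]
  | cons φ l ih =>
    change φ.IsQF ∧ (bigAnd l).IsQF ↔ _
    simp [ih]

end Fml

theorem Struc.realize_imp {v : M.Assign} {φ ψ : Fml L} :
    M.Realize v (φ.imp ψ) ↔ (M.Realize v φ → M.Realize v ψ) := by
  rw [Fml.imp, M.realize_or, imp_iff_not_or]; rfl

theorem Struc.realize_bigOr {v : M.Assign} {l : List (Fml L)} :
    M.Realize v (Fml.bigOr l) ↔ ∃ φ ∈ l, M.Realize v φ := by
  induction l with
  | nil => simp [Fml.bigOr, Struc.Realize]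
  | cons φ l ih => exact (M.realize_or.trans (or_congr_right ih)).trans (by simp)

theorem Struc.realize_bigAnd {v : M.Assign} {l : List (Fml L)} :
    M.Realize v (Fml.bigAnd l) ↔ ∀ φ ∈ l, M.Realize v φ := by
  induction l with
  | nil => simp [Fml.bigAnd, Struc.Realize]
  | cons φ l ih =>
    change M.Realize v φ ∧ M.Realize v (Fml.bigAnd l) ↔ _
    simp [ih]

/-! ### Constraints -/

/-- A quantifier-free formula that is true (or false) somewhere is made true (false) by a constraint
that is true there. -/
theorem exists_constraint (v : M.Assign) : ∀ φ : Fml L, φ.IsQF → ∃ ψ : Fml L, ψ.IsConstraint ∧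
    M.Realize v ψ ∧ ∀ (N : Struc L) (w : N.Assign), N.Realize w ψ →
      (N.Realize w φ ↔ M.Realize v φ)
  | .fls, _ => ⟨_, .top, id, fun _ _ _ => Iff.rfl⟩
  | .eq t u, _ => by
    -- Each atom contributes itself or its negation, whichever is true at `v`; the conjunction of
    -- these literals fixes the truth value of the whole formula.
    by_cases h : M.Realize v (.eq t u)
    · exact ⟨_, .pos t u, h, fun N w hw => iff_of_true hw h⟩
    · exact ⟨_, .neg t u, h, fun N w hw => iff_of_false hw h⟩
  | .neg φ, h => by
    obtain ⟨ψ, h₁, h₂, h₃⟩ := exists_constraint v φ h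
    exact ⟨ψ, h₁, h₂, fun N w hw => not_congr (h₃ N w hw)⟩
  | .and φ χ, h => by
    obtain ⟨ψ, h₁, h₂, h₃⟩ := exists_constraint v φ h.1
    obtain ⟨ψ', h₁', h₂', h₃'⟩ := exists_constraint v χ h.2
    exact ⟨_, .and h₁ h₁', ⟨h₂, h₂'⟩, fun N w hw => and_congr (h₃ N w hw.1) (h₃' N w hw.2)⟩

/-- Satisfiability of quantifier-free formulae transfers between classes of structures if that of
constraints does. -/
theorem SatIn.transfer {𝒦 𝒦' : Struc L → Prop}
    (h : ∀ φ : Fml L, φ.IsConstraint → SatIn 𝒦 φ → SatIn 𝒦' φ) {φ : Fml L} (hφ : φ.IsQF)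
    (hs : SatIn 𝒦 φ) : SatIn 𝒦' φ := by
  obtain ⟨M, hM, v, hv⟩ := hs
  obtain ⟨ψ, h₁, h₂, h₃⟩ := exists_constraint v φ hφ
  obtain ⟨N, hN, w, hw⟩ := h ψ h₁ ⟨M, hM, v, h₂⟩
  exact ⟨N, hN, w, (h₃ N w hw).2 hv⟩

end Logic

end Artifact

namespace Artifact

/-! ## Elimination of artifact sorts over finitely many entries -/

section Translation

variable {L : Sig} {W : Setting L}

namespace Setting

/-- The structure for the artifact extension with `n E + 1` entries of the artifact sort `E`. -/
def finStruc (W : Setting L) (N : Struc L) (n : W.ASrt → ℕ) : W.ExtStruc where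
  db := N
  entries E := Fin (n E + 1)
  nonempty _ := ⟨0⟩

variable (W) in
/-- Terms that name the values of the artifact variables, and the values of the artifact components
at the entries, the entries being numbered. -/
structure Names where
  x : ∀ {s : L.Srt}, W.X s → Term L s
  a : ∀ {E : W.ASrt} {s : L.Srt}, W.A E s → ℕ → Term L s

/-- The assignment described by names. -/
def Names.assign (ν : W.Names) (N : Struc L) (u : N.Assign) (n : W.ASrt → ℕ) :
    Assignment (W.finStruc N n) where
  x y := (ν.x y).eval N u
  a b k := (ν.a b k.val).eval N u

/-- All quantifiers range over artifact sorts. -/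
def _root_.Artifact.Fml.ArtQuant : Fml W.sig → Prop
  | .fls => True
  | .eq _ _ => True
  | .neg φ => φ.ArtQuant
  | .and φ ψ => φ.ArtQuant ∧ ψ.ArtQuant
  | .ex (.inl _, _) _ => False
  | .ex (.inr _, _) φ => φ.ArtQuant

/-- Values of the individual variables of artifact sorts. -/
abbrev Env (W : Setting L) (n : W.ASrt → ℕ) : Type := ∀ E : W.ASrt, ℕ → Fin (n E + 1)

open Classical in
/-- The environment `ρ[(E, m) ↦ k]`. -/
noncomputable def Env.upd {n : W.ASrt → ℕ} (ρ : W.Env n) (E : W.ASrt) (m : ℕ) (k : Fin (n E + 1)) :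
    W.Env n :=
  Function.update ρ E (Function.update (ρ E) m k)

/-- Translations of terms: terms for the basic sorts, entries for the artifact sorts. -/
def Tr (W : Setting L) (n : W.ASrt → ℕ) : W.sig.Srt → Type
  | .inl s => Term L s
  | .inr E => Fin (n E + 1)

namespace Names

variable (ν : W.Names) (z : ℕ → ℕ) {n : W.ASrt → ℕ}

/-- Variables of basic sorts survive, renumbered so as to avoid the names; those of artifact sorts
are replaced by the entry numbers that the environment assigns to them. -/
def trVar (ρ : W.Env n) : (σ : W.sig.Srt) → ℕ → W.Tr n σ
  | .inl s, m => (Term.var s (z m) : Term L s)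
  | .inr E, m => ρ E m

def trCst : (σ : W.sig.Srt) → W.Cst σ → W.Tr n σ
  | .inl _, .inl c => Term.cst c
  | .inl _, .inr y => ν.x y

def trApp : (σ σ' : W.sig.Srt) → W.Fn σ σ' → W.Tr n σ → W.Tr n σ'
  | .inl _, .inl _, f, t => Term.app f t
  | .inr _, .inl _, b, k => ν.a b (Fin.val k)

/-- Translation of terms; the variable number `m` of a basic sort becomes number `z m`. -/
def trTerm (ρ : W.Env n) : {σ : W.sig.Srt} → Term W.sig σ → W.Tr n σ
  | _, .var σ m => trVar z ρ σ m
  | _, .cst (s := σ) c => ν.trCst σ c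
  | _, .app (s := σ) (s' := σ') f t => ν.trApp σ σ' f (trTerm ρ t)

-- Distinct numbers stand for distinct entries, so an equation between entries has a definite truth
-- value at the time of translation.
open Classical in
noncomputable def trEq : (σ : W.sig.Srt) → W.Tr n σ → W.Tr n σ → Fml L
  | .inl _, t, u => Fml.eq t u
  | .inr _, k, l => if k = l then Fml.neg Fml.fls else Fml.fls

/-- Variables of the translation of a term. -/
def trVars : (σ : W.sig.Srt) → W.Tr n σ → Set L.Var
  | .inl _, t => Term.vars t
  | .inr _, _ => ∅

theorem fv_trEq : ∀ (σ : W.sig.Srt) (t u : W.Tr n σ),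
    (trEq σ t u).fv ⊆ trVars σ t ∪ trVars σ u
  | .inl _, _, _ => subset_rfl
  | .inr _, k, l => by
    change (@ite _ _ (Classical.propDecidable _) _ _ : Fml L).fv ⊆ _
    split_ifs <;> exact Set.empty_subset _

/-- Translation of formulae, in which quantifiers over the entries become finite disjunctions. -/
noncomputable def tr : W.Env n → Fml W.sig → Fml L
  | _, .fls => .fls
  | ρ, .eq (s := σ) t u => trEq σ (ν.trTerm z ρ t) (ν.trTerm z ρ u)
  | ρ, .neg φ => .neg (tr ρ φ)
  | ρ, .and φ ψ => .and (tr ρ φ) (tr ρ ψ)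
  | ρ, .ex (.inl s, m) φ => .ex (s, z m) (tr ρ φ)
  | ρ, .ex (.inr E, m) φ =>
    Fml.bigOr ((List.finRange (n E + 1)).map fun k => tr (ρ.upd E m k) φ)

/-- The numbers `z m` are not used in the names. -/
structure Fresh : Prop where
  inj : Function.Injective z
  x : ∀ {s} (y : W.X s) s' m, ((s', z m) : L.Var) ∉ (ν.x y).vars
  a : ∀ {E s} (b : W.A E s) k s' m, ((s', z m) : L.Var) ∉ (ν.a b k).vars

variable {ν z}

/-- A quantifier over a basic sort must not disturb the named values; freshness of the bound
variable guarantees this. -/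
theorem Fresh.assign_upd (h : ν.Fresh z) (N : Struc L) (u : N.Assign) (s : L.Srt) (m : ℕ)
    (d : N.carrier s) : ν.assign N (N.upd u (s, z m) d) n = ν.assign N u n := by
  have hx : ∀ {s'} (y : W.X s'), (ν.x y).eval N (N.upd u (s, z m) d) = (ν.x y).eval N u :=
    fun y => Term.eval_congr _ fun s' m' hm => N.upd_of_ne _ _ _ fun e => h.x y s m (e ▸ hm)
  have ha : ∀ {E s'} (b : W.A E s') k,
      (ν.a b k).eval N (N.upd u (s, z m) d) = (ν.a b k).eval N u :=
    fun b k => Term.eval_congr _ fun s' m' hm => N.upd_of_ne _ _ _ fun e => h.a b k s m (e ▸ hm)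
  simp only [assign, hx, ha]

variable (z) in
/-- Values of all individual variables. -/
def glue {N : Struc L} (α : Assignment (W.finStruc N n)) (u : N.Assign) (ρ : W.Env n) :
    ((W.finStruc N n).withAssignment α).Assign
  | .inl s, m => u s (z m)
  | .inr E, m => ρ E m

def trVal (N : Struc L) (u : N.Assign) (α : Assignment (W.finStruc N n)) :
    (σ : W.sig.Srt) → W.Tr n σ → ((W.finStruc N n).withAssignment α).carrier σ
  | .inl _, t => Term.eval N u t
  | .inr _, k => k

theorem eval_trTerm {N : Struc L} (u : N.Assign) (ρ : W.Env n) {σ : W.sig.Srt}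
    (t : Term W.sig σ) :
    t.eval _ (glue z (ν.assign N u n) u ρ) = trVal N u _ σ (ν.trTerm z ρ t) := by
  induction t with
  | var σ m =>
    match σ with
    | .inl s => rfl
    | .inr E => rfl
  | @cst σ c =>
    match σ, c with
    | .inl s, .inl c => rfl
    | .inl s, .inr y => rfl
    | .inr E, c => exact Empty.elim c
  | @app σ σ' f t ih =>
    match σ, σ', f, t, ih with
    | .inl s, .inl s', f, _, ih => exact congrArg (N.fn f) ih
    | .inr E, .inl s', b, _, ih => exact congrArg (fun k => (ν.assign N u n).a b k) ih
    | .inl s, .inr E', f, _, _ => exact Empty.elim f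
    | .inr E, .inr E', f, _, _ => exact Empty.elim f

theorem realize_trEq {N : Struc L} (u : N.Assign) (α : Assignment (W.finStruc N n)) :
    ∀ (σ : W.sig.Srt) (t t' : W.Tr n σ),
      N.Realize u (trEq σ t t') ↔ trVal N u α σ t = trVal N u α σ t'
  | .inl _, _, _ => Iff.rfl
  | .inr E, k, l => by
    change N.Realize u (@ite _ _ (Classical.propDecidable _) _ _) ↔ k = l
    split_ifs with h
    · exact iff_of_true id h
    · exact iff_of_false id h

theorem glue_upd_inl (hz : Function.Injective z) {N : Struc L} (α : Assignment (W.finStruc N n))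
    (u : N.Assign) (ρ : W.Env n) (s : L.Srt) (m : ℕ) (d : N.carrier s) :
    glue z α (N.upd u (s, z m) d) ρ =
      Struc.upd _ (glue z α u ρ) ((.inl s, m) : W.sig.Var) d := by
  refine Struc.eq_upd (N.upd_self u (s, z m) d) fun σ k h => ?_
  match σ, h with
  | .inl s', h =>
    refine N.upd_of_ne u _ _ fun e => h ?_
    rw [Prod.mk.injEq] at e
    rw [e.1, hz e.2]
  | .inr E, _ => rfl

theorem glue_upd_inr {N : Struc L} (α : Assignment (W.finStruc N n))
    (u : N.Assign) (ρ : W.Env n) (E : W.ASrt) (m : ℕ) (k : Fin (n E + 1)) :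
    glue z α u (ρ.upd E m k) =
      Struc.upd _ (glue z α u ρ) ((.inr E, m) : W.sig.Var) k := by
  refine Struc.eq_upd ?_ fun σ l h => ?_
  · change ρ.upd E m k E m = k
    simp [Env.upd]
  · match σ, h with
    | .inl s', _ => rfl
    | .inr E', h =>
      change ρ.upd E m k E' l = ρ E' l
      by_cases hE : E' = E
      · subst hE
        have : l ≠ m := fun h' => h (by rw [h'])
        simp [Env.upd, this]
      · simp [Env.upd, hE]

/-- The translation is correct. -/
theorem Fresh.realize_tr (h : ν.Fresh z) {N : Struc L} (φ : Fml W.sig) (u : N.Assign)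
    (ρ : W.Env n) : N.Realize u (ν.tr z ρ φ) ↔
      ((W.finStruc N n).withAssignment (ν.assign N u n)).Realize
        (glue z (ν.assign N u n) u ρ) φ := by
  induction φ generalizing u ρ with
  | fls => rfl
  | @eq σ t t' =>
    change N.Realize u (trEq σ _ _) ↔ t.eval _ _ = t'.eval _ _
    exact (realize_trEq u (ν.assign N u n) σ _ _).trans
      (Eq.congr (eval_trTerm u ρ t) (eval_trTerm u ρ t')).symm
  | neg φ ih => exact not_congr (ih u ρ)
  | and φ ψ ih₁ ih₂ => exact and_congr (ih₁ u ρ) (ih₂ u ρ)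
  | ex x φ ih =>
    match x with
    | (.inl s, m) =>
      refine exists_congr fun d => ?_
      rw [ih, h.assign_upd, glue_upd_inl h.inj]
    | (.inr E, m) =>
      rw [tr, N.realize_bigOr]
      simp only [List.mem_map, List.mem_finRange, true_and, exists_exists_eq_and, ih, glue_upd_inr]
      rfl

/-- The free variables of the translation. -/
theorem mem_fv_tr {φ : Fml W.sig} {ρ : W.Env n} {y : L.Var} (hy : y ∈ (ν.tr z ρ φ).fv) :
    (∃ m, y.2 = z m ∧ ((.inl y.1, m) : W.sig.Var) ∈ φ.fv) ∨
      (∃ (s : L.Srt) (x : W.X s), y ∈ (ν.x x).vars) ∨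
      ∃ (E : W.ASrt) (s : L.Srt) (b : W.A E s) (k : ℕ), k ≤ n E ∧ y ∈ (ν.a b k).vars := by
  induction φ generalizing ρ with
  | fls => exact hy.elim
  | @eq σ t u =>
    have key : ∀ {σ : W.sig.Srt} (t : Term W.sig σ) (w : W.Tr n σ), ν.trTerm z ρ t = w →
        y ∈ trVars σ w →
        (∃ m, y.2 = z m ∧ ((.inl y.1, m) : W.sig.Var) ∈ t.vars) ∨
        (∃ (s : L.Srt) (x : W.X s), y ∈ (ν.x x).vars) ∨
        ∃ (E : W.ASrt) (s : L.Srt) (b : W.A E s) (k : ℕ), k ≤ n E ∧ y ∈ (ν.a b k).vars := by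
      intro σ t w hw hy
      subst hw
      induction t with
      | var σ m =>
        match σ, hy with
        | .inl s, hy => obtain rfl : y = (s, z m) := hy; exact Or.inl ⟨m, rfl, rfl⟩
        | .inr E, hy => exact hy.elim
      | @cst σ c =>
        match σ, c, hy with
        | .inl s, .inl c, hy => exact hy.elim
        | .inl s, .inr x, hy => exact Or.inr (Or.inl ⟨s, x, hy⟩)
        | .inr E, c, _ => exact Empty.elim c
      | @app σ σ' f t ih =>
        match σ, σ', f, t, ih, hy with
        | .inl s, .inl s', f, _, ih, hy => exact ih hy
        | .inr E, .inl s', b, t, ih, hy =>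
          exact Or.inr (Or.inr ⟨E, s', b, _, Nat.lt_succ_iff.1 (Fin.isLt (ν.trTerm z ρ t)), hy⟩)
        | .inl s, .inr E', f, _, _, _ => exact Empty.elim f
        | .inr E, .inr E', f, _, _, _ => exact Empty.elim f
    have h : y ∈ trVars σ (ν.trTerm z ρ t) ∪ trVars σ (ν.trTerm z ρ u) := fv_trEq _ _ _ hy
    rcases h with h | h
    · rcases key t _ rfl h with ⟨m, h₁, h₂⟩ | h
      · exact Or.inl ⟨m, h₁, Or.inl h₂⟩
      · exact Or.inr h
    · rcases key u _ rfl h with ⟨m, h₁, h₂⟩ | h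
      · exact Or.inl ⟨m, h₁, Or.inr h₂⟩
      · exact Or.inr h
  | neg φ ih => exact ih hy
  | and φ ψ ih₁ ih₂ =>
    rcases hy with hy | hy
    · rcases ih₁ hy with ⟨m, h₁, h₂⟩ | h
      · exact Or.inl ⟨m, h₁, Or.inl h₂⟩
      · exact Or.inr h
    · rcases ih₂ hy with ⟨m, h₁, h₂⟩ | h
      · exact Or.inl ⟨m, h₁, Or.inr h₂⟩
      · exact Or.inr h
  | ex x φ ih =>
    match x with
    | (.inl s, m) =>
      rcases ih hy.1 with ⟨m', h₁, h₂⟩ | h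
      · refine Or.inl ⟨m', h₁, h₂, fun e => hy.2 ?_⟩
        have e₁ : (Sum.inl y.1 : L.Srt ⊕ W.ASrt) = Sum.inl s := congrArg Prod.fst e
        have e₂ : m' = m := congrArg Prod.snd e
        exact Prod.ext (Sum.inl.inj e₁) (h₁.trans (congrArg z e₂))
      · exact Or.inr h
    | (.inr E, m) =>
      rw [tr, Fml.mem_fv_bigOr] at hy
      obtain ⟨ψ, hψ, hy⟩ := hy
      obtain ⟨k, -, rfl⟩ := List.mem_map.1 hψ
      rcases ih hy with ⟨m', h₁, h₂⟩ | h
      · refine Or.inl ⟨m', h₁, h₂, fun e => ?_⟩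
        have e₁ : (Sum.inl y.1 : L.Srt ⊕ W.ASrt) = Sum.inr E := congrArg Prod.fst e
        exact Sum.inl_ne_inr e₁
      · exact Or.inr h

/-- Quantifiers over entries turn into finite disjunctions, so none is left if there were no others.
This brings the assumptions on quantifier-free formulae into play. -/
theorem isQF_tr {φ : Fml W.sig} (h : φ.ArtQuant) (ρ : W.Env n) : (ν.tr z ρ φ).IsQF := by
  induction φ generalizing ρ with
  | fls => trivial
  | @eq σ t u =>
    change (trEq σ _ _).IsQF
    match σ, t, u with
    | .inl s, _, _ => trivial
    | .inr E, t, u =>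
      change (@ite _ _ (Classical.propDecidable _) _ _ : Fml L).IsQF
      split_ifs <;> trivial
  | neg φ ih => exact ih h ρ
  | and φ ψ ih₁ ih₂ => exact ⟨ih₁ h.1 ρ, ih₂ h.2 ρ⟩
  | ex x φ ih =>
    match x, h with
    | (.inr E, m), h =>
      rw [tr, Fml.isQF_bigOr]
      intro ψ hψ
      obtain ⟨k, -, rfl⟩ := List.mem_map.1 hψ
      exact ih h _

end Names

end Setting

end Translation

end Artifact

namespace Artifact

/-! ## Restriction to finitely many entries -/

section Restriction

variable {L : Sig} {W : Setting L}

namespace Setting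

/-- A choice of finitely many entries, numbered without repetition. -/
structure ExtStruc.Emb (M : W.ExtStruc) (n : W.ASrt → ℕ) where
  f : ∀ E, Fin (n E + 1) → M.entries E
  inj : ∀ E, Function.Injective (f E)

namespace ExtStruc.Emb

variable {M : W.ExtStruc} {n : W.ASrt → ℕ} (j : M.Emb n) (α : Assignment M)

/-- The restriction of an assignment to the chosen entries. -/
def pull : Assignment (W.finStruc M.db n) where
  x y := α.x y
  a b k := α.a b (j.f _ k)

def val : (σ : W.sig.Srt) → ((W.finStruc M.db n).withAssignment (j.pull α)).carrier σ →
    (M.withAssignment α).carrier σ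
  | .inl _, d => d
  | .inr E, k => j.f E k

def lift (w : ((W.finStruc M.db n).withAssignment (j.pull α)).Assign) :
    (M.withAssignment α).Assign :=
  fun σ m => j.val α σ (w σ m)

theorem val_injective (σ : W.sig.Srt) : Function.Injective (j.val α σ) :=
  match σ with
  | .inl _ => fun _ _ h => h
  | .inr E => j.inj E

theorem val_eval (w : ((W.finStruc M.db n).withAssignment (j.pull α)).Assign) {σ : W.sig.Srt}
    (t : Term W.sig σ) : j.val α σ (t.eval _ w) = t.eval _ (j.lift α w) := by
  induction t with
  | var σ m => rfl
  | @cst σ c =>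
    match σ, c with
    | .inl s, .inl c => rfl
    | .inl s, .inr y => rfl
    | .inr E, c => exact Empty.elim c
  | @app σ σ' f t ih =>
    match σ, σ', f, t, ih with
    | .inl s, .inl s', f, _, ih => exact congrArg (M.db.fn f) ih
    | .inr E, .inl s', b, _, ih => exact congrArg (fun k => α.a b k) ih
    | .inl s, .inr E', f, _, _ => exact Empty.elim f
    | .inr E, .inr E', f, _, _ => exact Empty.elim f

theorem lift_upd (w : ((W.finStruc M.db n).withAssignment (j.pull α)).Assign) (x : W.sig.Var)
    (d : ((W.finStruc M.db n).withAssignment (j.pull α)).carrier x.1) :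
    j.lift α (Struc.upd _ w x d) = Struc.upd _ (j.lift α w) x (j.val α x.1 d) := by
  refine Struc.eq_upd (congrArg _ (Struc.upd_self _ _ _)) fun σ m h => ?_
  exact congrArg _ (Struc.upd_of_ne _ _ _ h)

/-- No function takes values in an artifact sort, so every choice of entries is closed under the
functions. The chosen part is a substructure, and quantifier-free formulae are absolute between it
and the whole. -/
theorem realize_iff_of_isQF {φ : Fml W.sig} (h : φ.IsQF)
    (w : ((W.finStruc M.db n).withAssignment (j.pull α)).Assign) :
    ((W.finStruc M.db n).withAssignment (j.pull α)).Realize w φ ↔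
      (M.withAssignment α).Realize (j.lift α w) φ := by
  induction φ with
  | fls => rfl
  | @eq σ t u =>
    change t.eval _ _ = u.eval _ _ ↔ t.eval _ _ = u.eval _ _
    rw [← val_eval, ← val_eval]
    exact (j.val_injective α σ).eq_iff.symm
  | neg φ ih => exact not_congr (ih h)
  | and φ ψ ih₁ ih₂ => exact and_congr (ih₁ h.1) (ih₂ h.2)
  | ex x φ => exact h.elim

end ExtStruc.Emb

theorem ExtStruc.exists_emb (M : W.ExtStruc) (D : ∀ E, Finset (M.entries E)) :
    ∃ (n : W.ASrt → ℕ) (j : M.Emb n), (∀ E, n E ≤ (D E).card) ∧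
      ∀ E, ∀ e ∈ D E, e ∈ Set.range (j.f E) := by
  classical
  have key : ∀ E, ∃ (n : ℕ) (f : Fin (n + 1) → M.entries E), n ≤ (D E).card ∧ Function.Injective f ∧
      ∀ e ∈ D E, e ∈ Set.range f := by
    intro E
    obtain ⟨e₀⟩ := M.nonempty E
    -- The extra entry covers the case of an empty `D E`. As a size `n` stands for `n + 1` entries,
    -- the bound remains the cardinality of `D E`.
    let D' := insert e₀ (D E)
    have hpos : 0 < D'.card := Finset.card_pos.2 ⟨e₀, by simp [D']⟩
    have hle : D'.card ≤ (D E).card + 1 := Finset.card_insert_le _ _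
    have hc : D'.card = D'.card - 1 + 1 := by omega
    refine ⟨D'.card - 1, fun k => ((D'.equivFinOfCardEq hc).symm k).1, by omega,
      Subtype.val_injective.comp (Equiv.injective _), fun e he => ?_⟩
    exact ⟨D'.equivFinOfCardEq hc ⟨e, by simp [D', he]⟩, by simp⟩
  choose n f h₁ h₂ h₃ using key
  exact ⟨n, ⟨f, h₂⟩, h₁, h₃⟩

/-- Formulae preserved when passing to finitely many entries. -/
def Univ (φ : Fml W.sig) : Prop :=
  ∀ (M : W.ExtStruc) (n : W.ASrt → ℕ) (j : M.Emb n) (α : Assignment M)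
    (w : ((W.finStruc M.db n).withAssignment (j.pull α)).Assign),
    (M.withAssignment α).Realize (j.lift α w) φ →
      ((W.finStruc M.db n).withAssignment (j.pull α)).Realize w φ

/-- Formulae whose truth over finitely many of the entries implies their truth. -/
def Exis (φ : Fml W.sig) : Prop :=
  ∀ (M : W.ExtStruc) (n : W.ASrt → ℕ) (j : M.Emb n) (α : Assignment M)
    (w : ((W.finStruc M.db n).withAssignment (j.pull α)).Assign),
    ((W.finStruc M.db n).withAssignment (j.pull α)).Realize w φ →
      (M.withAssignment α).Realize (j.lift α w) φ

/-- True formulae of this class remain true over any finite set of entries that extends a suitable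
one with at most `b` entries of every sort. -/
def Small (b : ℕ) (φ : Fml W.sig) : Prop :=
  ∀ (M : W.ExtStruc) (α : Assignment M) (v : (M.withAssignment α).Assign),
    (M.withAssignment α).Realize v φ → ∃ D : ∀ E, Finset (M.entries E), (∀ E, (D E).card ≤ b) ∧
      ∀ (n : W.ASrt → ℕ) (j : M.Emb n), (∀ E, ∀ e ∈ D E, e ∈ Set.range (j.f E)) →
        ∀ w, j.lift α w = v → ((W.finStruc M.db n).withAssignment (j.pull α)).Realize w φ

/-! ### Closure properties of the three classes. -/

theorem univ_of_isQF {φ : Fml W.sig} (h : φ.IsQF) : Univ φ :=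
  fun _ _ j α w => (j.realize_iff_of_isQF α h w).2

theorem exis_of_isQF {φ : Fml W.sig} (h : φ.IsQF) : Exis φ :=
  fun _ _ j α w => (j.realize_iff_of_isQF α h w).1

theorem Exis.neg {φ : Fml W.sig} (h : Exis φ) : Univ φ.neg :=
  fun M n j α w hw hw' => hw (h M n j α w hw')

theorem Exis.ex {φ : Fml W.sig} (h : Exis φ) (x : W.sig.Var) : Exis (φ.ex x) := by
  rintro M n j α w ⟨d, hd⟩
  exact ⟨_, j.lift_upd α w x d ▸ h M n j α _ hd⟩

theorem Exis.exs {φ : Fml W.sig} (h : Exis φ) (xs : List W.sig.Var) : Exis (φ.exs xs) := by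
  induction xs with
  | nil => exact h
  | cons x xs ih => exact ih.ex x

theorem Exis.or {φ ψ : Fml W.sig} (h : Exis φ) (h' : Exis ψ) : Exis (φ.or ψ) := by
  intro M n j α w hw
  rw [Struc.realize_or] at hw ⊢
  exact hw.imp (h M n j α w) (h' M n j α w)

theorem Univ.all {φ : Fml W.sig} (h : Univ φ) (x : W.sig.Var) : Univ (φ.all x) := by
  intro M n j α w hw
  rw [Struc.realize_all] at hw ⊢
  intro d
  exact h M n j α _ (j.lift_upd α w x d ▸ hw _)

theorem Univ.alls {φ : Fml W.sig} (h : Univ φ) (xs : List W.sig.Var) : Univ (φ.alls xs) := by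
  induction xs with
  | nil => exact h
  | cons x xs ih => exact ih.all x

theorem Univ.and {φ ψ : Fml W.sig} (h : Univ φ) (h' : Univ ψ) : Univ (φ.and ψ) :=
  fun M n j α w hw => ⟨h M n j α w hw.1, h' M n j α w hw.2⟩

theorem Univ.bigAnd {l : List (Fml W.sig)} (h : ∀ φ ∈ l, Univ φ) : Univ (Fml.bigAnd l) := by
  intro M n j α w hw
  rw [Struc.realize_bigAnd] at hw ⊢
  exact fun φ hφ => h φ hφ M n j α w (hw φ hφ)

/-- Passing to any set of entries preserves universal formulae, so no witnesses need to be kept. -/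
theorem Univ.small {φ : Fml W.sig} (h : Univ φ) : Small 0 φ := by
  intro M α v hv
  refine ⟨fun _ => ∅, fun _ => le_rfl, ?_⟩
  rintro n j - w rfl
  exact h M n j α w hv

theorem Small.mono {φ : Fml W.sig} {b b' : ℕ} (h : Small b φ) (hb : b ≤ b') : Small b' φ :=
  fun M α v hv =>
    let ⟨D, h₁, h₂⟩ := h M α v hv
    ⟨D, fun E => (h₁ E).trans hb, h₂⟩

theorem Small.and {φ ψ : Fml W.sig} {b b' : ℕ} (h : Small b φ) (h' : Small b' ψ) :
    Small (b + b') (φ.and ψ) := by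
  classical
  intro M α v hv
  obtain ⟨D, h₁, h₂⟩ := h M α v hv.1
  obtain ⟨D', h₁', h₂'⟩ := h' M α v hv.2
  refine ⟨fun E => D E ∪ D' E, fun E => (Finset.card_union_le _ _).trans
    (add_le_add (h₁ E) (h₁' E)), fun n j hj w hw => ⟨h₂ n j (fun E e he => hj E e ?_) w hw,
      h₂' n j (fun E e he => hj E e ?_) w hw⟩⟩
  · exact Finset.mem_union_left _ he
  · exact Finset.mem_union_right _ he

theorem Small.bigOr {l : List (Fml W.sig)} {b : ℕ} (h : ∀ φ ∈ l, Small b φ) :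
    Small b (Fml.bigOr l) := by
  intro M α v hv
  obtain ⟨φ, hφ, hv⟩ := Struc.realize_bigOr.1 hv
  obtain ⟨D, h₁, h₂⟩ := h φ hφ M α v hv
  exact ⟨D, h₁, fun n j hj w hw => Struc.realize_bigOr.2 ⟨φ, hφ, h₂ n j hj w hw⟩⟩

/-- A witness of an artifact sort is added to the set of entries to be kept; one of a basic sort
costs nothing, as the basic part is never restricted. -/
theorem Small.ex {φ : Fml W.sig} {b : ℕ} (h : Small b φ) (x : W.sig.Var) :
    Small (b + 1) (φ.ex x) := by
  classical
  rintro M α v ⟨d, hd⟩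
  obtain ⟨D, h₁, h₂⟩ := h M α _ hd
  suffices H : ∃ D' : ∀ E, Finset (M.entries E), (∀ E, (D' E).card ≤ b + 1) ∧
      ∀ (n : W.ASrt → ℕ) (j : M.Emb n), (∀ E, ∀ e ∈ D' E, e ∈ Set.range (j.f E)) →
        (∀ E, ∀ e ∈ D E, e ∈ Set.range (j.f E)) ∧ ∃ d', j.val α x.1 d' = d by
    obtain ⟨D', h₃, h₄⟩ := H
    refine ⟨D', h₃, ?_⟩
    rintro n j hj w rfl
    obtain ⟨h₅, d', rfl⟩ := h₄ n j hj
    exact ⟨d', h₂ n j h₅ _ (j.lift_upd α w x d')⟩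
  match x, d with
  | (.inl s, m), d => exact ⟨D, fun E => (h₁ E).trans (Nat.le_succ b), fun n j hj => ⟨hj, d, rfl⟩⟩
  | (.inr E, m), d =>
    have key : ∀ e₀ : M.entries E, ∃ D' : ∀ E, Finset (M.entries E), (∀ E, (D' E).card ≤ b + 1) ∧
        (∀ E, ∀ e ∈ D E, e ∈ D' E) ∧ e₀ ∈ D' E := by
      intro e₀
      refine ⟨Function.update D E (insert e₀ (D E)), fun E' => ?_, fun E' e he => ?_, by simp⟩
      · by_cases h : E' = E
        · subst h
          simpa using (Finset.card_insert_le _ _).trans (Nat.succ_le_succ (h₁ E'))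
        · simpa [h] using (h₁ E').trans (Nat.le_succ b)
      · by_cases h : E' = E
        · subst h
          simp [he]
        · simpa [h] using he
    obtain ⟨D', h₃, h₄, h₅⟩ := key d
    exact ⟨D', h₃, fun n j hj => ⟨fun E e he => hj E e (h₄ E e he), hj E _ h₅⟩⟩

theorem Small.exs {φ : Fml W.sig} {b : ℕ} (h : Small b φ) (xs : List W.sig.Var) :
    Small (b + xs.length) (φ.exs xs) := by
  induction xs with
  | nil => exact h
  | cons x xs ih => exact ih.ex x

/-- A sentence of the class `Small b` that is true remains true over any finite set of entries that
extends a suitable one with at most `b + 1` entries of every sort. -/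
theorem Small.holds {φ : Fml W.sig} {b : ℕ} (h : Small b φ) (hφ : φ.fv = ∅) {M : W.ExtStruc}
    {α : Assignment M} (hα : M.Holds α φ) : ∃ D : ∀ E, Finset (M.entries E),
      (∀ E, (D E).card ≤ b + 1) ∧
      ∀ (n : W.ASrt → ℕ) (j : M.Emb n), (∀ E, ∀ e ∈ D E, e ∈ Set.range (j.f E)) →
        (W.finStruc M.db n).Holds (j.pull α) φ := by
  classical
  let v : (M.withAssignment α).Assign := fun σ _ => ((M.withAssignment α).nonempty σ).some
  obtain ⟨D, h₁, h₂⟩ := h M α v (hα v)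
  -- Total assignments also give values to variables that do not occur, and those values must lie
  -- among the chosen entries. As `v` is constant on each sort, one further entry per sort suffices;
  -- hence the bound `b + 1`.
  let e₀ : ∀ E, M.entries E := fun E => v (.inr E) 0
  refine ⟨fun E => insert (e₀ E) (D E), fun E => (Finset.card_insert_le _ _).trans
    (Nat.succ_le_succ (h₁ E)), fun n j hj => ?_⟩
  have hj' : ∀ σ : W.sig.Srt, ∃ d, j.val α σ d = v σ 0 := fun σ =>
    match σ with
    | .inl s => ⟨_, rfl⟩
    | .inr E => hj E (e₀ E) (Finset.mem_insert_self _ _)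
  choose d hd using hj'
  have hw : j.lift α (fun σ _ => d σ) = v := by
    funext σ m
    exact hd σ
  exact (Struc.true_iff_realize hφ _).2
    (h₂ n j (fun E e he => hj E e (Finset.mem_insert_of_mem he)) _ hw)

theorem Exis.holds {φ : Fml W.sig} (h : Exis φ) (hφ : φ.fv = ∅) {M : W.ExtStruc}
    {α : Assignment M} {n : W.ASrt → ℕ} (j : M.Emb n)
    (hα : (W.finStruc M.db n).Holds (j.pull α) φ) : M.Holds α φ := by
  obtain ⟨w⟩ := ((W.finStruc M.db n).withAssignment (j.pull α)).assignNonempty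
  exact (Struc.true_iff_realize hφ _).2 (h M n j α w (hα w))

end Setting

end Restriction

end Artifact

namespace Artifact

/-! ## Satisfiability in the artifact extension -/

section Satisfiability

open Encodable

variable {L : Sig} {W : Setting L}

namespace Setting

/-- The number of the copy with index `i` of the variable number `m`. -/
def copyVar (i m : ℕ) : ℕ := 3 * Nat.pair i m

variable (W) in
/-- The names with index `i`: distinct variables. -/
def stdNames (i : ℕ) : W.Names where
  x {s} y := Term.var s (3 * Nat.pair i (encode y) + 1)
  a {E} {s} b k := Term.var s (3 * Nat.pair i (Nat.pair (Nat.pair (encode E) (encode b)) k) + 2)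

/-- Names that are constants. -/
def constNames (c : ∀ {s}, W.X s → L.Cst s) (d : ∀ {E s}, W.A E s → L.Cst s) : W.Names where
  x y := Term.cst (c y)
  a b _ := Term.cst (d b)

theorem copyVar_injective (i : ℕ) : Function.Injective (copyVar i) := by
  intro m m' h
  simpa [copyVar, Nat.pair_eq_pair] using h

/-- Residues modulo 3 keep the roles apart: 0 for copies of individual variables, 1 for names of
artifact variables, 2 for names of component values. -/
theorem stdNames_fresh (i j : ℕ) : (W.stdNames i).Fresh (copyVar j) where
  inj := copyVar_injective j
  x y s' m h := by
    have := congrArg Prod.snd (Set.mem_singleton_iff.1 h)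
    simp only [copyVar] at this
    omega
  a b k s' m h := by
    have := congrArg Prod.snd (Set.mem_singleton_iff.1 h)
    simp only [copyVar] at this
    omega

theorem constNames_fresh (c : ∀ {s}, W.X s → L.Cst s) (d : ∀ {E s}, W.A E s → L.Cst s) (j : ℕ) :
    (constNames c d).Fresh (copyVar j) where
  inj := copyVar_injective j
  x _ _ _ h := h
  a _ _ _ _ h := h

theorem Assignment.ext' {M : W.ExtStruc} {α β : Assignment M}
    (hx : ∀ (s : L.Srt) (y : W.X s), α.x y = β.x y)
    (ha : ∀ (E : W.ASrt) (s : L.Srt) (b : W.A E s) (e : M.entries E), α.a b e = β.a b e) :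
    α = β := by
  obtain ⟨x, a⟩ := α
  obtain ⟨x', a'⟩ := β
  have h₁ : @x = @x' := by
    funext s y
    exact hx s y
  have h₂ : @a = @a' := by
    funext E s b e
    exact ha E s b e
  subst h₁ h₂
  rfl

/-- Every family of assignments can be described by names. -/
theorem exists_stdNames_assign (N : Struc L) (n : W.ASrt → ℕ)
    (α : ℕ → Assignment (W.finStruc N n)) (v : ℕ → N.Assign) :
    ∃ u : N.Assign, ∀ i, (∀ s m, u s (copyVar i m) = v i s m) ∧
      (W.stdNames i).assign N u n = α i := by
  -- The number of a variable is decoded into what it names. Where decoding fails the value `v 0 s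
  -- 0` is arbitrary, and `Fin.ofNat` only alters entry numbers that are out of range.
  let u : N.Assign := fun s p =>
    if p % 3 = 0 then v (p / 3).unpair.1 s (p / 3).unpair.2
    else if p % 3 = 1 then
      match (decode (p / 3).unpair.2 : Option (W.X s)) with
      | some y => (α (p / 3).unpair.1).x y
      | none => v 0 s 0
    else
      match (decode (p / 3).unpair.2.unpair.1.unpair.1 : Option W.ASrt) with
      | some E =>
        match (decode (p / 3).unpair.2.unpair.1.unpair.2 : Option (W.A E s)) with
        | some b => (α (p / 3).unpair.1).a b (Fin.ofNat (n E + 1) (p / 3).unpair.2.unpair.2)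
        | none => v 0 s 0
      | none => v 0 s 0
  refine ⟨u, fun i => ⟨fun s m => ?_, ?_⟩⟩
  · simp [u, copyVar]
  · have hx : ∀ {s} (y : W.X s), u s (3 * Nat.pair i (encode y) + 1) = (α i).x y := by
      intro s y
      have h₁ : (3 * Nat.pair i (encode y) + 1) % 3 = 1 := by omega
      have h₂ : (3 * Nat.pair i (encode y) + 1) / 3 = Nat.pair i (encode y) := by omega
      simp only [u, h₁, h₂, Nat.unpair_pair, encodek]
      rfl
    have ha : ∀ {E s} (b : W.A E s) (k : Fin (n E + 1)),
        u s (3 * Nat.pair i (Nat.pair (Nat.pair (encode E) (encode b)) k.val) + 2) =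
          (α i).a b k := by
      intro E s b k
      have h₁ : ∀ q, (3 * q + 2) % 3 = 2 := by omega
      have h₂ : ∀ q, (3 * q + 2) / 3 = q := by omega
      simp [u, h₁, h₂]
      rfl
    exact Assignment.ext' (fun _ y => hx y) fun _ _ b k => ha b k

theorem Names.Fresh.holds_iff {ν : W.Names} {z : ℕ → ℕ} (h : ν.Fresh z) {n : W.ASrt → ℕ}
    {χ : Fml W.sig} (hχ : χ.fv = ∅) {N : Struc L} (u : N.Assign) (ρ : W.Env n) :
    N.Realize u (ν.tr z ρ χ) ↔ (W.finStruc N n).Holds (ν.assign N u n) χ := by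
  rw [h.realize_tr]
  exact (Struc.true_iff_realize hχ _).symm

/-- The environment in which all values are the first entry. -/
def zeroEnv (n : W.ASrt → ℕ) : W.Env n := fun _ _ => 0

/-- Sentences to which the elimination of artifact sorts applies. -/
structure Tame (χ : Fml W.sig) : Prop where
  closed : χ.fv = ∅
  artQuant : χ.ArtQuant
  small : Small χ.code χ

theorem ExtStruc.exists_small {M : W.ExtStruc} {α : Assignment M} {χ : Fml W.sig} (hχ : Tame χ)
    (h : M.Holds α χ) : ∃ (n : W.ASrt → ℕ) (j : M.Emb n), (∀ E, n E ≤ χ.code + 1) ∧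
      (W.finStruc M.db n).Holds (j.pull α) χ := by
  obtain ⟨D, h₁, h₂⟩ := hχ.small.holds hχ.closed h
  obtain ⟨n, j, h₃, h₄⟩ := M.exists_emb D
  exact ⟨n, j, fun E => (h₃ E).trans (h₁ E), h₂ n j h₄⟩

theorem extSatIn_of_satIn {𝒦 : Struc L → Prop} {χ : Fml W.sig} (hχ : χ.fv = ∅) {n : W.ASrt → ℕ}
    (ρ : W.Env n) (h : SatIn 𝒦 ((W.stdNames 0).tr (copyVar 0) ρ χ)) : W.ExtSatIn 𝒦 χ := by
  obtain ⟨N, hN, u, hu⟩ := h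
  exact ⟨W.finStruc N n, hN, _, ((stdNames_fresh 0 0).holds_iff hχ u ρ).1 hu⟩

/-- Restriction to the witnesses keeps the sentence true with the same basic part, and the bound on
the sizes is read off from the Gödel number. This bound makes the search finite. -/
theorem exists_satIn_of_extSatIn {𝒦 : Struc L → Prop} {χ : Fml W.sig} (hχ : Tame χ)
    (h : W.ExtSatIn 𝒦 χ) : ∃ n : W.ASrt → ℕ, (∀ E, n E ≤ χ.code + 1) ∧
      SatIn 𝒦 ((W.stdNames 0).tr (copyVar 0) (zeroEnv n) χ) := by
  obtain ⟨M, hM, α, hα⟩ := h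
  obtain ⟨n, j, h₁, h₂⟩ := M.exists_small hχ hα
  obtain ⟨v⟩ := M.db.assignNonempty
  obtain ⟨u, hu⟩ := exists_stdNames_assign M.db n (fun _ => j.pull α) fun _ => v
  refine ⟨n, h₁, M.db, hM, u, ((stdNames_fresh 0 0).holds_iff hχ.closed u _).2 ?_⟩
  rw [(hu 0).2]
  exact h₂

/-- Satisfiability transfers between classes of structures if that of constraints does. -/
theorem ExtSatIn.transfer {𝒦 𝒦' : Struc L → Prop}
    (h : ∀ φ : Fml L, φ.IsConstraint → SatIn 𝒦 φ → SatIn 𝒦' φ) {χ : Fml W.sig} (hχ : Tame χ)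
    (hs : W.ExtSatIn 𝒦 χ) : W.ExtSatIn 𝒦' χ :=
  let ⟨_, _, h₂⟩ := exists_satIn_of_extSatIn hχ hs
  extSatIn_of_satIn hχ.closed _ (h₂.transfer h (Names.isQF_tr hχ.artQuant _))

theorem ExtSatIn.mono {𝒦 𝒦' : Struc L → Prop} (h : ∀ N, 𝒦 N → 𝒦' N) {χ : Fml W.sig}
    (hs : W.ExtSatIn 𝒦 χ) : W.ExtSatIn 𝒦' χ :=
  let ⟨M, hM, hα⟩ := hs
  ⟨M, h _ hM, hα⟩

end Setting

/-! ### Syntactic classes -/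

namespace Fml

theorem code_lt_and_left (φ ψ : Fml L) : φ.code < (φ.and ψ).code :=
  lt_of_lt_of_le (lt_of_le_of_lt (Nat.left_le_pair φ.code ψ.code) (by omega))
    (Nat.add_le_pair 3 (Nat.pair φ.code ψ.code))

theorem code_lt_ex (x : L.Var) (φ : Fml L) : φ.code < (φ.ex x).code :=
  lt_of_lt_of_le (lt_of_le_of_lt
    (Nat.right_le_pair (Nat.pair (encode x.1) x.2) φ.code) (by omega)) (Nat.add_le_pair 4 _)

/-- Each quantifier increases the Gödel number, so the number itself is a computable bound for the
number of witnesses. -/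
theorem length_le_code_exs (xs : List L.Var) (φ : Fml L) : xs.length ≤ (φ.exs xs).code := by
  induction xs with
  | nil => exact Nat.zero_le _
  | cons x xs ih => exact lt_of_le_of_lt ih (code_lt_ex x _)

theorem IsQF.artQuant {φ : Fml W.sig} (h : φ.IsQF) : φ.ArtQuant := by
  induction φ with
  | fls => trivial
  | eq t u => trivial
  | neg φ ih => exact ih h
  | and φ ψ ih₁ ih₂ => exact ⟨ih₁ h.1, ih₂ h.2⟩
  | ex x φ => exact h.elim

theorem ArtQuant.exs {φ : Fml W.sig} (h : φ.ArtQuant) {xs : List W.sig.Var}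
    (hxs : W.AreArtifactVars xs) : (φ.exs xs).ArtQuant := by
  induction xs with
  | nil => exact h
  | cons x xs ih =>
    have ih := ih fun e he => hxs e (List.mem_cons_of_mem _ he)
    obtain ⟨E, hE⟩ := hxs x List.mem_cons_self
    obtain ⟨σ, m⟩ := x
    subst hE
    exact ih

theorem ArtQuant.alls {φ : Fml W.sig} (h : φ.ArtQuant) {xs : List W.sig.Var}
    (hxs : W.AreArtifactVars xs) : (φ.alls xs).ArtQuant := by
  induction xs with
  | nil => exact h
  | cons x xs ih =>
    have ih := ih fun e he => hxs e (List.mem_cons_of_mem _ he)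
    obtain ⟨E, hE⟩ := hxs x List.mem_cons_self
    obtain ⟨σ, m⟩ := x
    subst hE
    exact ih

end Fml

namespace Setting

theorem IsState.closed {φ : Fml W.sig} (h : W.IsState φ) : φ.fv = ∅ := by
  obtain ⟨_, _, _, _, _, h⟩ := h
  exact h

theorem IsState.exis {φ : Fml W.sig} (h : W.IsState φ) : Exis φ := by
  obtain ⟨xs, φ, h₁, h₂, rfl, h₃⟩ := h
  exact (exis_of_isQF h₂).exs xs

/-- Only the values of the existential prefix have to be kept; the universal part passes to
substructures. -/
theorem IsExAll.tame {φ : Fml W.sig} (h : W.IsExAll φ) : Tame φ := by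
  obtain ⟨xs, ys, φ, h₁, h₂, h₃, rfl, h₄⟩ := h
  exact ⟨h₄, (h₃.artQuant.alls h₂).exs h₁, (((univ_of_isQF h₃).alls ys).small.exs xs).mono
    (by simpa using Fml.length_le_code_exs xs _)⟩

theorem IsState.tame {φ : Fml W.sig} (h : W.IsState φ) : Tame φ := by
  obtain ⟨xs, φ, h₁, h₂, rfl, h₃⟩ := h
  exact IsExAll.tame ⟨xs, [], φ, h₁, by simp [AreArtifactVars], h₂, rfl, h₃⟩

theorem IsStateDisj.closed {B : Fml W.sig} (h : W.IsStateDisj B) : B.fv = ∅ := by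
  induction h with
  | bot => rfl
  | or h _ ih => rw [Fml.fv_or, h.closed, ih, Set.union_empty]

theorem IsStateDisj.exis {B : Fml W.sig} (h : W.IsStateDisj B) : Exis B := by
  induction h with
  | bot => exact exis_of_isQF trivial
  | or h _ ih => exact h.exis.or ih

theorem IsStateDisj.artQuant {B : Fml W.sig} (h : W.IsStateDisj B) : B.ArtQuant := by
  induction h with
  | bot => trivial
  | or h _ ih => exact ⟨h.tame.artQuant, ih⟩

/-- The negation of `B` is preserved under restriction, so the witnesses of `φ` alone suffice. -/
theorem IsState.tame_and_neg {φ B : Fml W.sig} (h : W.IsState φ) (hB : W.IsStateDisj B) :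
    Tame (φ.and B.neg) where
  closed := (congrArg₂ (· ∪ ·) h.closed hB.closed).trans (Set.union_empty _)
  artQuant := ⟨h.tame.artQuant, hB.artQuant⟩
  small := (h.tame.small.and hB.exis.neg.small).mono (Fml.code_lt_and_left _ _).le

end Setting

end Satisfiability

end Artifact

namespace Artifact

/-! ## Transitions as formulae over a doubled artifact setting -/

section Doubling

variable {L : Sig} {W : Setting L} {T : Set (Fml L)}

namespace Setting

/-- The artifact setting with two copies of the artifact variables and components. -/
def dbl (W : Setting L) : Setting L where
  ASrt := W.ASrt
  X s := W.X s ⊕ W.X s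
  A E s := W.A E s ⊕ W.A E s

def dblCst : (σ : W.sig.Srt) → W.sig.Cst σ → W.dbl.sig.Cst σ
  | .inl _, .inl c => Sum.inl c
  | .inl _, .inr y => Sum.inr (Sum.inl y)

def dblFn : (σ σ' : W.sig.Srt) → W.sig.Fn σ σ' → W.dbl.sig.Fn σ σ'
  | .inl _, .inl _, f => f
  | .inr _, .inl _, b => Sum.inl b

/-- A term about the first copy. -/
def _root_.Artifact.Term.dbl : {σ : W.sig.Srt} → Term W.sig σ → Term W.dbl.sig σ
  | _, .var σ m => Term.var (L := W.dbl.sig) σ m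
  | _, .cst (s := σ) c => Term.cst (L := W.dbl.sig) (dblCst σ c)
  | _, .app (s := σ) (s' := σ') f t => Term.app (L := W.dbl.sig) (dblFn σ σ' f) t.dbl

/-- A formula about the first copy. -/
def _root_.Artifact.Fml.dbl : Fml W.sig → Fml W.dbl.sig
  | .fls => .fls
  | .eq t u => .eq t.dbl u.dbl
  | .neg φ => .neg φ.dbl
  | .and φ ψ => .and φ.dbl ψ.dbl
  | .ex x φ => .ex (L := W.dbl.sig) x φ.dbl

def ExtStruc.dbl (M : W.ExtStruc) : W.dbl.ExtStruc where
  db := M.db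
  entries := M.entries
  nonempty := M.nonempty

def Assignment.dbl {M : W.ExtStruc} (α α' : Assignment M) : Assignment M.dbl where
  x
    | .inl y => α.x y
    | .inr y => α'.x y
  a
    | .inl b, e => α.a b e
    | .inr b, e => α'.a b e

theorem eval_dbl {M : W.ExtStruc} (α α' : Assignment M) (v : (M.withAssignment α).Assign)
    {σ : W.sig.Srt} (t : Term W.sig σ) :
    t.dbl.eval (M.dbl.withAssignment (α.dbl α')) v = t.eval (M.withAssignment α) v := by
  induction t with
  | var σ m => rfl
  | @cst σ c =>
    match σ, c with
    | .inl s, .inl c => rfl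
    | .inl s, .inr y => rfl
    | .inr E, c => exact Empty.elim c
  | @app σ σ' f t ih =>
    match σ, σ', f, t, ih with
    | .inl s, .inl s', f, _, ih => exact congrArg (M.db.fn f) ih
    | .inr E, .inl s', b, _, ih => exact congrArg (fun k => α.a b k) ih
    | .inl s, .inr E', f, _, _ => exact Empty.elim f
    | .inr E, .inr E', f, _, _ => exact Empty.elim f

theorem realize_dbl {M : W.ExtStruc} (α α' : Assignment M) (φ : Fml W.sig)
    (v : (M.withAssignment α).Assign) :
    (M.dbl.withAssignment (α.dbl α')).Realize v φ.dbl ↔ (M.withAssignment α).Realize v φ := by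
  induction φ generalizing v with
  | fls => rfl
  | eq t u => exact Eq.congr (eval_dbl α α' v t) (eval_dbl α α' v u)
  | neg φ ih => exact not_congr (ih v)
  | and φ ψ ih₁ ih₂ => exact and_congr (ih₁ v) (ih₂ v)
  | ex x φ ih => exact exists_congr fun d => ih _

theorem isQF_dbl {φ : Fml W.sig} (h : φ.IsQF) : φ.dbl.IsQF := by
  induction φ with
  | fls => trivial
  | eq t u => trivial
  | neg φ ih => exact ih h
  | and φ ψ ih₁ ih₂ => exact ⟨ih₁ h.1, ih₂ h.2⟩
  | ex x φ => exact h.elim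

/-- The equation `x' = F(⋯)`, where the term `u` stands for `x'`. -/
def CaseDef.graph {s : L.Srt} (F : W.CaseDef T s) (u : Term W.dbl.sig (Sum.inl s)) :
    Fml W.dbl.sig :=
  Fml.bigAnd (F.cases.map fun p => Fml.imp p.1.dbl (Fml.eq (L := W.dbl.sig) u p.2.dbl))

theorem CaseDef.realize_graph {s : L.Srt} (F : W.CaseDef T s) (u : Term W.dbl.sig (Sum.inl s))
    {M : W.ExtStruc} (α α' : Assignment M) (v : (M.withAssignment α).Assign) :
    (M.dbl.withAssignment (α.dbl α')).Realize v (F.graph u) ↔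
      F.IsValue α v (u.eval (M.dbl.withAssignment (α.dbl α')) v) := by
  refine (Struc.realize_bigAnd.trans List.forall_mem_map).trans (forall₂_congr fun p _ => ?_)
  exact Struc.realize_imp.trans <| imp_congr (realize_dbl α α' p.1 v)
    (Eq.congr rfl (eval_dbl α α' v p.2))

theorem CaseDef.isQF_graph {s : L.Srt} (F : W.CaseDef T s) (u : Term W.dbl.sig (Sum.inl s)) :
    (F.graph u).IsQF := by
  refine Fml.isQF_bigAnd.2 fun φ hφ => ?_
  obtain ⟨p, hp, rfl⟩ := List.mem_map.1 hφ
  exact ⟨isQF_dbl (F.qf p hp), trivial⟩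

namespace Transition

variable (t : W.Transition T)

/-- The matrix of the transition formula, the second copy of the setting being the primed one. -/
noncomputable def matrix : Fml W.dbl.sig :=
  .and t.guard.dbl <| .and
    (Fml.bigAnd ((finList (Σ s, W.X s)).map fun y => (t.F y.2).graph
      (Term.cst (L := W.dbl.sig) (s := Sum.inl y.1) (Sum.inr (Sum.inr y.2)))))
    (Fml.bigAnd ((finList (Σ E s, W.A E s)).map fun b => Fml.all (L := W.dbl.sig)
      (Sum.inr b.1, t.y b.2.2) ((t.G b.2.2).graph (Term.app (L := W.dbl.sig) (s := Sum.inr b.1)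
        (s' := Sum.inl b.2.1) (Sum.inr b.2.2) (Term.var (L := W.dbl.sig) (Sum.inr b.1)
          (t.y b.2.2))))))

/-- Truth of the matrix. -/
def HoldsAt (M : W.ExtStruc) (α α' : Assignment M) (v : (M.withAssignment α).Assign) : Prop :=
  (M.withAssignment α).Realize v t.guard ∧
    (∀ {s : L.Srt} (x : W.X s), (t.F x).IsValue α v (α'.x x)) ∧
    (∀ {E : W.ASrt} {s : L.Srt} (a : W.A E s) (d : M.entries E),
      (t.G a).IsValue α
        ((M.withAssignment α).upd v ((Sum.inr E, t.y a) : W.sig.Var) d) (α'.a a d))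

theorem realize_matrix {M : W.ExtStruc} (α α' : Assignment M) (v : (M.withAssignment α).Assign) :
    (M.dbl.withAssignment (α.dbl α')).Realize v t.matrix ↔ t.HoldsAt M α α' v := by
  refine and_congr (realize_dbl α α' _ v) (and_congr ?_ ?_)
  · refine (Struc.realize_bigAnd.trans List.forall_mem_map).trans ?_
    constructor
    · intro h s y
      exact ((t.F y).realize_graph _ α α' v).1 (h ⟨s, y⟩ (mem_finList _))
    · intro h y _
      exact ((t.F y.2).realize_graph _ α α' v).2 (h y.2)
  · refine (Struc.realize_bigAnd.trans List.forall_mem_map).trans ?_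
    -- The bound variable has the value `d`, so the term that stands for `a'(y)` evaluates to the
    -- new value of the component at `d`.
    have key : ∀ {E : W.ASrt} {s : L.Srt} (b : W.A E s) (d : M.entries E),
        Term.eval (M.dbl.withAssignment (α.dbl α'))
          ((M.withAssignment α).upd v ((Sum.inr E, t.y b) : W.sig.Var) d)
          (Term.app (L := W.dbl.sig) (s := Sum.inr E) (s' := Sum.inl s) (Sum.inr b)
            (Term.var (L := W.dbl.sig) (Sum.inr E) (t.y b))) = α'.a b d := by
      intro E s b d
      exact congrArg (fun e => α'.a b e) (Struc.upd_self v ((Sum.inr E, t.y b) : W.sig.Var) d)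
    constructor
    · intro h E s b d
      have := ((t.G b).realize_graph _ α α' _).1
        (Struc.realize_all.1 (h ⟨E, s, b⟩ (mem_finList _)) d)
      exact (congrArg (fun e => (t.G b).IsValue α
        ((M.withAssignment α).upd v ((Sum.inr E, t.y b) : W.sig.Var) d) e) (key b d)).mp this
    · intro h b _
      refine Struc.realize_all.2 fun d => ((t.G b.2.2).realize_graph _ α α' _).2 ?_
      exact (congrArg (fun e => (t.G b.2.2).IsValue α
        ((M.withAssignment α).upd v ((Sum.inr b.1, t.y b.2.2) : W.sig.Var) d) e)
          (key b.2.2 d)).mpr (h b.2.2 d)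

/-- Guard and graphs are quantifier-free; the only quantifiers are the universal ones over the
argument of an updated component. -/
theorem univ_matrix : Univ t.matrix := by
  refine (univ_of_isQF (isQF_dbl t.guard_qf)).and (Univ.and ?_ ?_)
  · refine univ_of_isQF (Fml.isQF_bigAnd.2 fun φ hφ => ?_)
    obtain ⟨y, -, rfl⟩ := List.mem_map.1 hφ
    exact CaseDef.isQF_graph _ _
  · refine Univ.bigAnd fun φ hφ => ?_
    obtain ⟨b, -, rfl⟩ := List.mem_map.1 hφ
    exact (univ_of_isQF (CaseDef.isQF_graph _ _)).all _

theorem _root_.Artifact.Fml.ArtQuant.bigAnd {l : List (Fml W.sig)} (h : ∀ φ ∈ l, φ.ArtQuant) :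
    (Fml.bigAnd l).ArtQuant := by
  induction l with
  | nil => trivial
  | cons φ l ih => exact ⟨h φ List.mem_cons_self, ih fun ψ hψ => h ψ (List.mem_cons_of_mem _ hψ)⟩

theorem artQuant_matrix : t.matrix.ArtQuant := by
  refine ⟨(isQF_dbl t.guard_qf).artQuant, Fml.ArtQuant.bigAnd fun φ hφ => ?_,
    Fml.ArtQuant.bigAnd fun φ hφ => ?_⟩
  · obtain ⟨y, -, rfl⟩ := List.mem_map.1 hφ
    exact (CaseDef.isQF_graph _ _).artQuant
  · obtain ⟨b, -, rfl⟩ := List.mem_map.1 hφ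
    exact (CaseDef.isQF_graph (t.G b.2.2) _).artQuant

end Transition

/-- Names for both copies. -/
def Names.dbl (ν ν' : W.Names) : W.dbl.Names where
  x
    | .inl y => ν.x y
    | .inr y => ν'.x y
  a
    | .inl b, k => ν.a b k
    | .inr b, k => ν'.a b k

theorem Names.Fresh.dbl {ν ν' : W.Names} {z : ℕ → ℕ} (h : ν.Fresh z) (h' : ν'.Fresh z) :
    (ν.dbl ν').Fresh z where
  inj := h.inj
  x
    | .inl y => h.x y
    | .inr y => h'.x y
  a
    | .inl b => h.a b
    | .inr b => h'.a b

theorem Names.assign_dbl (ν ν' : W.Names) (N : Struc L) (u : N.Assign) (n : W.ASrt → ℕ) :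
    (ν.dbl ν').assign N u n =
      (Assignment.dbl (ν.assign N u n) (ν'.assign N u n) : Assignment (W.finStruc N n).dbl) := by
  refine Assignment.ext' (fun s y => ?_) fun E s b e => ?_
  · rcases y with y | y <;> rfl
  · rcases b with b | b <;> rfl

def ExtStruc.Emb.dbl {M : W.ExtStruc} {n : W.ASrt → ℕ} (j : M.Emb n) : M.dbl.Emb (W := W.dbl) n :=
  ⟨j.f, j.inj⟩

theorem ExtStruc.Emb.pull_dbl {M : W.ExtStruc} {n : W.ASrt → ℕ} (j : M.Emb n)
    (α α' : Assignment M) : j.dbl.pull (α.dbl α') =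
      (Assignment.dbl (j.pull α) (j.pull α') : Assignment (W.finStruc M.db n).dbl) := by
  refine Assignment.ext' (fun s y => ?_) fun E s b e => ?_
  · rcases y with y | y <;> rfl
  · rcases b with b | b <;> rfl

/-- The type of `v` mentions the assignment although the carriers do not depend on it, which makes
direct rewriting awkward. -/
theorem realize_congr_assignment {M : W.ExtStruc} {α β : Assignment M} (h : α = β)
    (v : (M.withAssignment α).Assign) (φ : Fml W.sig) :
    (M.withAssignment α).Realize v φ ↔ (M.withAssignment β).Realize v φ := by
  subst h
  rfl

theorem ExtStruc.Emb.lift_dbl {M : W.ExtStruc} {n : W.ASrt → ℕ} (j : M.Emb n)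
    (α α' : Assignment M) (w : ((W.finStruc M.db n).withAssignment (j.pull α)).Assign) :
    j.dbl.lift (α.dbl α') w = j.lift α w := by
  funext σ m
  match σ with
  | .inl s => rfl
  | .inr E => rfl

theorem Names.glue_dbl {N : Struc L} {n : W.ASrt → ℕ} (z : ℕ → ℕ)
    (α : Assignment (W.finStruc N n)) (β : Assignment (W.dbl.finStruc N n)) (u : N.Assign)
    (ρ : W.Env n) : Names.glue (W := W.dbl) z β u ρ = Names.glue z α u ρ := by
  funext σ m
  match σ with
  | .inl s => rfl
  | .inr E => rfl

/-- Transitions can be restricted to finitely many entries. -/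
theorem Transition.HoldsAt.pull {t : W.Transition T} {M : W.ExtStruc} {n : W.ASrt → ℕ}
    (j : M.Emb n) {α α' : Assignment M}
    {w : ((W.finStruc M.db n).withAssignment (j.pull α)).Assign}
    (h : t.HoldsAt M α α' (j.lift α w)) : t.HoldsAt _ (j.pull α) (j.pull α') w :=
  (t.realize_matrix _ _ w).1 <| (realize_congr_assignment (j.pull_dbl α α') w _).1 <|
    t.univ_matrix M.dbl n j.dbl (α.dbl α') w
      ((t.realize_matrix α α' _).2 ((j.lift_dbl α α' w).symm ▸ h))

/-- Over numbered entries a transition with given values of its existential variables becomes a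
formula about the two families of names. -/
theorem Transition.realize_tr_matrix (t : W.Transition T) {ν ν' : W.Names} {z : ℕ → ℕ}
    (h : ν.Fresh z) (h' : ν'.Fresh z) {N : Struc L} (u : N.Assign) {n : W.ASrt → ℕ}
    (ρ : W.Env n) :
    N.Realize u ((ν.dbl ν').tr z (W := W.dbl) (n := n) ρ t.matrix) ↔
      t.HoldsAt (W.finStruc N n) (ν.assign N u n) (ν'.assign N u n)
        (Names.glue z (ν.assign N u n) u ρ) := by
  refine ((h.dbl h').realize_tr t.matrix u ρ).trans
    ((realize_congr_assignment (Names.assign_dbl ν ν' N u n) _ _).trans ?_)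
  refine Iff.trans (Eq.to_iff ?_) (t.realize_matrix (ν.assign N u n) (ν'.assign N u n)
    (Names.glue z (ν.assign N u n) u ρ))
  exact congrArg (fun v => Struc.Realize _ v t.matrix)
    (Names.glue_dbl z (ν.assign N u n) ((ν.dbl ν').assign N u n) u ρ)

end Setting

end Doubling

end Artifact

namespace Artifact

/-! ## Runs and their transfer between classes of structures -/

section Runs

namespace Setting

variable {L : Sig} {W : Setting L} {T : Set (Fml L)}

theorem Transition.HoldsAt.congr {t : W.Transition T} {M : W.ExtStruc} {α α' : Assignment M}
    {v v' : (M.withAssignment α).Assign} (h : t.HoldsAt M α α' v)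
    (hv : ∀ (σ : W.sig.Srt) (m : ℕ), ((σ, m) : W.dbl.sig.Var) ∈ t.matrix.fv → v σ m = v' σ m) :
    t.HoldsAt M α α' v' :=
  (t.realize_matrix α α' v').1 <| (Struc.realize_congr (M := M.dbl.withAssignment (α.dbl α'))
    t.matrix hv).1 <| (t.realize_matrix α α' v).2 h

/-- A transition remains possible over any finite set of entries that extends a suitable one. -/
theorem Transition.HoldsAt.restrict {t : W.Transition T} {M : W.ExtStruc} {α α' : Assignment M}
    {v : (M.withAssignment α).Assign} (h : t.HoldsAt M α α' v) :
    ∃ D : ∀ E, Finset (M.entries E), ∀ (n : W.ASrt → ℕ) (j : M.Emb n),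
      (∀ E, ∀ e ∈ D E, e ∈ Set.range (j.f E)) → ∃ ρ : W.Env n,
        t.HoldsAt _ (j.pull α) (j.pull α')
          (Names.glue id (j.pull α) (fun s m => v (.inl s) m) ρ) := by
  classical
  -- Only the values of the finitely many free variables of the matrix matter.
  have hfin : ∀ E, {e : M.entries E | ∃ m, ((Sum.inr E, m) : W.dbl.sig.Var) ∈ t.matrix.fv ∧
      v (.inr E) m = e}.Finite := fun E => by
    refine (t.matrix.fv_finite.image fun x => v (.inr E) x.2).subset ?_
    rintro e ⟨m, hm, rfl⟩
    exact ⟨_, hm, rfl⟩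
  refine ⟨fun E => (hfin E).toFinset, fun n j hj => ?_⟩
  -- The default `0` is taken only where the value of a variable is not a chosen entry, which cannot
  -- happen for a free variable of the matrix.
  let ρ : W.Env n := fun E m =>
    if hm : ∃ k, j.f E k = v (.inr E) m then hm.choose else 0
  refine ⟨ρ, Transition.HoldsAt.pull j (h.congr fun σ m hm => ?_)⟩
  match σ, hm with
  | .inl s, _ => rfl
  | .inr E, hm =>
    have hex : ∃ k, j.f E k = v (.inr E) m :=
      hj E _ ((hfin E).mem_toFinset.2 ⟨m, hm, rfl⟩)
    have : ρ E m = hex.choose := dif_pos hex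
    exact hex.choose_spec.symm.trans (congrArg (j.f E) this.symm)

end Setting

/-! ### Runs as formulae over the DB signature. -/

namespace RAS

open Setting

variable (S : RAS)

/-- There is a run of `k` steps that ends with `υ`, in a structure with reduct in `𝒦`. -/
def Reach (𝒦 : Struc S.schema.sig → Prop) (k : ℕ) (υ : Fml S.setting.sig) : Prop :=
  ∃ M : S.setting.ExtStruc, 𝒦 M.db ∧ ∃ α : ℕ → Assignment M,
    S.Init M (α 0) ∧ (∀ i < k, S.Step M (α i) (α (i + 1))) ∧ M.Holds (α k) υ

variable {S}

theorem safe_iff {υ : Fml S.setting.sig} : S.Safe υ ↔ ∀ k, ¬ S.Reach S.schema.IsInstance k υ := by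
  unfold Safe Reach
  constructor
  · rintro h k ⟨M, hM, α, hα⟩
    exact h ⟨M, hM, k, α, hα⟩
  · rintro h ⟨M, hM, k, α, hα⟩
    exact h k ⟨M, hM, α, hα⟩

theorem initTSat_iff {φ : Fml S.setting.sig} :
    S.InitTSat φ ↔ S.Reach (fun N => N.Models S.schema.T) 0 φ := by
  constructor
  · rintro ⟨M, hM, α, h₁, h₂⟩
    exact ⟨M, hM, fun _ => α, h₁, fun i hi => absurd hi (Nat.not_lt_zero i), h₂⟩
  · rintro ⟨M, hM, α, h₁, -, h₂⟩
    exact ⟨M, hM, α 0, h₁, h₂⟩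

variable (S) in
/-- The names of the initial values. -/
def initNames : S.setting.Names := constNames S.c S.d

variable (S) in
/-- Names for the values along a run. -/
def runNames (i : ℕ) : S.setting.Names := if i = 0 then S.initNames else S.setting.stdNames i

theorem runNames_fresh (i j : ℕ) : (S.runNames i).Fresh (copyVar j) := by
  unfold runNames
  split_ifs
  · exact constNames_fresh _ _ j
  · exact stdNames_fresh i j

theorem initNames_assign {M : S.setting.ExtStruc} {α : Assignment M} (h : S.Init M α)
    {n : S.setting.ASrt → ℕ} (j : M.Emb n) (u : M.db.Assign) :
    S.initNames.assign M.db u n = j.pull α :=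
  Assignment.ext' (fun _ y => (h.1 y).symm) fun _ _ b e => (h.2 b (j.f _ e)).symm

/-- With constants as names the initial formula holds automatically, so it needs no conjunct in the
description of a run. -/
theorem init_initNames (N : Struc S.schema.sig) (u : N.Assign) (n : S.setting.ASrt → ℕ) :
    S.Init (S.setting.finStruc N n) (S.initNames.assign N u n) :=
  ⟨fun _ => rfl, fun _ _ => rfl⟩

/-- Over entries that contain the witnesses of all steps and of `υ`, the run is coded by one
quantifier-free formula `ψ`. It is satisfied at the original basic part, and a solution of `ψ`
elsewhere decodes to a run over as many entries. -/
theorem Reach.transfer {𝒦 𝒦' : Struc S.schema.sig → Prop}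
    (h : ∀ φ : Fml S.schema.sig, φ.IsConstraint → SatIn 𝒦 φ → SatIn 𝒦' φ) {k : ℕ}
    {υ : Fml S.setting.sig} (hυ : Tame υ) (hs : S.Reach 𝒦 k υ) : S.Reach 𝒦' k υ := by
  classical
  obtain ⟨M, hM, α, hα₀, hα, hα'⟩ := hs
  choose t ht v hv using hα
  choose D hD using fun (i : ℕ) (hi : i < k) =>
    (show (t i hi).HoldsAt M _ _ _ from hv i hi).restrict
  obtain ⟨D', -, hD'⟩ := hυ.small.holds hυ.closed hα'
  -- One choice of entries serves all steps and the final formula; no bound on the sizes is needed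
  -- here.
  obtain ⟨n, j, -, hj⟩ := M.exists_emb fun E =>
    D' E ∪ Finset.univ.biUnion fun i : Fin k => D i i.2 E
  have hj' := hD' n j fun E e he => hj E e (Finset.mem_union_left _ he)
  choose ρ hρ using fun (i : ℕ) (hi : i < k) => hD i hi n j fun E e he =>
    hj E e (Finset.mem_union_right _ (Finset.mem_biUnion.2 ⟨⟨i, hi⟩, Finset.mem_univ _, he⟩))
  obtain ⟨u₀⟩ := M.db.assignNonempty
  -- A single assignment `u` describes the whole run: names with index `i` give the values at stage
  -- `i`, copies with index `i` the basic-sort variables of the `i`-th transition.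
  obtain ⟨u, hu⟩ := exists_stdNames_assign (W := S.setting) M.db n (fun i => j.pull (α i))
    fun i => if hi : i < k then fun s m => v i hi (.inl s) m else u₀
  have hnames : ∀ i, (S.runNames i).assign M.db u n = j.pull (α i) := by
    intro i
    unfold runNames
    split_ifs with hi
    · subst hi
      exact initNames_assign hα₀ j u
    · exact (hu i).2
  -- The `i`-th conjunct relates the names of stages `i` and `i + 1`. It uses the variable copies
  -- with index `i`, so that different steps may choose their existential values independently.
  let ψ : Fml S.schema.sig := Fml.and
    (Fml.bigAnd ((finList (Fin k)).map fun i : Fin k =>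
      ((S.runNames i.1).dbl (S.runNames (i.1 + 1))).tr
      (W := S.setting.dbl) (copyVar i.1) (n := n) (ρ i i.2) (t i i.2).matrix))
    ((S.runNames k).tr (copyVar 0) (zeroEnv n) υ)
  have hψ : ψ.IsQF := by
    refine ⟨Fml.isQF_bigAnd.2 fun φ hφ => ?_, Names.isQF_tr hυ.artQuant _⟩
    obtain ⟨i, -, rfl⟩ := List.mem_map.1 hφ
    exact Names.isQF_tr (Transition.artQuant_matrix _) _
  have key : ∀ (N : Struc S.schema.sig) (u : N.Assign), N.Realize u ψ ↔
      (∀ (i : ℕ) (hi : i < k), (t i hi).HoldsAt (S.setting.finStruc N n)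
        ((S.runNames i).assign N u n) ((S.runNames (i + 1)).assign N u n)
        (Names.glue (copyVar i) _ u (ρ i hi))) ∧
      (S.setting.finStruc N n).Holds ((S.runNames k).assign N u n) υ := by
    intro N u
    refine and_congr ?_ ((runNames_fresh k 0).holds_iff hυ.closed u _)
    refine (Struc.realize_bigAnd.trans List.forall_mem_map).trans
      ⟨fun H i hi => ?_, fun H i _ => ?_⟩
    · exact ((t i hi).realize_tr_matrix (runNames_fresh _ _) (runNames_fresh _ _) u _).1
        (H ⟨i, hi⟩ (mem_finList _))
    · exact ((t i i.2).realize_tr_matrix (runNames_fresh _ _) (runNames_fresh _ _) u _).2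
        (H i i.2)
  have hsat : SatIn 𝒦 ψ := by
    refine ⟨M.db, hM, u, (key _ u).2 ⟨fun i hi => ?_, ?_⟩⟩
    · have hglue : ∀ β : Assignment (S.setting.finStruc M.db n),
          Names.glue (copyVar i) β u (ρ i hi) =
            Names.glue id β (fun s m => v i hi (.inl s) m) (ρ i hi) := by
        intro β
        funext σ m
        match σ with
        | .inl s =>
          exact ((hu i).1 s m).trans (congrFun (congrFun (dif_pos hi) s) m)
        | .inr E => rfl
      rw [hglue, hnames i, hnames (i + 1)]
      exact hρ i hi
    · rw [hnames k]
      exact hj'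
  obtain ⟨N, hN, u', hu'⟩ := hsat.transfer h hψ
  obtain ⟨h₁, h₂⟩ := (key N u').1 hu'
  exact ⟨S.setting.finStruc N n, hN, fun i => (S.runNames i).assign N u' n, init_initNames N u' n,
    fun i hi => ⟨t i hi, ht i hi, _, h₁ i hi⟩, h₂⟩

end RAS

end Runs

end Artifact

namespace Artifact

/-! ## Partial correctness of backward search -/

section PartialCorrectness

open Setting

/-- Closedness is essential: `Holds` quantifies over all assignments, and this would not commute
with disjunction otherwise. -/
theorem Setting.ExtStruc.holds_or {L : Sig} {W : Setting L} {M : W.ExtStruc} {α : Assignment M}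
    {φ ψ : Fml W.sig} (hφ : φ.fv = ∅) (hψ : ψ.fv = ∅) :
    M.Holds α (φ.or ψ) ↔ M.Holds α φ ∨ M.Holds α ψ := by
  obtain ⟨v⟩ := (M.withAssignment α).assignNonempty
  have h : (φ.or ψ).fv = ∅ := by rw [Fml.fv_or, hφ, hψ, Set.union_empty]
  unfold ExtStruc.Holds
  rw [Struc.true_iff_realize h v, Struc.true_iff_realize hφ v, Struc.true_iff_realize hψ v]
  exact Struc.realize_or

theorem Setting.ExtStruc.holds_and_neg {L : Sig} {W : Setting L} {M : W.ExtStruc}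
    {α : Assignment M} {φ ψ : Fml W.sig} (hφ : φ.fv = ∅) (hψ : ψ.fv = ∅) :
    M.Holds α (φ.and ψ.neg) ↔ M.Holds α φ ∧ ¬ M.Holds α ψ := by
  obtain ⟨v⟩ := (M.withAssignment α).assignNonempty
  have h : (φ.and ψ.neg).fv = ∅ := (congrArg₂ (· ∪ ·) hφ hψ).trans (Set.union_empty _)
  unfold ExtStruc.Holds
  rw [Struc.true_iff_realize h v, Struc.true_iff_realize hφ v, Struc.true_iff_realize hψ v]
  rfl

namespace RAS

variable {S : RAS}

theorem Reach.mono {𝒦 𝒦' : Struc S.schema.sig → Prop} (h : ∀ N, 𝒦 N → 𝒦' N) {k : ℕ}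
    {υ : Fml S.setting.sig} (hs : S.Reach 𝒦 k υ) : S.Reach 𝒦' k υ :=
  let ⟨M, hM, hα⟩ := hs
  ⟨M, h _ hM, hα⟩

/-- A run that ends in the preimage is prolonged by one step at its end. -/
theorem Reach.of_preimage {𝒦 : Struc S.schema.sig → Prop} {k : ℕ} {φ ψ : Fml S.setting.sig}
    (h : ∀ M : S.setting.ExtStruc, 𝒦 M.db → ∀ α : Assignment M, M.Holds α ψ → S.Pre φ M α)
    (hs : S.Reach 𝒦 k ψ) : S.Reach 𝒦 (k + 1) φ := by
  obtain ⟨M, hM, α, h₀, h₁, h₂⟩ := hs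
  obtain ⟨α', h₃, h₄⟩ := h M hM _ h₂
  refine ⟨M, hM, fun i => if i ≤ k then α i else α', ?_, fun i hi => ?_, ?_⟩
  · simpa using h₀
  · rcases Nat.lt_succ_iff_lt_or_eq.1 hi with hi | rfl
    · simpa [hi.le, Nat.succ_le_of_lt hi] using h₁ i hi
    · simpa using h₃
  · simpa using h₄

variable {Tstar : Set (Fml S.schema.sig)} {pq : Fml S.setting.sig → Fml S.setting.sig}

/-- The initial state found in a model of the theory is moved to a model of the completion, where
each computed preimage provides a genuine further step towards the original formula. -/
theorem Loop.exists_reach (hmc : IsModelCompletion S.schema.T Tstar)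
    (hpq : S.IsPreimageProcedure Tstar pq) {φ B : Fml S.setting.sig} {r : S.Answer}
    (h : Loop pq φ B r) (hr : r = .unsafeAnswer) (hφ : S.setting.IsState φ) :
    ∃ k, S.Reach (fun N => N.Models Tstar) k φ := by
  induction h with
  | exit _ => exact nomatch hr
  | found _ h => exact ⟨0, (initTSat_iff.1 h).transfer hmc.conservative hφ.tame⟩
  | next _ _ _ ih =>
    obtain ⟨k, hk⟩ := ih hr (hpq _ hφ).1
    exact ⟨k + 1, hk.of_preimage fun M hM α => ((hpq _ hφ).2 M hM α).1⟩

/-- The loop invariant: a state with a successor in `B` lies in `B` or satisfies the current `φ`,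
and no initial state lies in `B`. At the exit `φ` implies `B`, so that `B` has become closed under
preimages. -/
theorem Loop.exists_invariant (hmc : IsModelCompletion S.schema.T Tstar)
    (hpq : S.IsPreimageProcedure Tstar pq) {φ B B' : Fml S.setting.sig} {r : S.Answer}
    (h : Loop pq φ B r) (hr : r = .safeAnswer B') (hφ : S.setting.IsState φ)
    (hB : S.setting.IsStateDisj B)
    (hstep : ∀ M : S.setting.ExtStruc, M.db.Models Tstar → ∀ α α' : Assignment M,
      S.Step M α α' → M.Holds α' B → M.Holds α B ∨ M.Holds α φ)
    (hinit : ∀ M : S.setting.ExtStruc, M.db.Models Tstar → ∀ α : Assignment M,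
      S.Init M α → ¬ M.Holds α B) :
    ∀ M : S.setting.ExtStruc, M.db.Models Tstar →
      (∀ α : Assignment M, M.Holds α B ∨ M.Holds α φ → M.Holds α B') ∧
      (∀ α α' : Assignment M, S.Step M α α' → M.Holds α' B' → M.Holds α B') ∧
      ∀ α : Assignment M, S.Init M α → ¬ M.Holds α B' := by
  have hT : ∀ M : S.setting.ExtStruc, M.db.Models Tstar → M.db.Models S.schema.T :=
    fun M hM ψ hψ => hM ψ (hmc.subset hψ)
  induction h with
  | @exit φ B h =>
    obtain rfl : B = B' := by simpa using hr
    -- The failed loop test excludes `φ ∧ ¬B` in models of the theory, in particular in those of the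
    -- completion.
    have key : ∀ M : S.setting.ExtStruc, M.db.Models Tstar → ∀ α : Assignment M,
        M.Holds α B ∨ M.Holds α φ → M.Holds α B := by
      rintro M hM α (h' | h')
      · exact h'
      · by_contra h''
        exact h ⟨M, hT M hM, α, (ExtStruc.holds_and_neg hφ.closed hB.closed).2 ⟨h', h''⟩⟩
    exact fun M hM => ⟨key M hM, fun α α' h₁ h₂ => key M hM α (hstep M hM α α' h₁ h₂), hinit M hM⟩
  | found _ _ => exact nomatch hr
  | @next φ B r _ h _ ih =>
    have hor : ∀ {M : S.setting.ExtStruc} {α : Assignment M},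
        M.Holds α (φ.or B) ↔ M.Holds α φ ∨ M.Holds α B :=
      ExtStruc.holds_or hφ.closed hB.closed
    intro M hM
    obtain ⟨h₁, h₂⟩ := ih hr (hpq φ hφ).1 (.or hφ hB) (fun M hM α α' h₁ h₂ => by
        rw [hor] at h₂ ⊢
        rcases h₂ with h₂ | h₂
        · exact Or.inr (((hpq φ hφ).2 M hM α).2 ⟨α', h₁, h₂⟩)
        · exact Or.inl (hstep M hM α α' h₁ h₂).symm)
      (fun M hM α h₁ h₂ => by
        rcases hor.1 h₂ with h₂ | h₂
        · exact h ⟨M, hT M hM, α, h₁, h₂⟩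
        · exact hinit M hM α h₁ h₂) M hM
    exact ⟨fun α h₃ => h₁ α (Or.inl (hor.2 h₃.symm)), h₂⟩

/-- Both directions argue in models of the completion. A run found there is moved to a DB instance
by the finite model property; a hypothetical unsafe run in a DB instance is moved into a model of
the completion and refuted by the invariant. -/
theorem backwardSearchPartiallyCorrect (hfmp : S.schema.FiniteModelProperty)
    (hmc : IsModelCompletion S.schema.T Tstar) : S.BackwardSearchPartiallyCorrect Tstar := by
  intro pq hpq υ hυ
  refine ⟨fun h => ?_, fun B h => ?_⟩
  · obtain ⟨k, hk⟩ := Loop.exists_reach hmc hpq h rfl hυ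
    rw [safe_iff]
    push Not
    exact ⟨k, (hk.mono fun N hN ψ hψ => hN ψ (hmc.subset hψ)).transfer hfmp hυ.tame⟩
  · rw [safe_iff]
    intro k hk
    obtain ⟨M, hM, α, h₀, h₁, h₂⟩ := (hk.mono fun N hN => hN.1).transfer hmc.conservative hυ.tame
    obtain ⟨h₃, h₄, h₅⟩ := Loop.exists_invariant hmc hpq h rfl hυ .bot
      (fun M hM α α' _ h => (h (M.withAssignment α').assignNonempty.some).elim)
      (fun M hM α _ h => h (M.withAssignment α).assignNonempty.some) M hM
    refine h₅ (α 0) h₀ ?_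
    -- Membership in `B` propagates from the unsafe last state back to the initial one.
    have key : ∀ i ≤ k, M.Holds (α (k - i)) B := by
      intro i
      induction i with
      | zero => exact fun _ => h₃ _ (Or.inr h₂)
      | succ i ih =>
        intro hi
        refine h₄ _ _ (h₁ (k - (i + 1)) (by omega)) ?_
        rw [show k - (i + 1) + 1 = k - i by omega]
        exact ih (by omega)
    simpa using key k le_rfl

theorem tSat_iff_of_isExAll (hfmp : S.schema.FiniteModelProperty)
    (hmc : IsModelCompletion S.schema.T Tstar) {χ : Fml S.setting.sig} (hχ : S.setting.IsExAll χ) :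
    (S.TSat χ ↔ S.setting.ExtSatIn S.schema.IsInstance χ) ∧
      (S.TSat χ ↔ S.setting.ExtSatIn (fun N => N.Models Tstar) χ) :=
  ⟨⟨fun h => ExtSatIn.transfer hfmp hχ.tame h, fun h => ExtSatIn.mono (fun _ hN => hN.1) h⟩,
    ⟨fun h => ExtSatIn.transfer hmc.conservative hχ.tame h,
      fun h => ExtSatIn.mono (fun _ hN ψ hψ => hN ψ (hmc.subset hψ)) h⟩⟩

end RAS

end PartialCorrectness

end Artifact

namespace Artifact

/-! ## The elimination of artifact sorts is primitive recursive -/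

section Primrec

open Encodable Setting Primrec

variable {L : Sig} {W : Setting L}

namespace Fml

def codeOr (a b : ℕ) : ℕ :=
  Nat.pair 2 (Nat.pair 3 (Nat.pair (Nat.pair 2 a) (Nat.pair 2 b)))

def codeBigOr (l : List ℕ) : ℕ := l.foldr codeOr (Nat.pair 0 0)

def codeBigAnd (l : List ℕ) : ℕ :=
  l.foldr (fun a b => Nat.pair 3 (Nat.pair a b)) (Nat.pair 2 (Nat.pair 0 0))

def codeExs (xs : List ℕ) (a : ℕ) : ℕ := xs.foldr (fun x b => Nat.pair 4 (Nat.pair x b)) a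

def codeVar (x : L.Var) : ℕ := Nat.pair (encode x.1) x.2

theorem code_bigOr (l : List (Fml L)) : (bigOr l).code = codeBigOr (l.map code) := by
  induction l with
  | nil => rfl
  | cons φ l ih => exact congrArg (codeOr φ.code) ih

theorem code_bigAnd (l : List (Fml L)) : (bigAnd l).code = codeBigAnd (l.map code) := by
  induction l with
  | nil => rfl
  | cons φ l ih => exact congrArg (fun b => Nat.pair 3 (Nat.pair φ.code b)) ih

theorem code_exs (xs : List L.Var) (φ : Fml L) :
    (exs xs φ).code = codeExs (xs.map codeVar) φ.code := by
  induction xs with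
  | nil => rfl
  | cons x xs ih => exact congrArg (fun b => Nat.pair 4 (Nat.pair (codeVar x) b)) ih

@[fun_prop]
theorem primrec_codeBigOr : Primrec codeBigOr := by
  unfold codeBigOr codeOr
  fun_prop

@[fun_prop]
theorem primrec_codeBigAnd : Primrec codeBigAnd := by
  unfold codeBigAnd
  fun_prop

@[fun_prop]
theorem primrec_codeExs : Primrec fun p : List ℕ × ℕ => codeExs p.1 p.2 := by
  unfold codeExs
  fun_prop

end Fml

/-- The strict decrease that makes recursion on Gödel numbers terminate. -/
theorem unpair_snd_lt {c : ℕ} (h : c.unpair.1 ≠ 0) : c.unpair.2 < c := by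
  have := Nat.add_le_pair c.unpair.1 c.unpair.2
  rw [Nat.pair_unpair] at this
  omega

namespace Setting

variable (W) in
/-- Sizes given by a list. -/
def sizes (v : List ℕ) (E : W.ASrt) : ℕ := v.getD (encode E) 0

/-- The list of pairs represents the environment. -/
def Env.Rep {n : W.ASrt → ℕ} (ρ : W.Env n) (l : List (ℕ × ℕ)) : Prop :=
  ∀ E m, lookupD l (Nat.pair (encode E) m) = (ρ E m).val

theorem zeroEnv_rep (n : W.ASrt → ℕ) : (zeroEnv n : W.Env n).Rep [] := fun _ _ => rfl

theorem Env.Rep.upd {n : W.ASrt → ℕ} {ρ : W.Env n} {l : List (ℕ × ℕ)} (h : ρ.Rep l) (E : W.ASrt)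
    (m : ℕ) (k : Fin (n E + 1)) : (ρ.upd E m k).Rep ((Nat.pair (encode E) m, k.val) :: l) := by
  intro E' m'
  unfold lookupD
  by_cases h₁ : Nat.pair (encode E') m' = Nat.pair (encode E) m
  · rw [List.lookup_cons, beq_iff_eq.2 h₁]
    obtain ⟨h₂, rfl⟩ := Nat.pair_eq_pair.1 h₁
    obtain rfl := encode_injective h₂
    simp [Env.upd]
  · have h₂ : (Nat.pair (encode E') m' == Nat.pair (encode E) m) = false := beq_false_of_ne h₁
    rw [List.lookup_cons, h₂]
    refine (h E' m').trans ?_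
    by_cases hE : E' = E
    · subst hE
      have : m' ≠ m := fun e => h₁ (by rw [e])
      simp [Env.upd, this]
    · simp [Env.upd, hE]

namespace Names

/-- The codes of the names are given by primitive recursive functions. -/
def IsPrimrec (ν : W.Names) : Prop :=
  (∃ f : ℕ → ℕ, Primrec f ∧ ∀ (s : L.Srt) (y : W.X s),
    f (Nat.pair (encode s) (encode y)) = (ν.x y).code) ∧
  ∃ f : ℕ → ℕ, Primrec f ∧ ∀ (E : W.ASrt) (s : L.Srt) (b : W.A E s) (k : ℕ),
    f (Nat.pair (Nat.pair (Nat.pair (encode E) (encode s)) (encode b)) k) = (ν.a b k).code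

theorem isPrimrec_stdNames (i : ℕ) : (W.stdNames i).IsPrimrec := by
  refine ⟨⟨fun c => Nat.pair 0 (Nat.pair c.unpair.1 (3 * Nat.pair i c.unpair.2 + 1)), by fun_prop,
    fun s y => ?_⟩, ⟨fun c => Nat.pair 0 (Nat.pair c.unpair.1.unpair.1.unpair.2
      (3 * Nat.pair i (Nat.pair (Nat.pair c.unpair.1.unpair.1.unpair.1 c.unpair.1.unpair.2)
        c.unpair.2) + 2)), by fun_prop, fun E s b k => ?_⟩⟩
  · simp [stdNames, Term.code]
  · simp [stdNames, Term.code]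

/-- The choice of constants is an arbitrary function on a finite set of symbols, and is therefore
given by a table. -/
theorem isPrimrec_constNames (c : ∀ {s}, W.X s → L.Cst s) (d : ∀ {E s}, W.A E s → L.Cst s) :
    (constNames c d).IsPrimrec := by
  constructor
  · obtain ⟨f, hf, h⟩ := exists_table
      (fun y : Σ s, W.X s => Nat.pair (encode y.1) (encode y.2))
      (by
        rintro ⟨s, y⟩ ⟨s', y'⟩ h
        obtain ⟨h₁, h₂⟩ := Nat.pair_eq_pair.1 h
        obtain rfl := encode_injective h₁
        exact congrArg (Sigma.mk s) (encode_injective h₂))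
      fun y => (Term.cst (c y.2)).code
    exact ⟨f, hf, fun s y => h ⟨s, y⟩⟩
  · obtain ⟨f, hf, h⟩ := exists_table
      (fun b : Σ E s, W.A E s => Nat.pair (Nat.pair (encode b.1) (encode b.2.1)) (encode b.2.2))
      (by
        rintro ⟨E, s, b⟩ ⟨E', s', b'⟩ h
        obtain ⟨h₁, h₂⟩ := Nat.pair_eq_pair.1 h
        obtain ⟨h₃, h₄⟩ := Nat.pair_eq_pair.1 h₁
        obtain rfl := encode_injective h₃
        obtain rfl := encode_injective h₄
        exact congrArg (fun b => (⟨E, s, b⟩ : Σ E s, W.A E s)) (encode_injective h₂))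
      fun b => (Term.cst (d b.2.2)).code
    exact ⟨fun p => f p.unpair.1, by fun_prop, fun E s b k =>
      (congrArg f (congrArg Prod.fst (Nat.unpair_pair _ _))).trans (h ⟨E, s, b⟩)⟩

/-- A sum is encoded by parity: even numbers belong to the first copy, odd ones to the second. -/
theorem IsPrimrec.dbl {ν ν' : W.Names} (h : ν.IsPrimrec) (h' : ν'.IsPrimrec) :
    (ν.dbl ν').IsPrimrec := by
  obtain ⟨⟨f, hf, hf'⟩, g, hg, hg'⟩ := h
  obtain ⟨⟨f₁, hf₁, hf₁'⟩, g₁, hg₁, hg₁'⟩ := h'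
  let F : ℕ → ℕ := fun c => if c.unpair.2 % 2 = 0 then f (Nat.pair c.unpair.1 (c.unpair.2 / 2))
    else f₁ (Nat.pair c.unpair.1 (c.unpair.2 / 2))
  let G : ℕ → ℕ := fun c => if c.unpair.1.unpair.2 % 2 = 0
    then g (Nat.pair (Nat.pair c.unpair.1.unpair.1 (c.unpair.1.unpair.2 / 2)) c.unpair.2)
    else g₁ (Nat.pair (Nat.pair c.unpair.1.unpair.1 (c.unpair.1.unpair.2 / 2)) c.unpair.2)
  have h₁ : ∀ m, (2 * m + 1) % 2 = 1 := fun m => by omega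
  have h₂ : ∀ m, (2 * m + 1) / 2 = m := fun m => by omega
  have hF₀ : ∀ a m, F (Nat.pair a (2 * m)) = f (Nat.pair a m) := fun a m => by simp [F]
  have hF₁ : ∀ a m, F (Nat.pair a (2 * m + 1)) = f₁ (Nat.pair a m) :=
    fun a m => by simp [F, h₁, h₂]
  have hG₀ : ∀ a m k, G (Nat.pair (Nat.pair a (2 * m)) k) = g (Nat.pair (Nat.pair a m) k) :=
    fun a m k => by simp [G]
  have hG₁ : ∀ a m k, G (Nat.pair (Nat.pair a (2 * m + 1)) k) = g₁ (Nat.pair (Nat.pair a m) k) :=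
    fun a m k => by simp [G, h₁, h₂]
  refine ⟨⟨F, by fun_prop, fun s y => ?_⟩, ⟨G, by fun_prop, fun E s b k => ?_⟩⟩
  · rcases y with y | y
    · exact (hF₀ _ _).trans (hf' s y)
    · exact (hF₁ _ _).trans (hf₁' s y)
  · rcases b with b | b
    · exact (hG₀ _ _ _).trans (hg' E s b k)
    · exact (hG₁ _ _ _).trans (hg₁' E s b k)

/-- The code of the translation of a term. -/
def trCode {n : W.ASrt → ℕ} : (σ : W.sig.Srt) → W.Tr n σ → ℕ
  | .inl _, t => Term.code t
  | .inr _, k => Fin.val k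

theorem trCode_injective {n : W.ASrt → ℕ} (E : W.ASrt) :
    Function.Injective (trCode (n := n) (.inr E : W.sig.Srt)) := Fin.val_injective

/-- Course-of-values recursion on the Gödel number. The parity of a sort's code tells basic sorts
from artifact sorts, and that of a constant's code tells constants of the DB signature from artifact
variables. -/
theorem exists_primrec_trTerm {ν : W.Names} (hν : ν.IsPrimrec) {z : ℕ → ℕ} (hz : Primrec z) :
    ∃ f : List (ℕ × ℕ) × ℕ → ℕ, Primrec f ∧ ∀ {n : W.ASrt → ℕ} {ρ : W.Env n} {l : List (ℕ × ℕ)},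
      ρ.Rep l → ∀ {σ : W.sig.Srt} (t : Term W.sig σ),
        f (l, t.code) = trCode σ (ν.trTerm z ρ t) := by
  obtain ⟨⟨xc, hxc, hx⟩, ac, hac, ha⟩ := hν
  let calls : List (ℕ × ℕ) × ℕ → List (List (ℕ × ℕ) × ℕ) := fun p =>
    if p.2.unpair.1 = 2 then [(p.1, p.2.unpair.2.unpair.2.unpair.2)] else []
  let combine : List (ℕ × ℕ) × ℕ → List ℕ → ℕ := fun p vs =>
    if p.2.unpair.1 = 0 then
      if p.2.unpair.2.unpair.1 % 2 = 0 then
        Nat.pair 0 (Nat.pair (p.2.unpair.2.unpair.1 / 2) (z p.2.unpair.2.unpair.2))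
      else lookupD p.1 (Nat.pair (p.2.unpair.2.unpair.1 / 2) p.2.unpair.2.unpair.2)
    else if p.2.unpair.1 = 1 then
      if p.2.unpair.2.unpair.2 % 2 = 0 then
        Nat.pair 1 (Nat.pair (p.2.unpair.2.unpair.1 / 2) (p.2.unpair.2.unpair.2 / 2))
      else xc (Nat.pair (p.2.unpair.2.unpair.1 / 2) (p.2.unpair.2.unpair.2 / 2))
    else if p.2.unpair.2.unpair.1.unpair.1 % 2 = 0 then
      Nat.pair 2 (Nat.pair (Nat.pair (p.2.unpair.2.unpair.1.unpair.1 / 2)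
        (p.2.unpair.2.unpair.1.unpair.2 / 2)) (Nat.pair p.2.unpair.2.unpair.2.unpair.1
          (vs.getD 0 0)))
    else ac (Nat.pair (Nat.pair (Nat.pair (p.2.unpair.2.unpair.1.unpair.1 / 2)
        (p.2.unpair.2.unpair.1.unpair.2 / 2)) p.2.unpair.2.unpair.2.unpair.1) (vs.getD 0 0))
  obtain ⟨f, hf, hf'⟩ := exists_rec (m := fun p : List (ℕ × ℕ) × ℕ => p.2) (calls := calls)
    (combine := combine) (by fun_prop) (by fun_prop) (by fun_prop) (by
      intro p p' hp'
      dsimp only [calls] at hp'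
      split_ifs at hp' with h
      · obtain rfl := List.mem_singleton.1 hp'
        exact lt_of_le_of_lt ((Nat.unpair_right_le _).trans (Nat.unpair_right_le _))
          (unpair_snd_lt (by omega))
      · simp at hp')
  refine ⟨f, hf, fun {n ρ l} hl {σ} t => ?_⟩
  induction t with
  | var σ m =>
    match σ with
    | .inl s =>
      have hc : (Term.var (L := W.sig) (.inl s) m).code =
        Nat.pair 0 (Nat.pair (2 * encode s) m) := rfl
      rw [hf', hc]
      simp [combine, trCode, trTerm, trVar, Term.code]
    | .inr E =>
      have hc : (Term.var (L := W.sig) (.inr E) m).code =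
        Nat.pair 0 (Nat.pair (2 * encode E + 1) m) := rfl
      have h₁ : (2 * encode E + 1) % 2 = 1 := by omega
      have h₂ : (2 * encode E + 1) / 2 = encode E := by omega
      rw [hf', hc]
      simp only [combine, Nat.unpair_pair, if_true, h₁, h₂, one_ne_zero, if_false]
      exact hl E m
  | @cst σ c =>
    match σ, c with
    | .inl s, .inl c =>
      have hc : (Term.cst (L := W.sig) (s := .inl s) (.inl c)).code =
        Nat.pair 1 (Nat.pair (2 * encode s) (2 * encode c)) := rfl
      rw [hf', hc]
      simp [combine, trCode, trTerm, trCst, Term.code]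
    | .inl s, .inr y =>
      have hc : (Term.cst (L := W.sig) (s := .inl s) (.inr y)).code =
        Nat.pair 1 (Nat.pair (2 * encode s) (2 * encode y + 1)) := rfl
      have h₁ : (2 * encode y + 1) % 2 = 1 := by omega
      have h₂ : (2 * encode y + 1) / 2 = encode y := by omega
      rw [hf', hc]
      simp [combine, h₁, h₂, hx]
      rfl
    | .inr E, c => exact Empty.elim c
  | @app σ σ' g t ih =>
    match σ, σ', g, t, ih with
    | .inl s, .inl s', g, t, ih =>
      have hc : (Term.app (L := W.sig) (s := .inl s) (s' := .inl s') g t).code =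
        Nat.pair 2 (Nat.pair (Nat.pair (2 * encode s) (2 * encode s'))
          (Nat.pair (encode (α := L.Fn s s') g) t.code)) := rfl
      rw [hf', hc]
      simp [combine, calls, ih]
      rfl
    | .inr E, .inl s', b, t, ih =>
      have hc : (Term.app (L := W.sig) (s := .inr E) (s' := .inl s') b t).code =
        Nat.pair 2 (Nat.pair (Nat.pair (2 * encode E + 1) (2 * encode s'))
          (Nat.pair (encode (α := W.A E s') b) t.code)) := rfl
      have h₁ : (2 * encode E + 1) % 2 = 1 := by omega
      have h₂ : (2 * encode E + 1) / 2 = encode E := by omega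
      rw [hf', hc]
      simp [combine, calls, ih, h₁, h₂]
      exact ha E s' b _
    | .inl s, .inr E', f, _, _ => exact Empty.elim f
    | .inr E, .inr E', f, _, _ => exact Empty.elim f

/-- The elimination of artifact sorts is primitive recursive. -/
theorem exists_primrec_tr {ν : W.Names} (hν : ν.IsPrimrec) {z : ℕ → ℕ} (hz : Primrec z) :
    ∃ f : (List ℕ × List (ℕ × ℕ)) × ℕ → ℕ, Primrec f ∧
      ∀ {v : List ℕ} {ρ : W.Env (W.sizes v)} {l : List (ℕ × ℕ)}, ρ.Rep l →
        ∀ φ : Fml W.sig, f ((v, l), φ.code) = (ν.tr z ρ φ).code := by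
  obtain ⟨g, hg, hg'⟩ := exists_primrec_trTerm hν hz
  -- The environment travels along as an association list. A quantifier over an artifact sort calls
  -- the recursion once for every entry, with the new value put in front.
  let calls : (List ℕ × List (ℕ × ℕ)) × ℕ → List ((List ℕ × List (ℕ × ℕ)) × ℕ) := fun p =>
    if p.2.unpair.1 = 2 then [(p.1, p.2.unpair.2)]
    else if p.2.unpair.1 = 3 then [(p.1, p.2.unpair.2.unpair.1), (p.1, p.2.unpair.2.unpair.2)]
    else if p.2.unpair.1 = 4 then
      if p.2.unpair.2.unpair.1.unpair.1 % 2 = 0 then [(p.1, p.2.unpair.2.unpair.2)]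
      else (List.range (p.1.1.getD (p.2.unpair.2.unpair.1.unpair.1 / 2) 0 + 1)).map fun k =>
        ((p.1.1, (Nat.pair (p.2.unpair.2.unpair.1.unpair.1 / 2) p.2.unpair.2.unpair.1.unpair.2, k)
          :: p.1.2), p.2.unpair.2.unpair.2)
    else []
  let combine : (List ℕ × List (ℕ × ℕ)) × ℕ → List ℕ → ℕ := fun p vs =>
    if p.2.unpair.1 = 0 then Nat.pair 0 0
    else if p.2.unpair.1 = 1 then
      if p.2.unpair.2.unpair.1 % 2 = 0 then
        Nat.pair 1 (Nat.pair (p.2.unpair.2.unpair.1 / 2)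
          (Nat.pair (g (p.1.2, p.2.unpair.2.unpair.2.unpair.1))
            (g (p.1.2, p.2.unpair.2.unpair.2.unpair.2))))
      -- For an artifact sort the translated terms are entry numbers, compared here.
      else if g (p.1.2, p.2.unpair.2.unpair.2.unpair.1) =
        g (p.1.2, p.2.unpair.2.unpair.2.unpair.2) then Nat.pair 2 (Nat.pair 0 0)
      else Nat.pair 0 0
    else if p.2.unpair.1 = 2 then Nat.pair 2 (vs.getD 0 0)
    else if p.2.unpair.1 = 3 then Nat.pair 3 (Nat.pair (vs.getD 0 0) (vs.getD 1 0))
    else if p.2.unpair.2.unpair.1.unpair.1 % 2 = 0 then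
      Nat.pair 4 (Nat.pair (Nat.pair (p.2.unpair.2.unpair.1.unpair.1 / 2)
        (z p.2.unpair.2.unpair.1.unpair.2)) (vs.getD 0 0))
    else Fml.codeBigOr vs
  obtain ⟨f, hf, hf'⟩ := exists_rec (m := fun p : (List ℕ × List (ℕ × ℕ)) × ℕ => p.2)
    (calls := calls) (combine := combine) (by fun_prop) (by fun_prop) (by fun_prop) (by
      intro p p' hp'
      suffices H : p.2.unpair.1 ≠ 0 ∧ p'.2 ≤ p.2.unpair.2 from
        lt_of_le_of_lt H.2 (unpair_snd_lt H.1)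
      dsimp only [calls] at hp'
      split_ifs at hp' with h₁ h₂ h₃ h₄
      · obtain rfl := List.mem_singleton.1 hp'
        exact ⟨by omega, le_rfl⟩
      · refine ⟨by omega, ?_⟩
        rcases List.mem_cons.1 hp' with rfl | hp'
        · exact Nat.unpair_left_le _
        · obtain rfl := List.mem_singleton.1 hp'
          exact Nat.unpair_right_le _
      · obtain rfl := List.mem_singleton.1 hp'
        exact ⟨by omega, Nat.unpair_right_le _⟩
      · obtain ⟨k, -, rfl⟩ := List.mem_map.1 hp'
        exact ⟨by omega, Nat.unpair_right_le _⟩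
      · simp at hp')
  refine ⟨f, hf, fun {v ρ l} hl φ => ?_⟩
  induction φ generalizing ρ l with
  | fls =>
    have hc : (Fml.fls : Fml W.sig).code = Nat.pair 0 0 := rfl
    rw [hf', hc]
    simp [combine, tr, Fml.code]
  | @eq σ t u =>
    match σ, t, u with
    | .inl s, t, u =>
      have hc : (Fml.eq (L := W.sig) (s := .inl s) t u).code =
        Nat.pair 1 (Nat.pair (2 * encode s) (Nat.pair t.code u.code)) := rfl
      rw [hf', hc]
      simp only [combine, Nat.unpair_pair, Nat.mul_mod_right, Nat.mul_div_right _ two_pos,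
        one_ne_zero, if_false, if_true]
      exact congrArg₂ (fun a b => Nat.pair 1 (Nat.pair (encode s) (Nat.pair a b)))
        (hg' hl t) (hg' hl u)
    | .inr E, t, u =>
      have hc : (Fml.eq (L := W.sig) (s := .inr E) t u).code =
        Nat.pair 1 (Nat.pair (2 * encode E + 1) (Nat.pair t.code u.code)) := rfl
      have h₁ : (2 * encode E + 1) % 2 = 1 := by omega
      rw [hf', hc]
      simp only [combine, Nat.unpair_pair, h₁, one_ne_zero, if_false, if_true]
      by_cases h : ν.trTerm z ρ t = ν.trTerm z ρ u
      · have htr : ν.tr z ρ (Fml.eq (L := W.sig) (s := .inr E) t u) = Fml.neg Fml.fls :=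
          if_pos (h := Classical.propDecidable _) h
        exact (if_pos ((hg' hl t).trans ((congrArg _ h).trans (hg' hl u).symm))).trans
          (congrArg Fml.code htr.symm)
      · have htr : ν.tr z ρ (Fml.eq (L := W.sig) (s := .inr E) t u) = Fml.fls :=
          if_neg (h := Classical.propDecidable _) h
        exact (if_neg fun h' => h (trCode_injective E
          ((hg' hl t).symm.trans (h'.trans (hg' hl u))))).trans (congrArg Fml.code htr.symm)
  | neg φ ih =>
    have hc : φ.neg.code = Nat.pair 2 φ.code := rfl
    rw [hf', hc]
    simp [combine, calls, ih hl]
    rfl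
  | and φ ψ ih₁ ih₂ =>
    have hc : (φ.and ψ).code = Nat.pair 3 (Nat.pair φ.code ψ.code) := rfl
    rw [hf', hc]
    simp [combine, calls, ih₁ hl, ih₂ hl]
    rfl
  | ex x φ ih =>
    match x with
    | (.inl s, m) =>
      have hc : (Fml.ex (L := W.sig) (.inl s, m) φ).code =
        Nat.pair 4 (Nat.pair (Nat.pair (2 * encode s) m) φ.code) := rfl
      rw [hf', hc]
      simp [combine, calls, ih hl]
      rfl
    | (.inr E, m) =>
      have hc : (Fml.ex (L := W.sig) (.inr E, m) φ).code =
        Nat.pair 4 (Nat.pair (Nat.pair (2 * encode E + 1) m) φ.code) := rfl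
      have h₁ : (2 * encode E + 1) % 2 = 1 := by omega
      have h₂ : (2 * encode E + 1) / 2 = encode E := by omega
      rw [hf', hc, tr, Fml.code_bigOr]
      simp only [combine, calls, Nat.unpair_pair, h₁, h₂, List.map_map, one_ne_zero,
        OfNat.ofNat_ne_zero, OfNat.ofNat_ne_one, Nat.reduceEqDiff, if_false, if_true]
      refine congrArg Fml.codeBigOr ?_
      change (List.range (W.sizes v E + 1)).map _ = _
      rw [← List.map_coe_finRange_eq_range, List.map_map]
      exact List.map_congr_left fun k _ => ih (hl.upd E m k)

end Names

end Setting

end Primrec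

end Artifact

namespace Artifact

/-! ## Decidability of satisfiability in the artifact extension -/

section Decidability

open Encodable Setting Primrec

variable {L : Sig} {W : Setting L}

/-- The lists of length `r` of numbers at most `N`. -/
def boundedLists : ℕ → ℕ → List (List ℕ)
  | 0, _ => [[]]
  | r + 1, N => (List.range (N + 1)).flatMap fun k => (boundedLists r N).map fun v => k :: v

theorem mem_boundedLists {r N : ℕ} {v : List ℕ} :
    v ∈ boundedLists r N ↔ v.length = r ∧ ∀ k ∈ v, k ≤ N := by
  induction r generalizing v with
  | zero =>
    simp only [boundedLists, List.mem_singleton]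
    constructor
    · rintro rfl; simp
    · exact fun h => List.length_eq_zero_iff.1 h.1
  | succ r ih =>
    simp only [boundedLists, List.mem_flatMap, List.mem_map, List.mem_range, ih]
    constructor
    · rintro ⟨k, hk, v, ⟨rfl, hv⟩, rfl⟩
      exact ⟨rfl, by simpa using ⟨Nat.lt_succ_iff.1 hk, hv⟩⟩
    · rintro ⟨h₁, h₂⟩
      obtain ⟨k, v, rfl⟩ := List.exists_of_length_succ v h₁
      exact ⟨k, Nat.lt_succ_iff.2 (h₂ k (by simp)), v,
        ⟨by simpa using h₁, fun l hl => h₂ l (by simp [hl])⟩, rfl⟩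

@[fun_prop]
theorem primrec_boundedLists (r : ℕ) : Primrec (boundedLists r) := by
  induction r with
  | zero => exact Primrec.const _
  | succ r ih =>
    change Primrec fun N => (List.range (N + 1)).flatMap fun k =>
      (boundedLists r N).map fun v => k :: v
    fun_prop

namespace Setting

variable (W) in
/-- The bounded sizes of the artifact sorts can be listed. -/
theorem exists_sizes : ∃ V : ℕ → List (List ℕ), Primrec V ∧
    (∀ N, ∀ v ∈ V N, ∀ E, W.sizes v E ≤ N) ∧
    ∀ N (n : W.ASrt → ℕ), (∀ E, n E ≤ N) → ∃ v ∈ V N, W.sizes v = n := by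
  -- Sizes are stored at the codes of the sorts, so lists longer than every code suffice.
  obtain ⟨r, hr⟩ : ∃ r, ∀ E : W.ASrt, encode E < r := by
    obtain ⟨r, hr⟩ := (Set.finite_range (encode : W.ASrt → ℕ)).bddAbove
    exact ⟨r + 1, fun E => Nat.lt_succ_of_le (hr ⟨E, rfl⟩)⟩
  refine ⟨boundedLists r, by fun_prop, fun N v hv E => ?_, fun N n hn => ?_⟩
  · obtain ⟨h₁, h₂⟩ := mem_boundedLists.1 hv
    have h : encode E < v.length := h₁ ▸ hr E
    rw [sizes, List.getD_eq_getElem _ _ h]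
    exact h₂ _ (List.getElem_mem h)
  · let f : ℕ → ℕ := fun i => ((decode i : Option W.ASrt).map n).getD 0
    refine ⟨(List.range r).map f, mem_boundedLists.2 ⟨by simp, fun k hk => ?_⟩, ?_⟩
    · obtain ⟨i, -, rfl⟩ := List.mem_map.1 hk
      rcases h : (decode i : Option W.ASrt) with _ | E
      · simp [f, h]
      · simpa [f, h] using hn E
    · funext E
      simp [sizes, hr E, f]

/-- Problems that reduce to satisfiability of quantifier-free formulae by the elimination of
artifact sorts. -/
theorem decidableOn_of_forall_iff {𝒦 : Struc L → Prop} (hdec : DecidableOn Fml.IsQF (SatIn 𝒦))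
    {ν : W.Names} (hν : ν.IsPrimrec) {D Q : Fml W.sig → Prop} (hD : ∀ φ, D φ → φ.ArtQuant)
    (h : ∀ φ, D φ → (Q φ ↔ ∃ n : W.ASrt → ℕ, (∀ E, n E ≤ φ.code + 1) ∧
      SatIn 𝒦 (ν.tr (copyVar 0) (zeroEnv n) φ))) : DecidableOn D Q := by
  obtain ⟨V, hV, hV₁, hV₂⟩ := W.exists_sizes
  obtain ⟨g, hg, hg'⟩ := hdec
  have hz : Primrec (copyVar 0) := by
    unfold copyVar
    fun_prop
  obtain ⟨f, hf, hf'⟩ := Names.exists_primrec_tr hν hz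
  -- All admissible sizes are combined into one disjunction, so the given decision procedure is
  -- consulted only once. The bound `c + 1` is that of `ExtStruc.exists_small`.
  let F : ℕ → ℕ := fun c => Fml.codeBigOr ((V (c + 1)).map fun v => f ((v, []), c))
  have hF : Primrec F := by fun_prop
  refine ⟨fun c => g (F c), hg.comp hF.to_comp, fun φ hφ => ?_⟩
  let l : List (Fml L) := (V (φ.code + 1)).map fun v =>
    ν.tr (copyVar 0) (zeroEnv (W.sizes v)) φ
  have hl : F φ.code = (Fml.bigOr l).code := by
    rw [Fml.code_bigOr, List.map_map]
    exact congrArg Fml.codeBigOr (List.map_congr_left fun v _ => hf' (zeroEnv_rep _) φ)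
  have hqf : (Fml.bigOr l).IsQF := by
    rw [Fml.isQF_bigOr]
    intro ψ hψ
    obtain ⟨v, -, rfl⟩ := List.mem_map.1 hψ
    exact Names.isQF_tr (hD φ hφ) _
  change g (F φ.code) = true ↔ _
  rw [hl, hg' _ hqf, h φ hφ]
  constructor
  · rintro ⟨N, hN, u, hu⟩
    obtain ⟨ψ, hψ, hu⟩ := N.realize_bigOr.1 hu
    obtain ⟨v, hv, rfl⟩ := List.mem_map.1 hψ
    exact ⟨W.sizes v, hV₁ _ v hv, N, hN, u, hu⟩
  · rintro ⟨n, hn, N, hN, u, hu⟩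
    obtain ⟨v, hv, rfl⟩ := hV₂ _ n hn
    exact ⟨N, hN, u, N.realize_bigOr.2 ⟨_, List.mem_map.2 ⟨v, hv, rfl⟩, hu⟩⟩

/-- Satisfiability in the artifact extension is decidable for tame sentences if satisfiability of
quantifier-free formulae is decidable. -/
theorem decidableOn_extSatIn {𝒦 : Struc L → Prop} (hdec : DecidableOn Fml.IsQF (SatIn 𝒦))
    {D : Fml W.sig → Prop} (hD : ∀ φ, D φ → Tame φ) : DecidableOn D (W.ExtSatIn 𝒦) :=
  decidableOn_of_forall_iff hdec (Names.isPrimrec_stdNames 0) (fun φ hφ => (hD φ hφ).artQuant)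
    fun φ hφ => ⟨exists_satIn_of_extSatIn (hD φ hφ),
      fun ⟨_, _, h⟩ => extSatIn_of_satIn (hD φ hφ).closed _ h⟩

end Setting

namespace RAS

variable {S : RAS}

/-- Naming the values by the initial constants builds the initial formula into the translation,
which leaves only the state formula to be tested. -/
theorem decidableOn_initTSat (hdec : S.schema.DecidableConstraintSat) :
    DecidableOn S.setting.IsState S.InitTSat := by
  refine decidableOn_of_forall_iff (ν := S.initNames) hdec (Names.isPrimrec_constNames _ _)
    (fun φ hφ => hφ.tame.artQuant) fun φ hφ => ?_
  constructor
  · rintro ⟨M, hM, α, h₁, h₂⟩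
    obtain ⟨n, j, h₃, h₄⟩ := M.exists_small hφ.tame h₂
    obtain ⟨u⟩ := M.db.assignNonempty
    refine ⟨n, h₃, M.db, hM, u, ((constNames_fresh _ _ 0).holds_iff hφ.closed u _).2 ?_⟩
    exact (initNames_assign h₁ j u).symm ▸ h₄
  · rintro ⟨n, -, N, hN, u, hu⟩
    exact ⟨S.setting.finStruc N n, hN, _, init_initNames N u n,
      ((constNames_fresh _ _ 0).holds_iff hφ.closed u _).1 hu⟩

end RAS

end Decidability

end Artifact

namespace Artifact

/-! ## Extension of transitions to further entries -/

section Extension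

variable {L : Sig} {W : Setting L} {T : Set (Fml L)}

namespace Setting

/-- Exhaustiveness of the cases gives a value, and their disjointness makes it unambiguous. -/
theorem CaseDef.existsUnique_isValue {s : L.Srt} (F : W.CaseDef T s) {M : W.ExtStruc}
    (hM : M.db.Models T) (α : Assignment M) (v : (M.withAssignment α).Assign) :
    ∃! b, F.IsValue α v b := by
  obtain ⟨p, hp, hv⟩ := F.exhaustive M hM α v
  refine ⟨p.2.eval (M.withAssignment α) v, fun q hq hv' => ?_, fun b hb => hb p hp hv⟩
  by_cases h : p = q
  · rw [h]
  -- Pairwise disjointness is stated along the list order; symmetry extends it to any two distinct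
  -- cases.
  · have hsymm : Std.Symm fun p q : Fml W.sig × Term W.sig (Sum.inl s) =>
        ∀ M : W.ExtStruc, M.db.Models T → ∀ (α : Assignment M) (v : (M.withAssignment α).Assign),
          ¬ ((M.withAssignment α).Realize v p.1 ∧ (M.withAssignment α).Realize v q.1) :=
      ⟨fun _ _ H M hM α v H' => H M hM α v H'.symm⟩
    exact (F.disjoint.forall hp hq h M hM α v ⟨hv, hv'⟩).elim

theorem CaseDef.IsValue.lift {s : L.Srt} {F : W.CaseDef T s} {M : W.ExtStruc} {n : W.ASrt → ℕ}
    {j : M.Emb n} {α : Assignment M} {w : ((W.finStruc M.db n).withAssignment (j.pull α)).Assign}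
    {b : M.db.carrier s} (h : F.IsValue (j.pull α) w b) : F.IsValue α (j.lift α w) b :=
  fun p hp hv => (h p hp ((j.realize_iff_of_isQF α (F.qf p hp) w).2 hv)).trans
    (j.val_eval α w p.2)

/-- A transition over finitely many of the entries extends to all entries. -/
theorem Transition.HoldsAt.extend {t : W.Transition T} {M : W.ExtStruc} (hM : M.db.Models T)
    {n : W.ASrt → ℕ} {j : M.Emb n} {α : Assignment M} {β : Assignment (W.finStruc M.db n)}
    {w : ((W.finStruc M.db n).withAssignment (j.pull α)).Assign}
    (h : t.HoldsAt _ (j.pull α) β w) :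
    ∃ α' : Assignment M, t.HoldsAt M α α' (j.lift α w) ∧ j.pull α' = β := by
  have key : ∀ (E : W.ASrt) (s : L.Srt) (b : W.A E s) (d : M.entries E), ∃! c,
      (t.G b).IsValue α
        ((M.withAssignment α).upd (j.lift α w) ((Sum.inr E, t.y b) : W.sig.Var) d) c :=
    fun E s b d => (t.G b).existsUnique_isValue hM α _
  -- Artifact variables keep the values given by `β`; components take the values prescribed by their
  -- case definitions at every entry.
  refine ⟨⟨fun y => β.x y, fun b d => (key _ _ b d).choose⟩,
    ⟨(j.realize_iff_of_isQF α t.guard_qf w).1 h.1, fun y => (h.2.1 y).lift,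
      fun b d => (key _ _ b d).choose_spec.1⟩,
    Assignment.ext' (fun _ _ => rfl) fun E s b k => ?_⟩
  -- At the chosen entries `β` supplies a value of the same case definition, so uniqueness forces
  -- agreement.
  refine ((key E s b (j.f E k)).choose_spec.2 (β.a b k) ?_).symm
  have hk := (h.2.2 b k).lift
  exact (congrArg (fun v => (t.G b).IsValue α v (β.a b k))
    (j.lift_upd α w ((Sum.inr E, t.y b) : W.sig.Var) k)).mp hk

end Setting

/-! ### Preimages over small sets of entries. -/

namespace RAS

open Setting

variable {S : RAS}

theorem Step.extend {M : S.setting.ExtStruc} (hM : M.db.Models S.schema.T)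
    {n : S.setting.ASrt → ℕ} {j : M.Emb n} {α : Assignment M}
    {β : Assignment (S.setting.finStruc M.db n)} (h : S.Step _ (j.pull α) β) :
    ∃ α' : Assignment M, S.Step M α α' ∧ j.pull α' = β := by
  obtain ⟨t, ht, w, hw⟩ := h
  obtain ⟨α', h₁, h₂⟩ := Transition.HoldsAt.extend hM (show t.HoldsAt _ _ _ w from hw)
  exact ⟨α', ⟨t, ht, _, h₁⟩, h₂⟩

variable (S) in
/-- The formula `τ`, the second copy of the setting being the primed one. -/
noncomputable def stepFml : Fml S.setting.dbl.sig :=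
  Fml.bigOr (S.τ.map fun t => Fml.exs t.matrix.fvList t.matrix)

theorem realize_stepFml {M : S.setting.ExtStruc} {α α' : Assignment M}
    {v : (M.dbl.withAssignment (α.dbl α')).Assign} :
    (M.dbl.withAssignment (α.dbl α')).Realize v S.stepFml ↔ S.Step M α α' := by
  have h : ∀ t : S.setting.Transition S.schema.T, (M.dbl.withAssignment (α.dbl α')).Realize v
      (Fml.exs t.matrix.fvList t.matrix) ↔ t.Holds M α α' := fun t =>
    (Struc.realize_exs_of_subset fun x hx => Fml.mem_fvList.2 hx).trans
    (exists_congr fun v => t.realize_matrix α α' v)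
  refine Struc.realize_bigOr.trans ⟨?_, ?_⟩
  · rintro ⟨φ, hφ, hv⟩
    obtain ⟨t, ht, rfl⟩ := List.mem_map.1 hφ
    exact ⟨t, ht, (h t).1 hv⟩
  · rintro ⟨t, ht, hv⟩
    exact ⟨_, List.mem_map.2 ⟨t, ht, rfl⟩, (h t).2 hv⟩

theorem fv_stepFml : S.stepFml.fv = ∅ := by
  refine Set.eq_empty_of_forall_notMem fun x hx => ?_
  obtain ⟨φ, hφ, hx⟩ := Fml.mem_fv_bigOr.1 hx
  obtain ⟨t, -, rfl⟩ := List.mem_map.1 hφ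
  obtain ⟨h₁, h₂⟩ := Fml.mem_fv_exs.1 hx
  exact h₂ (Fml.mem_fvList.2 h₁)

-- The bound depends only on the fixed system, so the preimage algorithm may contain it as a
-- constant.
variable (S) in
theorem exists_small_stepFml : ∃ b, Small b S.stepFml := by
  let K := (S.τ.map fun t => t.matrix.fvList.length).sum
  refine ⟨K, Small.bigOr fun φ hφ => ?_⟩
  obtain ⟨t, ht, rfl⟩ := List.mem_map.1 hφ
  refine (t.univ_matrix.small.exs _).mono ?_
  rw [zero_add]
  exact List.le_sum_of_mem (List.mem_map.2 ⟨t, ht, rfl⟩)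

/-- Preimages can be computed over small sets of entries. -/
theorem pre_iff_exists_emb {b : ℕ} (hb : Small b S.stepFml) {φ : Fml S.setting.sig}
    (hφ : S.setting.IsState φ) {M : S.setting.ExtStruc} (hM : M.db.Models S.schema.T)
    (α : Assignment M) : S.Pre φ M α ↔ ∃ n : S.setting.ASrt → ℕ,
      (∀ E, n E ≤ φ.code + b + 2) ∧ ∃ j : M.Emb n, S.Pre φ _ (j.pull α) := by
  classical
  constructor
  · rintro ⟨α', h₁, h₂⟩
    obtain ⟨D, hD, hD'⟩ := hb.holds fv_stepFml (M := M.dbl) (α := α.dbl α')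
      fun v => realize_stepFml.2 h₁
    obtain ⟨D₁, hD₁, hD₁'⟩ := hφ.tame.small.holds hφ.closed h₂
    obtain ⟨n, j, hn, hj⟩ := M.exists_emb fun E => D E ∪ D₁ E
    refine ⟨n, fun E => ?_, j, j.pull α', ?_, hD₁' n j fun E e he =>
      hj E e (Finset.mem_union_right _ he)⟩
    -- At most `b + 1` entries are kept for the step and `φ.code + 1` for `φ`.
    · exact ((hn E).trans (Finset.card_union_le _ _)).trans
        ((add_le_add (hD E) (hD₁ E)).trans (by omega))
    · have h := hD' n j.dbl fun E e he => hj E e (Finset.mem_union_left _ he)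
      have h' := j.pull_dbl α α'
      obtain ⟨v⟩ := ((S.setting.finStruc M.db n).withAssignment (j.pull α)).assignNonempty
      exact (realize_stepFml (M := S.setting.finStruc M.db n) (v := v)).1
        ((realize_congr_assignment (W := S.setting.dbl) h' v _).1 (h v))
  · rintro ⟨n, -, j, β, h₁, h₂⟩
    -- The step over the chosen entries extends to all of them, and the state formula, being
    -- existential, remains true.
    obtain ⟨α', h₃, rfl⟩ := Step.extend hM h₁
    exact ⟨α', h₃, hφ.exis.holds hφ.closed j h₂⟩

end RAS

end Extension

end Artifact

namespace Artifact

/-! ## The preimage procedure -/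

section Preimage

open Encodable

variable {L : Sig}

namespace Setting

variable {W : Setting L}

/-- Replacement of the variables of a term by terms for the artifact extension. -/
def _root_.Artifact.Term.toArt (σ : ∀ s, ℕ → Term W.sig (.inl s)) :
    {s : L.Srt} → Term L s → Term W.sig (.inl s)
  | _, .var s m => σ s m
  | _, .cst (s := s) c => Term.cst (L := W.sig) (s := .inl s) (Sum.inl c)
  | _, .app (s := s) (s' := s') f t =>
    Term.app (L := W.sig) (s := .inl s) (s' := .inl s') f (t.toArt σ)

/-- Replacement of the variables of a quantifier-free formula by terms for the artifact
extension. -/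
def _root_.Artifact.Fml.toArt (σ : ∀ s, ℕ → Term W.sig (.inl s)) : Fml L → Fml W.sig
  | .fls => .fls
  | .eq (s := s) t u => Fml.eq (L := W.sig) (s := .inl s) (t.toArt σ) (u.toArt σ)
  | .neg φ => .neg (φ.toArt σ)
  | .and φ ψ => .and (φ.toArt σ) (ψ.toArt σ)
  | .ex _ _ => .fls

variable {σ : ∀ s, ℕ → Term W.sig (.inl s)}

theorem eval_toArt {M : W.ExtStruc} {α : Assignment M} (w : (M.withAssignment α).Assign)
    {s : L.Srt} (t : Term L s) : (t.toArt σ).eval (M.withAssignment α) w =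
      t.eval M.db fun s m => (σ s m).eval (M.withAssignment α) w := by
  induction t with
  | var s m => rfl
  | cst c => rfl
  | app f t ih => exact congrArg (M.db.fn f) ih

theorem realize_toArt {M : W.ExtStruc} {α : Assignment M} (w : (M.withAssignment α).Assign)
    {φ : Fml L} (h : φ.IsQF) : (M.withAssignment α).Realize w (φ.toArt σ) ↔
      M.db.Realize (fun s m => (σ s m).eval (M.withAssignment α) w) φ := by
  induction φ with
  | fls => rfl
  | eq t u => exact Eq.congr (eval_toArt w t) (eval_toArt w u)
  | neg φ ih => exact not_congr (ih h)
  | and φ ψ ih₁ ih₂ => exact and_congr (ih₁ h.1) (ih₂ h.2)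
  | ex x φ => exact h.elim

theorem isQF_toArt (φ : Fml L) : (φ.toArt σ).IsQF := by
  induction φ with
  | fls => trivial
  | eq t u => trivial
  | neg φ ih => exact ih
  | and φ ψ ih₁ ih₂ => exact ⟨ih₁, ih₂⟩
  | ex x φ => trivial

theorem mem_vars_toArt {s : L.Srt} {t : Term L s} {y : W.sig.Var} (hy : y ∈ (t.toArt σ).vars) :
    ∃ x ∈ t.vars, y ∈ (σ x.1 x.2).vars := by
  induction t with
  | var s m => exact ⟨(s, m), rfl, hy⟩
  | cst c => exact hy.elim
  | app f t ih => exact ih hy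

theorem mem_fv_toArt {φ : Fml L} (h : φ.IsQF) {y : W.sig.Var} (hy : y ∈ (φ.toArt σ).fv) :
    ∃ x ∈ φ.fv, y ∈ (σ x.1 x.2).vars := by
  induction φ with
  | fls => exact hy.elim
  | eq t u =>
    rcases hy with hy | hy
    · obtain ⟨x, hx, hy⟩ := mem_vars_toArt hy
      exact ⟨x, Or.inl hx, hy⟩
    · obtain ⟨x, hx, hy⟩ := mem_vars_toArt hy
      exact ⟨x, Or.inr hx, hy⟩
  | neg φ ih => exact ih h hy
  | and φ ψ ih₁ ih₂ =>
    rcases hy with hy | hy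
    · obtain ⟨x, hx, hy⟩ := ih₁ h.1 hy
      exact ⟨x, Or.inl hx, hy⟩
    · obtain ⟨x, hx, hy⟩ := ih₂ h.2 hy
      exact ⟨x, Or.inr hx, hy⟩
  | ex x φ => exact h.elim

/-! ### The variables that serve as names -/

variable (W) in
/-- The variables used by the names with index `i`, for entries with numbers bounded by `n`. -/
noncomputable def nameList (i : ℕ) (n : W.ASrt → ℕ) : List L.Var :=
  ((finList (Σ s, W.X s)).map fun y => (y.1, 3 * Nat.pair i (encode y.2) + 1)) ++
  (finList (Σ E s, W.A E s)).flatMap fun b => (List.range (n b.1 + 1)).map fun k =>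
    (b.2.1, 3 * Nat.pair i (Nat.pair (Nat.pair (encode b.1) (encode b.2.2)) k) + 2)

theorem mem_nameList {i : ℕ} {n : W.ASrt → ℕ} {y : L.Var} : y ∈ W.nameList i n ↔
    (∃ (s : L.Srt) (x : W.X s), y ∈ ((W.stdNames i).x x).vars) ∨
      ∃ (E : W.ASrt) (s : L.Srt) (b : W.A E s) (k : ℕ), k ≤ n E ∧
        y ∈ ((W.stdNames i).a b k).vars := by
  simp only [nameList, List.mem_append, List.mem_map, List.mem_flatMap, mem_finList, true_and,
    List.mem_range, Nat.lt_succ_iff]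
  refine or_congr ⟨?_, ?_⟩ ⟨?_, ?_⟩
  · rintro ⟨⟨s, x⟩, rfl⟩
    exact ⟨s, x, rfl⟩
  · rintro ⟨s, x, rfl⟩
    exact ⟨⟨s, x⟩, rfl⟩
  · rintro ⟨⟨E, s, b⟩, k, hk, rfl⟩
    exact ⟨E, s, b, k, hk, rfl⟩
  · rintro ⟨E, s, b, k, hk, rfl⟩
    exact ⟨⟨E, s, b⟩, k, hk, rfl⟩

/-- The index is part of the variable number, so quantifying the names with one index leaves those
with another untouched. -/
theorem notMem_nameList {i j : ℕ} (h : i ≠ j) {n n' : W.ASrt → ℕ} {y : L.Var}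
    (hy : y ∈ W.nameList i n) : y ∉ W.nameList j n' := by
  intro hy'
  rcases mem_nameList.1 hy with ⟨s, x, hx⟩ | ⟨E, s, b, k, -, hx⟩ <;>
    rcases mem_nameList.1 hy' with ⟨s', x', hx'⟩ | ⟨E', s', b', k', -, hx'⟩ <;>
    · have h₁ := (congrArg Prod.snd (Set.mem_singleton_iff.1 hx)).symm.trans
        (congrArg Prod.snd (Set.mem_singleton_iff.1 hx'))
      simp only [] at h₁
      -- Names of different kinds differ modulo 3; names of the same kind differ in the index inside
      -- the pairing.
      first
        | omega
        | exact h (Nat.pair_eq_pair.1 (Nat.eq_of_mul_eq_mul_left three_pos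
            (Nat.add_right_cancel h₁))).1

theorem stdNames_assign_congr {i : ℕ} {n : W.ASrt → ℕ} {N : Struc L} {u u' : N.Assign}
    (h : ∀ y ∈ W.nameList i n, u y.1 y.2 = u' y.1 y.2) :
    (W.stdNames i).assign N u n = (W.stdNames i).assign N u' n :=
  Assignment.ext' (fun s y => h (s, _) (mem_nameList.2 (Or.inl ⟨s, y, rfl⟩))) fun E s b k =>
    h (s, _) (mem_nameList.2 (Or.inr ⟨E, s, b, _, Nat.lt_succ_iff.1 (Fin.isLt k), rfl⟩))

variable (W) in
/-- The terms named by the variables used as names with index `0`: the artifact variables, and the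
artifact components applied to the individual variables. -/
def stdSubst (s : L.Srt) (p : ℕ) : Term W.sig (.inl s) :=
  if p % 3 = 1 then
    match (decode (p / 3).unpair.2 : Option (W.X s)) with
    | some y => Term.cst (L := W.sig) (s := .inl s) (Sum.inr y)
    | none => Term.var (L := W.sig) (.inl s) p
  else
    match (decode (p / 3).unpair.2.unpair.1.unpair.1 : Option W.ASrt) with
    | some E =>
      match (decode (p / 3).unpair.2.unpair.1.unpair.2 : Option (W.A E s)) with
      | some b => Term.app (L := W.sig) (s := .inr E) (s' := .inl s) b
          (Term.var (L := W.sig) (.inr E) (p / 3).unpair.2.unpair.2)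
      | none => Term.var (L := W.sig) (.inl s) p
    | none => Term.var (L := W.sig) (.inl s) p

theorem stdSubst_x {s : L.Srt} (y : W.X s) (i : ℕ) :
    W.stdSubst s (3 * Nat.pair i (encode y) + 1) =
      Term.cst (L := W.sig) (s := .inl s) (Sum.inr y) := by
  have h₁ : (3 * Nat.pair i (encode y) + 1) % 3 = 1 := by omega
  have h₂ : (3 * Nat.pair i (encode y) + 1) / 3 = Nat.pair i (encode y) := by omega
  unfold stdSubst
  rw [if_pos h₁]
  simp only [h₂, Nat.unpair_pair, encodek]

theorem stdSubst_a {E : W.ASrt} {s : L.Srt} (b : W.A E s) (i k : ℕ) :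
    W.stdSubst s (3 * Nat.pair i (Nat.pair (Nat.pair (encode E) (encode b)) k) + 2) =
      Term.app (L := W.sig) (s := .inr E) (s' := .inl s) b
        (Term.var (L := W.sig) (.inr E) k) := by
  have h₁ : ¬ (3 * Nat.pair i (Nat.pair (Nat.pair (encode E) (encode b)) k) + 2) % 3 = 1 := by
    omega
  have h₂ : (3 * Nat.pair i (Nat.pair (Nat.pair (encode E) (encode b)) k) + 2) / 3 =
    Nat.pair i (Nat.pair (Nat.pair (encode E) (encode b)) k) := by omega
  unfold stdSubst
  rw [if_neg h₁]
  simp only [h₂, Nat.unpair_pair, encodek]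

theorem mem_vars_stdSubst {i : ℕ} {n : W.ASrt → ℕ} {x : L.Var} (hx : x ∈ W.nameList i n)
    {y : W.sig.Var} (hy : y ∈ (W.stdSubst x.1 x.2).vars) :
    ∃ (E : W.ASrt) (k : ℕ), k ≤ n E ∧ y = ((.inr E, k) : W.sig.Var) := by
  rcases mem_nameList.1 hx with ⟨s, z, rfl⟩ | ⟨E, s, b, k, hk, rfl⟩
  · have : y ∈ (Term.cst (L := W.sig) (s := .inl s) (Sum.inr z)).vars := stdSubst_x z i ▸ hy
    exact this.elim
  · have : y ∈ (Term.app (L := W.sig) (s := .inr E) (s' := .inl s) b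
        (Term.var (L := W.sig) (.inr E) k)).vars := stdSubst_a b i k ▸ hy
    exact ⟨E, k, hk, this⟩

/-- Substitution undoes naming: if variable `k` denotes the `k`-th chosen entry, the substituted
terms evaluate to the actual values of the artifact variables and components. -/
theorem stdNames_assign_stdSubst {M : W.ExtStruc} {α : Assignment M}
    (w : (M.withAssignment α).Assign) {n : W.ASrt → ℕ} (j : M.Emb n)
    (hj : ∀ E k, j.f E k = w (.inr E) k.val) : (W.stdNames 0).assign M.db
      (fun s m => (W.stdSubst s m).eval (M.withAssignment α) w) n = j.pull α := by
  refine Assignment.ext' (fun s y => ?_) fun E s b k => ?_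
  · exact congrArg (Term.eval (M.withAssignment α) w) (stdSubst_x y 0)
  · exact (congrArg (Term.eval (M.withAssignment α) w) (stdSubst_a b 0 k.val)).trans
      (congrArg (α.a b) (hj E k).symm)

/-! ### Distinct entries -/

variable (W) in
/-- The variables with numbers bounded by `N` of the artifact sorts. -/
noncomputable def entryVars (N : ℕ) : List W.sig.Var :=
  (finList W.ASrt).flatMap fun E => (List.range (N + 1)).map fun k => (.inr E, k)

theorem mem_entryVars {N : ℕ} {y : W.sig.Var} :
    y ∈ W.entryVars N ↔ ∃ (E : W.ASrt) (k : ℕ), k ≤ N ∧ y = ((.inr E, k) : W.sig.Var) := by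
  simp only [entryVars, List.mem_flatMap, mem_finList, true_and, List.mem_map, List.mem_range,
    Nat.lt_succ_iff, eq_comm]

variable (W) in
/-- The values of the variables of artifact sorts with numbers bounded by `n` are distinct. -/
noncomputable def distinctFml (n : W.ASrt → ℕ) : Fml W.sig :=
  Fml.bigAnd <| (finList W.ASrt).flatMap fun E => (List.range (n E + 1)).flatMap fun k =>
    (List.range k).map fun l => Fml.neg (Fml.eq (L := W.sig) (s := .inr E)
      (Term.var (L := W.sig) (.inr E) k) (Term.var (L := W.sig) (.inr E) l))

theorem mem_distinctFml {n : W.ASrt → ℕ} {p : Fml W.sig → Prop} :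
    (∀ φ ∈ (finList W.ASrt).flatMap fun E => (List.range (n E + 1)).flatMap fun k =>
    (List.range k).map fun l => Fml.neg (Fml.eq (L := W.sig) (s := .inr E)
      (Term.var (L := W.sig) (.inr E) k) (Term.var (L := W.sig) (.inr E) l)), p φ) ↔
    ∀ (E : W.ASrt) (k l : ℕ), k ≤ n E → l < k → p (Fml.neg (Fml.eq (L := W.sig) (s := .inr E)
      (Term.var (L := W.sig) (.inr E) k) (Term.var (L := W.sig) (.inr E) l))) := by
  constructor
  · intro h E k l hk hl
    exact h _ (List.mem_flatMap.2 ⟨E, mem_finList _, List.mem_flatMap.2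
      ⟨k, List.mem_range.2 (Nat.lt_succ_iff.2 hk), List.mem_map.2 ⟨l, List.mem_range.2 hl, rfl⟩⟩⟩)
  · intro h φ hφ
    obtain ⟨E, -, hφ⟩ := List.mem_flatMap.1 hφ
    obtain ⟨k, hk, hφ⟩ := List.mem_flatMap.1 hφ
    obtain ⟨l, hl, rfl⟩ := List.mem_map.1 hφ
    exact h E k l (Nat.lt_succ_iff.1 (List.mem_range.1 hk)) (List.mem_range.1 hl)

theorem isQF_distinctFml (n : W.ASrt → ℕ) : (W.distinctFml n).IsQF :=
  Fml.isQF_bigAnd.2 (mem_distinctFml.2 fun _ _ _ _ _ => trivial)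

theorem mem_fv_distinctFml {n : W.ASrt → ℕ} {y : W.sig.Var} (hy : y ∈ (W.distinctFml n).fv) :
    ∃ (E : W.ASrt) (k : ℕ), k ≤ n E ∧ y = ((.inr E, k) : W.sig.Var) := by
  obtain ⟨φ, hφ, hy⟩ := Fml.mem_fv_bigAnd.1 hy
  revert φ
  refine mem_distinctFml.2 fun E k l hk hl hy => ?_
  rcases hy with hy | hy
  · exact ⟨E, k, hk, hy⟩
  · exact ⟨E, l, hl.le.trans hk, hy⟩

/-- Distinctness is needed because the translation treats entries with different numbers as
different. -/
theorem realize_distinctFml {n : W.ASrt → ℕ} {M : W.ExtStruc} {α : Assignment M}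
    {w : (M.withAssignment α).Assign} : (M.withAssignment α).Realize w (W.distinctFml n) ↔
      ∃ j : M.Emb n, ∀ E k, j.f E k = w (.inr E) k.val := by
  refine (Struc.realize_bigAnd.trans mem_distinctFml).trans ⟨fun h => ?_, ?_⟩
  · refine ⟨⟨fun E k => w (.inr E) k.val, fun E k l hkl => ?_⟩, fun _ _ => rfl⟩
    rcases lt_trichotomy k l with hlt | heq | hgt
    · exact (h E l k (Nat.lt_succ_iff.1 l.isLt) hlt hkl.symm).elim
    · exact heq
    · exact (h E k l (Nat.lt_succ_iff.1 k.isLt) hgt hkl).elim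
  · rintro ⟨j, hj⟩ E k l hk hl heq
    have hk' : k < n E + 1 := Nat.lt_succ_iff.2 hk
    have heq' : j.f E ⟨k, hk'⟩ = j.f E ⟨l, hl.trans hk'⟩ :=
      (hj E ⟨k, hk'⟩).trans (Eq.trans heq (hj E ⟨l, hl.trans hk'⟩).symm)
    exact hl.ne' (congrArg Fin.val (j.inj E heq'))

end Setting

/-! ### The preimage as a state formula. -/

namespace RAS

open Setting

variable (S : RAS)

/-- The preimage of `φ` over entries numbered up to `n`. -/
noncomputable def preFml (n : S.setting.ASrt → ℕ) (φ : Fml S.setting.sig) : Fml S.schema.sig :=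
  Fml.exs (S.setting.nameList 1 n) <| Fml.and
    (((S.setting.stdNames 0).dbl (S.setting.stdNames 1)).tr (W := S.setting.dbl) (n := n)
      (copyVar 0) (zeroEnv n) S.stepFml)
    ((S.setting.stdNames 1).tr (copyVar 0) (zeroEnv n) φ)

variable {S}

/-- The translated formulae are closed and the names with index 1 are quantified away. What remains
has a meaning in the artifact extension, so the result of quantifier elimination can be translated
back. -/
theorem fv_preFml {n : S.setting.ASrt → ℕ} {φ : Fml S.setting.sig} (hφ : φ.fv = ∅)
    {y : S.schema.sig.Var} (hy : y ∈ (S.preFml n φ).fv) : y ∈ S.setting.nameList 0 n := by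
  obtain ⟨hy, hy'⟩ := Fml.mem_fv_exs.1 hy
  rcases hy with hy | hy
  · rcases Names.mem_fv_tr hy with ⟨m, -, h⟩ | ⟨s, x, h⟩ | ⟨E, s, b, k, hk, h⟩
    · rw [fv_stepFml] at h
      exact h.elim
    · rcases x with x | x
      · exact mem_nameList.2 (Or.inl ⟨s, x, h⟩)
      · exact (hy' (mem_nameList.2 (Or.inl ⟨s, x, h⟩))).elim
    · rcases b with b | b
      · exact mem_nameList.2 (Or.inr ⟨E, s, b, k, hk, h⟩)
      · exact (hy' (mem_nameList.2 (Or.inr ⟨E, s, b, k, hk, h⟩))).elim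
  · rcases Names.mem_fv_tr hy with ⟨m, -, h⟩ | h
    · rw [hφ] at h
      exact h.elim
    · exact (hy' (mem_nameList.2 h)).elim

/-- Over finitely many entries an assignment is a finite tuple, so the quantifiers over the names
with index 1 range over exactly the possible values of the primed variables and components. -/
theorem realize_preFml {n : S.setting.ASrt → ℕ} {φ : Fml S.setting.sig} (hφ : φ.fv = ∅)
    {N : Struc S.schema.sig} {u : N.Assign} : N.Realize u (S.preFml n φ) ↔
      S.Pre φ (S.setting.finStruc N n) ((S.setting.stdNames 0).assign N u n) := by
  have key : ∀ u : N.Assign, N.Realize u (Fml.and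
      (((S.setting.stdNames 0).dbl (S.setting.stdNames 1)).tr (W := S.setting.dbl) (n := n)
        (copyVar 0) (zeroEnv n) S.stepFml)
      ((S.setting.stdNames 1).tr (copyVar 0) (zeroEnv n) φ)) ↔
      S.Step (S.setting.finStruc N n) ((S.setting.stdNames 0).assign N u n)
          ((S.setting.stdNames 1).assign N u n) ∧
        (S.setting.finStruc N n).Holds ((S.setting.stdNames 1).assign N u n) φ := by
    intro u
    refine and_congr ?_ ((stdNames_fresh 1 0).holds_iff hφ u _)
    refine (((stdNames_fresh 0 0).dbl (stdNames_fresh 1 0)).realize_tr _ u _).trans ?_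
    exact (realize_congr_assignment (Names.assign_dbl _ _ N u n) _ _).trans
      (realize_stepFml (M := S.setting.finStruc N n))
  rw [preFml, N.realize_exs]
  simp only [key]
  constructor
  · rintro ⟨u', h, h₁, h₂⟩
    have h₀ : (S.setting.stdNames 0).assign N u' n = (S.setting.stdNames 0).assign N u n :=
      stdNames_assign_congr fun y hy => h _ _ (notMem_nameList zero_ne_one hy)
    exact ⟨_, h₀ ▸ h₁, h₂⟩
  · classical
    rintro ⟨α', h₁, h₂⟩
    obtain ⟨u₁, hu₁⟩ := exists_stdNames_assign (W := S.setting) N n (fun _ => α') fun _ => u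
    -- Only the finitely many quantified names are changed; all other values remain those of `u`.
    let u' : N.Assign := fun s m =>
      if ((s, m) : S.schema.sig.Var) ∈ S.setting.nameList 1 n then u₁ s m else u s m
    have h₃ : (S.setting.stdNames 0).assign N u' n = (S.setting.stdNames 0).assign N u n :=
      stdNames_assign_congr fun y hy => if_neg (notMem_nameList zero_ne_one hy)
    have h₄ : (S.setting.stdNames 1).assign N u' n = α' :=
      (stdNames_assign_congr fun y hy => if_pos hy).trans (hu₁ 1).2
    exact ⟨u', fun s m hm => if_neg hm, by rw [h₃, h₄]; exact ⟨h₁, h₂⟩⟩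

variable (S) in
/-- The preimage of `φ`, as a state formula: there are entries, in numbers given by one of the lists
in `V`, over which the preimage holds. -/
noncomputable def preState (qe : Fml S.schema.sig → Fml S.schema.sig) (V : List (List ℕ)) (N : ℕ)
    (φ : Fml S.setting.sig) : Fml S.setting.sig :=
  Fml.exs (S.setting.entryVars N) <| Fml.bigOr <| V.map fun v =>
    Fml.and (S.setting.distinctFml (S.setting.sizes v))
      ((qe (S.preFml (S.setting.sizes v) φ)).toArt S.setting.stdSubst)

variable {qe : Fml S.schema.sig → Fml S.schema.sig} {V : List (List ℕ)} {N : ℕ}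
  {φ : Fml S.setting.sig}

theorem isState_preState (hqe : ∀ φ, (qe φ).IsQF ∧ (qe φ).fv ⊆ φ.fv)
    (hV : ∀ v ∈ V, ∀ E, S.setting.sizes v E ≤ N) (hφ : φ.fv = ∅) :
    S.setting.IsState (S.preState qe V N φ) := by
  refine ⟨_, _, fun y hy => ?_, ?_, rfl, ?_⟩
  · obtain ⟨E, k, -, rfl⟩ := mem_entryVars.1 hy
    exact ⟨E, rfl⟩
  · refine Fml.isQF_bigOr.2 fun ψ hψ => ?_
    obtain ⟨v, -, rfl⟩ := List.mem_map.1 hψ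
    exact ⟨isQF_distinctFml _, isQF_toArt _⟩
  · refine Set.eq_empty_of_forall_notMem fun y hy => ?_
    obtain ⟨hy, hy'⟩ := Fml.mem_fv_exs.1 hy
    obtain ⟨ψ, hψ, hy⟩ := Fml.mem_fv_bigOr.1 hy
    obtain ⟨v, hv, rfl⟩ := List.mem_map.1 hψ
    suffices H : ∃ (E : S.setting.ASrt) (k : ℕ), k ≤ S.setting.sizes v E ∧
        y = ((.inr E, k) : S.setting.sig.Var) by
      obtain ⟨E, k, hk, rfl⟩ := H
      exact hy' (mem_entryVars.2 ⟨E, k, hk.trans (hV v hv E), rfl⟩)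
    rcases hy with hy | hy
    · exact mem_fv_distinctFml hy
    · obtain ⟨x, hx, hy⟩ := mem_fv_toArt (hqe _).1 hy
      exact mem_vars_stdSubst (fv_preFml hφ ((hqe _).2 hx)) hy

/-- The existential prefix chooses the entries, the distinctness formula makes the choice injective,
and the remaining conjunct says that the preimage holds over them. -/
theorem holds_preState (hqf : ∀ φ, (qe φ).IsQF) {M : S.setting.ExtStruc}
    (hqe : ∀ φ (u : M.db.Assign), M.db.Realize u φ ↔ M.db.Realize u (qe φ))
    (hst : S.setting.IsState (S.preState qe V N φ)) (hφ : φ.fv = ∅) (α : Assignment M) :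
    M.Holds α (S.preState qe V N φ) ↔
      ∃ v ∈ V, ∃ j : M.Emb (S.setting.sizes v), S.Pre φ _ (j.pull α) := by
  obtain ⟨w₀⟩ := (M.withAssignment α).assignNonempty
  have hfv : ∀ y ∈ (Fml.bigOr (V.map fun v => Fml.and (S.setting.distinctFml (S.setting.sizes v))
      ((qe (S.preFml (S.setting.sizes v) φ)).toArt S.setting.stdSubst))).fv,
      y ∈ S.setting.entryVars N := by
    intro y hy
    by_contra hy'
    have : y ∈ (S.preState qe V N φ).fv := Fml.mem_fv_exs.2 ⟨hy, hy'⟩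
    rw [hst.closed] at this
    exact this
  have key : ∀ v (w : (M.withAssignment α).Assign), (M.withAssignment α).Realize w
      (Fml.and (S.setting.distinctFml (S.setting.sizes v))
        ((qe (S.preFml (S.setting.sizes v) φ)).toArt S.setting.stdSubst)) ↔
      ∃ j : M.Emb (S.setting.sizes v), (∀ E k, j.f E k = w (.inr E) k.val) ∧
        S.Pre φ _ (j.pull α) := by
    intro v w
    refine (and_congr realize_distinctFml ((realize_toArt w (hqf _)).trans
      ((hqe _ _).symm.trans (realize_preFml hφ)))).trans ?_
    constructor
    · rintro ⟨⟨j, hj⟩, h⟩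
      rw [stdNames_assign_stdSubst w j hj] at h
      exact ⟨j, hj, h⟩
    · rintro ⟨j, hj, h⟩
      rw [stdNames_assign_stdSubst w j hj]
      exact ⟨⟨j, hj⟩, h⟩
  refine (Struc.true_iff_realize hst.closed w₀).trans ((Struc.realize_exs_of_subset hfv).trans ?_)
  constructor
  · rintro ⟨w, hw⟩
    obtain ⟨ψ, hψ, hw⟩ := Struc.realize_bigOr.1 hw
    obtain ⟨v, hv, rfl⟩ := List.mem_map.1 hψ
    obtain ⟨j, -, h⟩ := (key v w).1 hw
    exact ⟨v, hv, j, h⟩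
  · rintro ⟨v, hv, j, h⟩
    let w : (M.withAssignment α).Assign := fun σ =>
      match σ with
      | .inl s => fun m => w₀ (.inl s) m
      -- Numbers beyond the size wrap around; only those in range have to denote the chosen entries.
      | .inr E => fun m => j.f E (Fin.ofNat _ m)
    refine ⟨w, Struc.realize_bigOr.2 ⟨_, List.mem_map.2 ⟨v, hv, rfl⟩,
      (key v w).2 ⟨j, fun E k => congrArg (j.f E) (Fin.ofNat_val_eq_self k).symm, h⟩⟩⟩

end RAS

end Preimage

end Artifact

namespace Artifact

/-! ## The preimage procedure is computable -/

section Effective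

open Encodable Setting Primrec

variable {L : Sig}

/-- The list of symbols or sorts is fixed by the setting, so its type needs no coding. -/
theorem primrec_flatMap_const {ι α β : Type*} [Primcodable α] [Primcodable β] (l : List ι)
    {g : ι → α → List β} (h : ∀ i, Primrec (g i)) :
    Primrec fun x => l.flatMap fun i => g i x := by
  induction l with
  | nil => exact Primrec.const _
  | cons i l ih => exact Primrec.list_append.comp (h i) ih

namespace Setting

variable {W : Setting L}

/-- As only variables that serve as names have to be handled, the algorithm copies the codes
contained in the variable number and need not check that they decode. -/
theorem exists_primrec_toArt_term : ∃ f : ℕ → ℕ, Primrec f ∧ ∀ {i : ℕ} {n : W.ASrt → ℕ} {s : L.Srt}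
    (t : Term L s), (∀ x ∈ t.vars, x ∈ W.nameList i n) → f t.code = (t.toArt W.stdSubst).code := by
  let calls : ℕ → List ℕ := fun c =>
    if c.unpair.1 = 2 then [c.unpair.2.unpair.2.unpair.2] else []
  let combine : ℕ → List ℕ → ℕ := fun c vs =>
    if c.unpair.1 = 0 then
      if c.unpair.2.unpair.2 % 3 = 1 then
        Nat.pair 1 (Nat.pair (2 * c.unpair.2.unpair.1)
          (2 * (c.unpair.2.unpair.2 / 3).unpair.2 + 1))
      else Nat.pair 2 (Nat.pair
        (Nat.pair (2 * (c.unpair.2.unpair.2 / 3).unpair.2.unpair.1.unpair.1 + 1)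
          (2 * c.unpair.2.unpair.1))
        (Nat.pair (c.unpair.2.unpair.2 / 3).unpair.2.unpair.1.unpair.2
          (Nat.pair 0 (Nat.pair (2 * (c.unpair.2.unpair.2 / 3).unpair.2.unpair.1.unpair.1 + 1)
            (c.unpair.2.unpair.2 / 3).unpair.2.unpair.2))))
    else if c.unpair.1 = 1 then
      Nat.pair 1 (Nat.pair (2 * c.unpair.2.unpair.1) (2 * c.unpair.2.unpair.2))
    else Nat.pair 2 (Nat.pair
      (Nat.pair (2 * c.unpair.2.unpair.1.unpair.1) (2 * c.unpair.2.unpair.1.unpair.2))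
      (Nat.pair c.unpair.2.unpair.2.unpair.1 (vs.getD 0 0)))
  obtain ⟨f, hf, hf'⟩ := exists_rec (m := fun c : ℕ => c) (calls := calls) (combine := combine)
    (by fun_prop) (by fun_prop) (by fun_prop) (by
      intro c c' hc
      dsimp only [calls] at hc
      split_ifs at hc with h
      · obtain rfl := List.mem_singleton.1 hc
        exact lt_of_le_of_lt ((Nat.unpair_right_le _).trans (Nat.unpair_right_le _))
          (unpair_snd_lt (by omega))
      · simp at hc)
  refine ⟨f, hf, fun {i n s} t ht => ?_⟩
  induction t with
  | var s m =>
    have h₁ : ∀ q, (3 * q + 1) % 3 = 1 := fun q => by omega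
    have h₂ : ∀ q, (3 * q + 1) / 3 = q := fun q => by omega
    have h₃ : ∀ q, (3 * q + 2) % 3 = 2 := fun q => by omega
    have h₄ : ∀ q, (3 * q + 2) / 3 = q := fun q => by omega
    rcases mem_nameList.1 (ht (s, m) rfl) with ⟨s, y, h⟩ | ⟨E, s, b, k, -, h⟩
    · cases h
      have hc : (Term.cst (L := W.sig) (s := .inl s) (Sum.inr y)).code =
        Nat.pair 1 (Nat.pair (2 * encode s) (2 * encode y + 1)) := rfl
      refine Eq.trans ?_ (hc.symm.trans (congrArg Term.code (stdSubst_x y i).symm))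
      rw [hf']
      simp [combine, Term.code, h₁, h₂]
    · cases h
      have hc : (Term.app (L := W.sig) (s := .inr E) (s' := .inl s) b
          (Term.var (L := W.sig) (.inr E) k)).code =
        Nat.pair 2 (Nat.pair (Nat.pair (2 * encode E + 1) (2 * encode s))
          (Nat.pair (encode b) (Nat.pair 0 (Nat.pair (2 * encode E + 1) k)))) := rfl
      refine Eq.trans ?_ (hc.symm.trans (congrArg Term.code (stdSubst_a b i k).symm))
      rw [hf']
      simp [combine, Term.code, h₃, h₄]
  | @cst s c =>
    have hc : (Term.cst (L := W.sig) (s := .inl s) (Sum.inl c)).code =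
      Nat.pair 1 (Nat.pair (2 * encode s) (2 * encode c)) := rfl
    refine Eq.trans ?_ hc.symm
    rw [hf']
    simp [combine, Term.code]
  | @app s s' g t ih =>
    have hc : (Term.app (L := W.sig) (s := .inl s) (s' := .inl s') g (t.toArt W.stdSubst)).code =
      Nat.pair 2 (Nat.pair (Nat.pair (2 * encode s) (2 * encode s'))
        (Nat.pair (encode g) (t.toArt W.stdSubst).code)) := rfl
    refine Eq.trans ?_ hc.symm
    rw [hf']
    simp [combine, calls, Term.code, ih ht]

theorem exists_primrec_toArt : ∃ f : ℕ → ℕ, Primrec f ∧ ∀ {i : ℕ} {n : W.ASrt → ℕ} (φ : Fml L),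
    φ.IsQF → (∀ x ∈ φ.fv, x ∈ W.nameList i n) → f φ.code = (φ.toArt W.stdSubst).code := by
  obtain ⟨g, hg, hg'⟩ := exists_primrec_toArt_term (W := W)
  let calls : ℕ → List ℕ := fun c =>
    if c.unpair.1 = 2 then [c.unpair.2]
    else if c.unpair.1 = 3 then [c.unpair.2.unpair.1, c.unpair.2.unpair.2] else []
  let combine : ℕ → List ℕ → ℕ := fun c vs =>
    if c.unpair.1 = 0 then Nat.pair 0 0
    else if c.unpair.1 = 1 then Nat.pair 1 (Nat.pair (2 * c.unpair.2.unpair.1)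
      (Nat.pair (g c.unpair.2.unpair.2.unpair.1) (g c.unpair.2.unpair.2.unpair.2)))
    else if c.unpair.1 = 2 then Nat.pair 2 (vs.getD 0 0)
    else Nat.pair 3 (Nat.pair (vs.getD 0 0) (vs.getD 1 0))
  obtain ⟨f, hf, hf'⟩ := exists_rec (m := fun c : ℕ => c) (calls := calls) (combine := combine)
    (by fun_prop) (by fun_prop) (by fun_prop) (by
      intro c c' hc
      suffices H : c.unpair.1 ≠ 0 ∧ c' ≤ c.unpair.2 from lt_of_le_of_lt H.2 (unpair_snd_lt H.1)
      dsimp only [calls] at hc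
      split_ifs at hc with h₁ h₂
      · obtain rfl := List.mem_singleton.1 hc
        exact ⟨by omega, le_rfl⟩
      · refine ⟨by omega, ?_⟩
        rcases List.mem_cons.1 hc with rfl | hc
        · exact Nat.unpair_left_le _
        · obtain rfl := List.mem_singleton.1 hc
          exact Nat.unpair_right_le _
      · simp at hc)
  refine ⟨f, hf, fun {i n} φ hφ hfv => ?_⟩
  induction φ with
  | fls =>
    rw [hf']
    simp [combine, Fml.code, Fml.toArt]
  | @eq s t u =>
    have hc : (Fml.eq (L := W.sig) (s := .inl s) (t.toArt W.stdSubst) (u.toArt W.stdSubst)).code =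
      Nat.pair 1 (Nat.pair (2 * encode s)
        (Nat.pair (t.toArt W.stdSubst).code (u.toArt W.stdSubst).code)) := rfl
    refine Eq.trans ?_ hc.symm
    rw [hf', ← hg' t fun x hx => hfv x (Or.inl hx), ← hg' u fun x hx => hfv x (Or.inr hx)]
    simp [combine, Fml.code]
  | neg φ ih =>
    rw [hf']
    simp [combine, calls, Fml.code, Fml.toArt, ih hφ hfv]
  | and φ ψ ih₁ ih₂ =>
    rw [hf']
    simp [combine, calls, Fml.code, Fml.toArt, ih₁ hφ.1 fun x hx => hfv x (Or.inl hx),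
      ih₂ hφ.2 fun x hx => hfv x (Or.inr hx)]
  | ex x φ => exact hφ.elim

variable (W) in
theorem exists_primrec_nameList (i : ℕ) : ∃ f : List ℕ → List ℕ, Primrec f ∧
    ∀ v, f v = (W.nameList i (W.sizes v)).map Fml.codeVar := by
  refine ⟨_, Primrec.list_append.comp (Primrec.const
    ((finList (Σ s, W.X s)).map fun y => Nat.pair (encode y.1) (3 * Nat.pair i (encode y.2) + 1)))
    (primrec_flatMap_const (finList (Σ E s, W.A E s)) (g := fun b v =>
      (List.range (v.getD (encode b.1) 0 + 1)).map fun k => Nat.pair (encode b.2.1)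
        (3 * Nat.pair i (Nat.pair (Nat.pair (encode b.1) (encode b.2.2)) k) + 2))
      fun b => by fun_prop), fun v => ?_⟩
  simp only [nameList, List.map_append, List.map_map, List.map_flatMap]
  rfl

variable (W) in
theorem exists_primrec_entryVars : ∃ f : ℕ → List ℕ, Primrec f ∧
    ∀ N, f N = (W.entryVars N).map Fml.codeVar := by
  refine ⟨_, primrec_flatMap_const (finList W.ASrt) (g := fun E N =>
    (List.range (N + 1)).map fun k => Nat.pair (2 * encode E + 1) k) fun E => by fun_prop,
    fun N => ?_⟩
  simp only [entryVars, List.map_map, List.map_flatMap]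
  rfl

variable (W) in
theorem exists_primrec_distinctFml : ∃ f : List ℕ → ℕ, Primrec f ∧
    ∀ v, f v = (W.distinctFml (W.sizes v)).code := by
  have h := primrec_flatMap_const (finList W.ASrt) (g := fun E (v : List ℕ) =>
    (List.range (v.getD (encode E) 0 + 1)).flatMap fun k => (List.range k).map fun l =>
      Nat.pair 2 (Nat.pair 1 (Nat.pair (2 * encode E + 1)
        (Nat.pair (Nat.pair 0 (Nat.pair (2 * encode E + 1) k))
          (Nat.pair 0 (Nat.pair (2 * encode E + 1) l)))))) fun E => by fun_prop
  refine ⟨_, Fml.primrec_codeBigAnd.comp h, fun v => ?_⟩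
  rw [distinctFml, Fml.code_bigAnd]
  simp only [List.map_map, List.map_flatMap]
  rfl

end Setting

namespace RAS

variable (S : RAS)

theorem exists_primrec_preFml : ∃ f : List ℕ × ℕ → ℕ, Primrec f ∧
    ∀ v (φ : Fml S.setting.sig), f (v, φ.code) = (S.preFml (S.setting.sizes v) φ).code := by
  have hz : Primrec (copyVar 0) := by
    unfold copyVar
    fun_prop
  obtain ⟨f₁, hf₁, hf₁'⟩ := S.setting.exists_primrec_nameList 1
  obtain ⟨f₂, hf₂, hf₂'⟩ := Names.exists_primrec_tr
    ((Names.isPrimrec_stdNames (W := S.setting) 0).dbl (Names.isPrimrec_stdNames 1)) hz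
  obtain ⟨f₃, hf₃, hf₃'⟩ := Names.exists_primrec_tr (Names.isPrimrec_stdNames (W := S.setting) 1) hz
  refine ⟨fun p => Fml.codeExs (f₁ p.1) (Nat.pair 3 (Nat.pair (f₂ ((p.1, []), S.stepFml.code))
    (f₃ ((p.1, []), p.2)))), by fun_prop, fun v φ => ?_⟩
  rw [preFml, Fml.code_exs, ← hf₁']
  refine congrArg (fun c => Fml.codeExs (f₁ v) (Nat.pair 3 c)) (congrArg₂ Nat.pair ?_ ?_)
  · exact hf₂' (zeroEnv_rep _) S.stepFml
  · exact hf₃' (zeroEnv_rep _) φ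

variable {S}

/-- Quantifier elimination is the only ingredient that may fail to be primitive recursive; it is
applied once for each choice of sizes. -/
theorem exists_computable_preState {qe : Fml S.schema.sig → Fml S.schema.sig}
    (hqe : ComputableOn (fun _ => True) qe) (hqe' : ∀ φ, (qe φ).IsQF ∧ (qe φ).fv ⊆ φ.fv)
    {V : ℕ → List (List ℕ)} (hV : Primrec V) (b : ℕ) :
    ComputableOn S.setting.IsState fun φ =>
      S.preState qe (V (φ.code + b + 2)) (φ.code + b + 2) φ := by
  obtain ⟨q, hq, hq'⟩ := hqe
  obtain ⟨f₁, hf₁, hf₁'⟩ := S.setting.exists_primrec_entryVars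
  obtain ⟨f₂, hf₂, hf₂'⟩ := S.setting.exists_primrec_distinctFml
  obtain ⟨f₃, hf₃, hf₃'⟩ := S.exists_primrec_preFml
  obtain ⟨f₄, hf₄, hf₄'⟩ := exists_primrec_toArt (W := S.setting)
  have h₁ : Computable fun p : List ℕ × ℕ => Nat.pair 3 (Nat.pair (f₂ p.1) (f₄ (q p.2))) :=
    (Primrec₂.natPair.to_comp.comp (Computable.const 3) (Primrec₂.natPair.to_comp.comp
      (hf₂.to_comp.comp Computable.fst) (hf₄.to_comp.comp (hq.comp Computable.snd))))
  have h₂ : Primrec fun c : ℕ => (V (c + b + 2)).map fun v => (v, f₃ (v, c)) := by fun_prop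
  have h₃ : Primrec fun p : ℕ × List ℕ => Fml.codeExs (f₁ (p.1 + b + 2)) (Fml.codeBigOr p.2) := by
    fun_prop
  refine ⟨_, h₃.to_comp.comp (Computable.id.pair (h₁.list_map.comp h₂.to_comp)), fun φ hφ => ?_⟩
  change _ = (S.preState qe (V (φ.code + b + 2)) (φ.code + b + 2) φ).code
  rw [preState, Fml.code_exs, Fml.code_bigOr, ← hf₁']
  simp only [List.map_map]
  refine congrArg (fun l => Fml.codeExs _ (Fml.codeBigOr l)) (List.map_congr_left fun v _ => ?_)
  refine congrArg (Nat.pair 3) (congrArg₂ Nat.pair (hf₂' v) ?_)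
  have h₄ : q (f₃ (v, φ.code)) = (qe (S.preFml (S.setting.sizes v) φ)).code := by
    rw [hf₃']
    exact hq' _ trivial
  -- Back-substitution is correct on this input because quantifier elimination adds no free
  -- variables to those of `preFml`.
  exact (congrArg f₄ h₄).trans (hf₄' _ (hqe' _).1 fun x hx => fv_preFml hφ.closed ((hqe' _).2 hx))

/-- The listed sizes are exactly those allowed by `pre_iff_exists_emb`, so the disjunction over them
is the full preimage in models of the completion. -/
theorem exists_preimageProcedure {Tstar : Set (Fml S.schema.sig)}
    (hmc : IsModelCompletion S.schema.T Tstar) :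
    ∃ pq, S.IsPreimageProcedure Tstar pq ∧ ComputableOn S.setting.IsState pq := by
  obtain ⟨qe, h₁, h₂⟩ := hmc.qe
  obtain ⟨V, hV, hV₁, hV₂⟩ := S.setting.exists_sizes
  obtain ⟨b, hb⟩ := S.exists_small_stepFml
  have hqe : ∀ φ, (qe φ).IsQF ∧ (qe φ).fv ⊆ φ.fv := fun φ => ⟨(h₂ φ).1, (h₂ φ).2.1⟩
  refine ⟨_, fun φ hφ => ?_, exists_computable_preState h₁ hqe hV b⟩
  have hst := isState_preState hqe (hV₁ (φ.code + b + 2)) hφ.closed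
  refine ⟨hst, fun M hM α => ?_⟩
  refine (holds_preState (fun φ => (h₂ φ).1) (fun φ u => (h₂ φ).2.2 _ hM u) hst hφ.closed α).trans
    (Iff.trans ?_ (pre_iff_exists_emb hb hφ (fun ψ hψ => hM ψ (hmc.subset hψ)) α).symm)
  constructor
  · rintro ⟨v, hv, h⟩
    exact ⟨_, hV₁ _ v hv, h⟩
  · rintro ⟨n, hn, h⟩
    obtain ⟨v, hv, rfl⟩ := hV₂ _ n hn
    exact ⟨v, hv, h⟩

theorem backwardSearchEffective {Tstar : Set (Fml S.schema.sig)}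
    (hdec : S.schema.DecidableConstraintSat) (hmc : IsModelCompletion S.schema.T Tstar) :
    S.BackwardSearchEffective Tstar := by
  refine ⟨decidableOn_extSatIn hdec ?_, decidableOn_initTSat hdec, exists_preimageProcedure hmc⟩
  rintro χ ⟨φ, B, hφ, hB, rfl⟩
  exact hφ.tame_and_neg hB

end RAS

end Effective

end Artifact

/-! ### The main theorem. -/

theorem theorem4p2 (S : Artifact.RAS)
    (hdec : S.schema.DecidableConstraintSat)
    (hfmp : S.schema.FiniteModelProperty)
    (Tstar : Set (Artifact.Fml S.schema.sig))
    (hmc : Artifact.IsModelCompletion S.schema.T Tstar) :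
    S.BackwardSearchEffective Tstar ∧
    S.BackwardSearchPartiallyCorrect Tstar ∧
    (∀ χ, S.setting.IsExAll χ →
      (S.TSat χ ↔ S.setting.ExtSatIn S.schema.IsInstance χ) ∧
      (S.TSat χ ↔ S.setting.ExtSatIn (fun N => N.Models Tstar) χ)) ∧
    Artifact.DecidableOn S.setting.IsExAll S.TSat := by
  exact ⟨Artifact.RAS.backwardSearchEffective hdec hmc,
    Artifact.RAS.backwardSearchPartiallyCorrect hfmp hmc,
    fun χ hχ => Artifact.RAS.tSat_iff_of_isExAll hfmp hmc hχ,
    Artifact.Setting.decidableOn_extSatIn hdec fun χ hχ => hχ.tame⟩
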